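/- **Conventions.** Let $\mathbb{K}$ be a field. All vector spaces are $\mathbb{K}$-vector spaces graded by an abelian group $\Gamma$ with a homomorphism $g\mapsto(-1)^g\in\{\pm1\}$ and a distinguished degree $1\in\Gamma$ with $(-1)^1=-1$ (for example $\Gamma=\mathbb{Z}$ or $\mathbb{Z}/2$). The shift is $(sV)^g=V^{g+1}$, and $(f\otimes g)(v\otimes w)=(-1)^{|g||v|}f(v)\otimes g(w)$. For a graded vector space $A$ let $BA=\bigoplus_{n\ge0}(sA)^{\otimes n}$ with the deconcatenation coproduct $\Delta$, and $(BA)_{\le n}=\bigoplus_{i\le n}(sA)^{\otimes i}$. *Algebras and modules.* A (strictly unital) $A_\infty$-algebra is a graded vector space $A$ with degree $1$ maps $\mu^n:(sA)^{\otimes n}\to sA$, $n\ge1$, such that $\sum_{k,r}\mu^{n-k+1}\circ(\mathbf 1^{\otimes r}\otimes\mu^k\otimes\mathbf 1^{\otimes(n-r-k)})=0$ for all $n$, and an element $e\in A^0$ with $\mu^2(e\otimes a)=a$, $\mu^2(a\otimes e)=-(-1)^{|a|}a$ ($|a|$ the degree in $sA$), and $\mu^n(\dots,e,\dots)=0$ for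 $n\neq2$. Let $b=\sum\mathbf 1^{\otimes r}\otimes\mu^k\otimes\mathbf 1^{\otimes t}$ be the resulting differential of $BA$. A left $A$-module is a graded vector space $P$ with a degree $1$ map $\mu_P:BA\otimes P\to P$ with $\mu_P\circ\big((\mathbf 1\otimes\mu_P)(\Delta\otimes\mathbf 1)+b\otimes\mathbf 1\big)=0$, $\mu_P(e\otimes p)=p$, and $\mu_P([a_1|\cdots|a_n]\otimes p)=0$ if $n\ge2$ and some $a_i=e$. A right $A$-module is a graded vector space $Q$ with a degree $1$ map $\mu_Q:Q\otimes BA\to Q$ with $\mu_Q\circ\big((\mu_Q\otimes\mathbf 1)(\mathbf 1\otimes\Delta)+\mathbf 1\otimes b\big)=0$, $\mu_Q(q\otimes e)=-(-1)^{|q|}q$, and $\mu_Q(q\otimes[a_1|\cdots|a_n])=0$ if $n\ge2$ and some $a_i=e$. *Tensor product.* For a right $A$-module $Q$ and a left $A$-module $P$, the filtered complex $Q\otimes_AP$ is $Q\otimes BA\otimes P$ with differential $(\mu_Q\otimes\mathbf 1\otimes\mathbf 1)(\mathbf 1\otimes\Delta\otimes\mathbf 1)+\mathbf 1\otimes b\otimes\mathbf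 1+(\mathbf 1\otimes\mathbf 1\otimes\mu_P)(\mathbf 1\otimes\Delta\otimes\mathbf 1)$ and increasing filtration $F_n=Q\otimes(BA)_{\le n}\otimes P$, $n\in\mathbb{Z}$. *Internal Hom.* For left $A$-modules $P,N$, the complex $\mathcal{H}om_A(P,N)$ consists in degree $k$ of the maps $\phi:BA\otimes P\to N$ of degree $k$ with $\phi([a_1|\cdots|a_n]\otimes p)=0$ whenever some $a_i=e$; its differential is $d\phi=\phi\circ(\mathbf 1\otimes\mu_P)(\Delta\otimes\mathbf 1)+\phi\circ(b\otimes\mathbf 1)-(-1)^k\mu_N\circ(\mathbf 1\otimes\phi)(\Delta\otimes\mathbf 1)$, and its increasing filtration is $F_n=\{\phi:\phi|_{(sA)^{\otimes m}\otimes P}=0\text{ for all }m<-n\}$, $n\in\mathbb{Z}$. *Lengths.* For a complex $V$ with an increasing filtration by subcomplexes $V_n$, $n\in\mathbb{Z}$, let $H^*(V)_n$ be the image of $H^*(V_n)$ in $H^*(V)$, let $\ell_+(V)=\inf\{n:H^*(V)_n=H^*(V)\}$ and $\ell_-(V)=\inf\{n:H^*(V)_n\ne0\}$ in $\mathbb{Z}\cup\{\pm\infty\}$,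 and let $\ell(V)=\max(|\ell_+(V)|,|\ell_-(V)|)\in[0,\infty]$ if $H^*(V)\neq0$, and $\ell(V)=0$ if $H^*(V)=0$. For a left $A$-module $P$ put $$\ell^{\_\otimes_AP}=\sup_Q\ell(Q\otimes_AP),\qquad \ell^{\mathcal{H}om_A(P,\_)}=\sup_N\ell(\mathcal{H}om_A(P,N)),$$ where $Q$ runs over all right and $N$ over all left $A$-modules. **Theorem.** For every strictly unital $A_\infty$-algebra $A$ and every left $A$-module $P$, $$\ell^{\_\otimes_AP}\le\ell^{\mathcal{H}om_A(P,\_)}.$$ -/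

import Mathlib

universe u w

set_option linter.unusedSectionVars false

namespace AInfinity

open TensorProduct

/-- The index group of a grading: an abelian group with a distinguished degree `one` (the degree of
a differential) and a parity homomorphism `sgn g = (-1)^g` for which `one` is odd. The examples are
`ℤ` (instance below) and `ℤ/2` (second instance below). -/
class ParityGrading (Γ : Type w) [AddCommGroup Γ] where
  one : Γ
  sgn : Γ → ℤˣ
  sgn_add : ∀ g h, sgn (g + h) = sgn g * sgn h
  sgn_one : sgn one = -1

instance : ParityGrading ℤ where
  one := 1
  sgn := Int.negOnePow
  sgn_add := Int.negOnePow_add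
  sgn_one := Int.negOnePow_one

instance : ParityGrading (ZMod 2) where
  one := 1
  sgn x := (-1 : ℤˣ) ^ x
  sgn_add x y := uzpow_add _ x y
  sgn_one := uzpow_one _

open ParityGrading

section Tens

variable {K : Type u} [Field K] {V : Type u} [AddCommGroup V] [Module K V]
variable {M N : Type u} [AddCommMonoid M] [Module K M] [AddCommMonoid N] [Module K N]

/-- The tensor `[a₁|⋯|aₙ] = a₁ ⊗ ⋯ ⊗ aₙ` in the tensor (co)algebra `T V = ⨁ₙ V^{⊗n}`. -/
noncomputable def word (l : List V) : TensorAlgebra K V := (l.map (TensorAlgebra.ι K)).prod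

@[simp] lemma word_nil : (word [] : TensorAlgebra K V) = 1 := by simp [word]
@[simp] lemma word_cons (a : V) (l : List V) :
    (word (a :: l) : TensorAlgebra K V) = TensorAlgebra.ι K a * word l := by simp [word]
lemma word_append (l l' : List V) :
    (word (l ++ l') : TensorAlgebra K V) = word l * word l' := by simp [word]

lemma span_word : Submodule.span K (Set.range (word : List V → TensorAlgebra K V)) = ⊤ := by
  rw [eq_top_iff]
  rintro x -
  induction x using TensorAlgebra.induction with
  | algebraMap r =>
    rw [Algebra.algebraMap_eq_smul_one]
    exact Submodule.smul_mem _ _ (Submodule.subset_span ⟨[], word_nil⟩)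
  | ι a => exact Submodule.subset_span ⟨[a], by simp⟩
  | add a b ha hb => exact Submodule.add_mem _ ha hb
  | mul a b ha hb =>
    have h := Submodule.mul_mem_mul ha hb
    rw [Submodule.span_mul_span] at h
    refine Submodule.span_mono ?_ h
    rintro _ ⟨_, ⟨l, rfl⟩, _, ⟨l', rfl⟩, rfl⟩
    exact ⟨l ++ l', word_append l l'⟩

lemma ext_word {f g : TensorAlgebra K V →ₗ[K] M} (h : ∀ l, f (word l) = g (word l)) : f = g := by
  refine LinearMap.ext_on_range (v := word) ?_ h
  exact span_word

/-- Auxiliary to `comul`: the letter `a` acts on pairs by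
`(x, y) ↦ (a x, 1 ⊗ a x + (a ⊗ 1) y)`. -/
noncomputable def comulAux : TensorAlgebra K V →ₐ[K]
    Module.End K (TensorAlgebra K V × (TensorAlgebra K V ⊗[K] TensorAlgebra K V)) :=
  TensorAlgebra.lift K
    { toFun := fun a =>
        LinearMap.prod
          (LinearMap.mulLeft K (TensorAlgebra.ι K a) ∘ₗ LinearMap.fst K _ _)
          ((TensorProduct.mk K _ _ 1) ∘ₗ LinearMap.mulLeft K (TensorAlgebra.ι K a) ∘ₗ
              LinearMap.fst K _ _
            + (LinearMap.mulLeft K (TensorAlgebra.ι K a)).rTensor _ ∘ₗ LinearMap.snd K _ _)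
      map_add' := by
        intro a b
        ext x <;> simp [add_mul, TensorProduct.tmul_add, TensorProduct.add_tmul]
      map_smul' := by
        intro r a
        ext x <;> simp [TensorProduct.smul_tmul'] }

/-- The deconcatenation coproduct of the tensor coalgebra, see `comul_word`. -/
noncomputable def comul :
    TensorAlgebra K V →ₗ[K] TensorAlgebra K V ⊗[K] TensorAlgebra K V :=
  LinearMap.snd K _ _ ∘ₗ LinearMap.applyₗ (1, 1 ⊗ₜ 1) ∘ₗ (comulAux (K := K) (V := V)).toLinearMap

lemma comulAux_fst (l : List V) :
    (comulAux (word l) ((1 : TensorAlgebra K V), (1 : TensorAlgebra K V) ⊗ₜ[K] (1 : TensorAlgebra K V))).1 = word l := by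
  induction l with
  | nil => simp
  | cons a l ih => simp [comulAux] at ih ⊢; simp [ih]

theorem comul_word (l : List V) : comul (word l : TensorAlgebra K V) =
    ∑ i ∈ Finset.range (l.length + 1), word (l.take i) ⊗ₜ[K] word (l.drop i) := by
  induction l with
  | nil => simp [comul]
  | cons a l ih =>
    have h1 := comulAux_fst (K := K) l
    rw [Finset.sum_range_succ']
    simp [comul, comulAux] at ih h1 ⊢
    rw [ih, h1, map_sum]
    simp [add_comm]


/-- The sum of `g u v` over all ways of cutting the list `l` into `l = u ++ v`. -/
def splitSum {X : Type*} {Y : Type*} [AddCommMonoid Y] (g : List X → List X → Y) (l : List X) : Y :=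
  ∑ i ∈ Finset.range (l.length + 1), g (l.take i) (l.drop i)

section SplitSum

variable {X Y Z G : Type*} [AddCommMonoid Y] [AddCommMonoid Z] [AddCommGroup G]

@[simp] lemma splitSum_nil (g : List X → List X → Y) : splitSum g [] = g [] [] := by
  simp [splitSum]

lemma splitSum_cons (g : List X → List X → Y) (a : X) (l : List X) :
    splitSum g (a :: l) = g [] (a :: l) + splitSum (fun u v => g (a :: u) v) l := by
  rw [splitSum, List.length_cons, Finset.sum_range_succ']
  simp [splitSum, add_comm]

lemma splitSum_add (f g : List X → List X → Y) (l : List X) :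
    splitSum (fun u v => f u v + g u v) l = splitSum f l + splitSum g l := by
  simp [splitSum, Finset.sum_add_distrib]

lemma splitSum_neg (f : List X → List X → G) (l : List X) :
    splitSum (fun u v => -f u v) l = -splitSum f l := by
  simp [splitSum]

lemma splitSum_sub (f g : List X → List X → G) (l : List X) :
    splitSum (fun u v => f u v - g u v) l = splitSum f l - splitSum g l := by
  simp [splitSum]

lemma map_splitSum {F : Type*} [FunLike F Y Z] [AddMonoidHomClass F Y Z] (φ : F)
    (f : List X → List X → Y) (l : List X) :
    φ (splitSum f l) = splitSum (fun u v => φ (f u v)) l := by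
  simp [splitSum]

lemma splitSum_map {X' : Type*} (s : X' → X) (f : List X → List X → Y) (l : List X') :
    splitSum f (l.map s) = splitSum (fun u v => f (u.map s) (v.map s)) l := by
  simp [splitSum]

lemma splitSum_congr {f g : List X → List X → Y} {l : List X}
    (h : ∀ u v, u ++ v = l → f u v = g u v) : splitSum f l = splitSum g l :=
  Finset.sum_congr rfl fun i _ => h _ _ (List.take_append_drop i l)

lemma splitSum_eq_zero {f : List X → List X → Y} {l : List X}
    (h : ∀ u v, u ++ v = l → f u v = 0) : splitSum f l = 0 :=
  Finset.sum_eq_zero fun i _ => h _ _ (List.take_append_drop i l)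

lemma splitSum_mem {R : Type*} [Semiring R] [Module R Y] (S : Submodule R Y)
    {f : List X → List X → Y} {l : List X}
    (h : ∀ u v, u ++ v = l → f u v ∈ S) : splitSum f l ∈ S :=
  Submodule.sum_mem _ fun i _ => h _ _ (List.take_append_drop i l)

lemma splitSum_assoc (h : List X → List X → List X → Y) (l : List X) :
    splitSum (fun u v => splitSum (fun u₁ u₂ => h u₁ u₂ v) u) l
      = splitSum (fun u v => splitSum (fun v₁ v₂ => h u v₁ v₂) v) l := by
  induction l generalizing h with
  | nil => simp
  | cons a l ih =>
    simp only [splitSum_cons, splitSum_nil, splitSum_add]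
    rw [ih (fun u v w => h (a :: u) v w)]
    abel

lemma splitSum_append (f : List X → List X → Y) (l : List X) (a : X) (l' : List X) :
    splitSum f (l ++ a :: l') = splitSum (fun u v => f u (v ++ a :: l')) l
      + splitSum (fun u v => f (l ++ a :: u) v) l' := by
  induction l generalizing f with
  | nil => simp [splitSum_cons]
  | cons b l ih => simp [splitSum_cons, ih, add_assoc]

end SplitSum

/-- `x ↦ ∑ f x' x''`, where `∑ x' ⊗ x''` is the deconcatenation of `x`; see `convolve_word`. -/
noncomputable def convolve
    (f : TensorAlgebra K V →ₗ[K] TensorAlgebra K V →ₗ[K] M) : TensorAlgebra K V →ₗ[K] M :=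
  TensorProduct.lift f ∘ₗ comul

lemma convolve_word (f : TensorAlgebra K V →ₗ[K] TensorAlgebra K V →ₗ[K] M) (l : List V) :
    convolve f (word l) = splitSum (fun u v => f (word u) (word v)) l := by
  simp [convolve, comul_word, splitSum]

lemma convolve_ι_mul (f : TensorAlgebra K V →ₗ[K] TensorAlgebra K V →ₗ[K] M) (a : V)
    (x : TensorAlgebra K V) :
    convolve f (TensorAlgebra.ι K a * x) = f 1 (TensorAlgebra.ι K a * x)
      + convolve (f ∘ₗ LinearMap.mulLeft K (TensorAlgebra.ι K a)) x := by
  have : convolve f ∘ₗ LinearMap.mulLeft K (TensorAlgebra.ι K a)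
      = f 1 ∘ₗ LinearMap.mulLeft K (TensorAlgebra.ι K a)
        + convolve (f ∘ₗ LinearMap.mulLeft K (TensorAlgebra.ι K a)) := by
    refine ext_word fun l => ?_
    have := convolve_word f (a :: l)
    simp only [word_cons, splitSum_cons, word_nil] at this
    simp [this, convolve_word]
  simpa using LinearMap.congr_fun this x

/-- The map `[a₁|⋯|aₙ] ↦ [σ a₁|⋯|σ aₙ]`. -/
noncomputable def tSign (σ : V →ₗ[K] V) : TensorAlgebra K V →ₗ[K] TensorAlgebra K V :=
  (TensorAlgebra.lift K (TensorAlgebra.ι K ∘ₗ σ)).toLinearMap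

lemma tSign_word (σ : V →ₗ[K] V) (l : List V) : tSign σ (word l) = word (l.map σ) := by
  induction l with
  | nil => simp [tSign]
  | cons a l ih => simp [tSign] at ih ⊢; simp [ih]

/-- `[a₁|⋯|aₙ] ↦ ∑ₖ [μ(a₁,…,aₖ)|aₖ₊₁|⋯|aₙ]`. -/
noncomputable def headOp (μ : TensorAlgebra K V →ₗ[K] V) :
    TensorAlgebra K V →ₗ[K] TensorAlgebra K V :=
  convolve (LinearMap.mul K (TensorAlgebra K V) ∘ₗ TensorAlgebra.ι K ∘ₗ μ)

/-- The coderivation `b` of the tensor coalgebra with components `μ`, i.e. the sum of the maps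
`1^{⊗r} ⊗ μ^k ⊗ 1^{⊗(n-r-k)}`. The Koszul sign of moving `μ` (of degree `1`) past the first `r`
letters is produced by applying `σ a = (-1)^{|a|} a` to them; see `bar_word`. -/
noncomputable def bar (σ : V →ₗ[K] V) (μ : TensorAlgebra K V →ₗ[K] V) :
    TensorAlgebra K V →ₗ[K] TensorAlgebra K V :=
  convolve ((LinearMap.mul K (TensorAlgebra K V)).compl₁₂ (tSign σ) (headOp μ))

lemma headOp_word (μ : TensorAlgebra K V →ₗ[K] V) (l : List V) :
    headOp μ (word l) = splitSum (fun u v => word (μ (word u) :: v)) l := by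
  simp [headOp, convolve_word]

theorem bar_word (σ : V →ₗ[K] V) (μ : TensorAlgebra K V →ₗ[K] V) (l : List V) :
    bar σ μ (word l) = splitSum (fun u v =>
      splitSum (fun v₁ v₂ => word (u.map σ ++ μ (word v₁) :: v₂)) v) l := by
  simp [bar, convolve_word, headOp_word, tSign_word, map_splitSum, word_append]

section Coderivation

variable (σ : V →ₗ[K] V) (μ : TensorAlgebra K V →ₗ[K] V)

lemma bar_cons (a : V) (l : List V) :
    bar σ μ (word (a :: l)) = headOp μ (word (a :: l)) + TensorAlgebra.ι K (σ a) * bar σ μ (word l) := by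
  rw [bar_word, splitSum_cons, headOp_word]
  congr 1
  rw [bar_word, ← LinearMap.mulLeft_apply (R := K), map_splitSum]
  simp only [map_splitSum]
  simp

lemma convolve_headOp (f : TensorAlgebra K V →ₗ[K] TensorAlgebra K V →ₗ[K] M) (l : List V) :
    convolve f (headOp μ (word l)) = f 1 (headOp μ (word l))
      + splitSum (fun u v => f (headOp μ (word u)) (word v)) l := by
  rw [headOp_word, map_splitSum, map_splitSum]
  simp only [convolve_word, splitSum_cons, word_nil, splitSum_add]
  congr 1
  rw [← splitSum_assoc (fun u v w => f (word (μ (word u) :: v)) (word w))]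
  refine splitSum_congr fun u v _ => ?_
  rw [headOp_word]
  simpa using (map_splitSum (f.flip (word v)) (fun u v => word (μ (word u) :: v)) u).symm

lemma convolve_bar (h1 : μ 1 = 0) (f : TensorAlgebra K V →ₗ[K] TensorAlgebra K V →ₗ[K] M) (l : List V) :
    convolve f (bar σ μ (word l)) = splitSum (fun u v => f (bar σ μ (word u)) (word v)
      + f (word (u.map σ)) (bar σ μ (word v))) l := by
  have b1 : bar σ μ 1 = 0 := by simpa [h1] using bar_word σ μ []
  have hd1 : headOp μ 1 = 0 := by simpa [h1] using headOp_word μ []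
  induction l generalizing f with
  | nil => simp [b1]
  | cons a l ih =>
    rw [bar_cons, map_add, convolve_ι_mul, ih, convolve_headOp, splitSum_cons, splitSum_cons]
    simp only [bar_cons, map_add, LinearMap.add_apply, splitSum_add]
    simp [b1, hd1]
    abel

lemma splitSum_apply {Y : Type*} (f : List Y → List Y → (M →ₗ[K] N)) (l : List Y) (m : M) :
    splitSum f l m = splitSum (fun u v => f u v m) l := by
  simp [splitSum]

lemma mul_splitSum {Y : Type*} {R : Type*} [Ring R] (f : List Y → List Y → R) (l : List Y) (m : R) :
    m * splitSum f l = splitSum (fun u v => m * f u v) l := by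
  simp [splitSum, Finset.mul_sum]

lemma splitSum_mul {Y : Type*} {R : Type*} [Ring R] (f : List Y → List Y → R) (l : List Y) (m : R) :
    splitSum f l * m = splitSum (fun u v => f u v * m) l := by
  simp [splitSum, Finset.sum_mul]

variable {σ μ}
lemma map_map_sign (hσ : ∀ a, σ (σ a) = a) (l : List V) : (l.map σ).map σ = l := by
  rw [List.map_map]
  conv_rhs => rw [← List.map_id l]
  exact List.map_congr_left fun a _ => hσ a

lemma bar_map (hσμ : ∀ l, μ (word (l.map σ)) = -σ (μ (word l))) (l : List V) : bar σ μ (word (l.map σ)) = -tSign σ (bar σ μ (word l)) := by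
  rw [bar_word, bar_word, splitSum_map, map_splitSum, ← splitSum_neg]
  refine splitSum_congr fun u v _ => ?_
  rw [splitSum_map, map_splitSum, ← splitSum_neg]
  refine splitSum_congr fun u v _ => ?_
  rw [tSign_word, hσμ]
  simp [word_append]

lemma bar_eq (l : List V) : bar σ μ (word l)
    = splitSum (fun u v => word (u.map σ) * headOp μ (word v)) l := by
  simp [bar, convolve_word, tSign_word]

lemma bar_bar (h1 : μ 1 = 0) (hσ : ∀ a, σ (σ a) = a)
    (hσμ : ∀ l, μ (word (l.map σ)) = -σ (μ (word l)))
    (hμ : ∀ l, μ (bar σ μ (word l)) = 0) (l : List V) : bar σ μ (bar σ μ (word l)) = 0 := by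
  have e1 : ∀ l, headOp μ (bar σ μ (word l))
      = splitSum (fun u v => TensorAlgebra.ι K (μ (word (u.map σ))) * bar σ μ (word v)) l := by
    intro l
    rw [headOp, convolve_bar σ μ h1]
    simp [hμ]
  change convolve ((LinearMap.mul K (TensorAlgebra K V)).compl₁₂ (tSign σ) (headOp μ))
    (bar σ μ (word l)) = 0
  rw [convolve_bar σ μ h1, splitSum_add]
  have e2 : ∀ u, tSign σ (bar σ μ (word u))
      = -splitSum (fun u v => word u * headOp μ (word (v.map σ))) u := by
    intro u
    rw [← neg_eq_iff_eq_neg, ← bar_map hσμ, bar_eq, splitSum_map]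
    simp only [map_map_sign hσ]
  simp only [LinearMap.compl₁₂_apply, LinearMap.mul_apply', e1, e2, tSign_word, map_map_sign hσ,
    neg_mul, splitSum_neg, splitSum_mul]
  simp only [bar_eq, mul_splitSum]
  rw [splitSum_assoc (fun u v w => word u * headOp μ (word (v.map σ)) * headOp μ (word w)),
    neg_add_eq_zero]
  refine splitSum_congr fun u v _ => ?_
  rw [← splitSum_assoc (fun v₁ v₂ v₃ => word u * (TensorAlgebra.ι K (μ (word (v₁.map σ))) *
    (word (v₂.map σ) * headOp μ (word v₃))))]
  refine splitSum_congr fun v w _ => ?_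
  rw [headOp_word, splitSum_map, mul_splitSum, splitSum_mul]
  simp [mul_assoc]

end Coderivation

end Tens

/-! ### Graded vector spaces and words of homogeneous elements -/

section Graded

variable (K : Type u) [Field K] (Γ : Type w)

open Classical in
/-- A `Γ`-graded vector space over `K`: the total space with its homogeneous components. -/
structure GrSpace where
  carrier : Type u
  [addCommGroup : AddCommGroup carrier]
  [module : Module K carrier]
  gr : Γ → Submodule K carrier
  internal : DirectSum.IsInternal gr

attribute [instance] GrSpace.addCommGroup GrSpace.module

variable {K Γ} [AddCommGroup Γ] [ParityGrading Γ]

open Classical in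
/-- The linear map with `v ↦ (-1)^{|v|} v` on homogeneous elements, see `GrSpace.signOp_apply`. -/
noncomputable def GrSpace.signOp (V : GrSpace K Γ) : V.carrier →ₗ[K] V.carrier :=
  DirectSum.toModule K Γ V.carrier (fun g => (sgn g : ℤ) • (V.gr g).subtype) ∘ₗ
    (LinearEquiv.ofBijective (DirectSum.coeLinearMap V.gr) V.internal).symm.toLinearMap

theorem GrSpace.signOp_apply (V : GrSpace K Γ) {g : Γ} {v : V.carrier} (hv : v ∈ V.gr g) :
    V.signOp v = (sgn g : ℤ) • v := by
  classical
  have : (LinearEquiv.ofBijective (DirectSum.coeLinearMap V.gr) V.internal).symm v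
      = DirectSum.lof K Γ (fun g => V.gr g) g ⟨v, hv⟩ := by
    rw [LinearEquiv.symm_apply_eq]
    exact (DirectSum.coeLinearMap_lof V.gr g ⟨v, hv⟩).symm
  rw [signOp, LinearMap.comp_apply, LinearEquiv.coe_coe, this, DirectSum.toModule_lof]
  rfl

/-- The grading of the shift `sV`: `(sV)^g = V^{g+1}`, on the same total space. -/
def GrSpace.suspGr (V : GrSpace K Γ) (g : Γ) : Submodule K V.carrier := V.gr (g + one)

/-- The map `v ↦ (-1)^{|v|} v` for the degree of `v` in the shift `sV`. -/
noncomputable def GrSpace.suspSign (V : GrSpace K Γ) : V.carrier →ₗ[K] V.carrier := -V.signOp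

/-- `WordDeg D [a₁, …, aₙ] g`: there are degrees `gᵢ` with `aᵢ ∈ D gᵢ` and `∑ gᵢ = g`. -/
inductive WordDeg {V : Type u} [AddCommGroup V] [Module K V] (D : Γ → Submodule K V) :
    List V → Γ → Prop
  | nil : WordDeg D [] 0
  | cons {a : V} {l : List V} {g h : Γ} : a ∈ D g → WordDeg D l h → WordDeg D (a :: l) (g + h)

lemma sgn_mul_self (g : Γ) : (sgn g : ℤ) * (sgn g : ℤ) = 1 := by
  rw [← Units.val_mul, Int.units_mul_self, Units.val_one]

lemma sgn_zero : sgn (0 : Γ) = 1 := by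
  have h := sgn_add (0 : Γ) 0
  simpa using h

namespace GrSpace

variable (V : GrSpace K Γ)

lemma induct {p : V.carrier → Prop} (h0 : ∀ g, ∀ v ∈ V.gr g, p v)
    (ha : ∀ v w, p v → p w → p (v + w)) (v : V.carrier) : p v := by
  classical
  have := V.internal.submodule_iSup_eq_top
  have hv : v ∈ ⨆ g, V.gr g := this ▸ Submodule.mem_top
  exact Submodule.iSup_induction _ (motive := p) hv h0 (h0 0 0 (Submodule.zero_mem _)) ha

lemma signOp_mem {g : Γ} {v : V.carrier} (hv : v ∈ V.gr g) : V.signOp v ∈ V.gr g := by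
  rw [V.signOp_apply hv]
  exact (V.gr g).toAddSubgroup.zsmul_mem hv _

lemma signOp_signOp (v : V.carrier) : V.signOp (V.signOp v) = v := by
  induction v using V.induct with
  | h0 g v hv =>
    rw [V.signOp_apply hv, map_zsmul, V.signOp_apply hv, smul_smul, sgn_mul_self, one_smul]
  | ha v w hv hw => simp [hv, hw]

lemma suspSign_apply {g : Γ} {v : V.carrier} (hv : v ∈ V.suspGr g) :
    V.suspSign v = (sgn g : ℤ) • v := by
  rw [suspSign, LinearMap.neg_apply, V.signOp_apply hv, sgn_add, sgn_one]
  simp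

lemma suspSign_suspSign (v : V.carrier) : V.suspSign (V.suspSign v) = v := by
  simp [suspSign, signOp_signOp]

end GrSpace

section WordDeg

variable {V : Type u} [AddCommGroup V] [Module K V] {D : Γ → Submodule K V}

lemma WordDeg.append {u v : List V} {g h : Γ} (hu : WordDeg D u g) (hv : WordDeg D v h) :
    WordDeg D (u ++ v) (g + h) := by
  induction hu with
  | nil => simpa using hv
  | cons ha _ ih => rw [add_assoc]; exact .cons ha ih

lemma WordDeg.split {u v : List V} {g : Γ} (h : WordDeg D (u ++ v) g) :
    ∃ i j, WordDeg D u i ∧ WordDeg D v j ∧ i + j = g := by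
  induction u generalizing g with
  | nil => exact ⟨0, g, .nil, h, zero_add g⟩
  | cons a u ih =>
    cases h with
    | cons ha hl =>
      obtain ⟨i, j, hi, hj, rfl⟩ := ih hl
      exact ⟨_, j, .cons ha hi, hj, add_assoc _ _ _⟩

variable {σ : V →ₗ[K] V}

lemma WordDeg.map (hs : ∀ g, ∀ a ∈ D g, σ a = (sgn g : ℤ) • a)
    {l : List V} {g : Γ} (h : WordDeg D l g) : WordDeg D (l.map σ) g := by
  induction h with
  | nil => exact .nil
  | cons ha _ ih =>
    refine .cons ?_ ih
    rw [hs _ _ ha]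
    exact (D _).toAddSubgroup.zsmul_mem ha _

lemma WordDeg.word_map (hs : ∀ g, ∀ a ∈ D g, σ a = (sgn g : ℤ) • a)
    {l : List V} {g : Γ} (h : WordDeg D l g) :
    (word (l.map σ) : TensorAlgebra K V) = (sgn g : ℤ) • word l := by
  induction h with
  | nil => simp [sgn_zero]
  | cons ha _ ih =>
    rw [List.map_cons, word_cons, ih, hs _ _ ha, map_zsmul, sgn_add, word_cons, Units.val_mul,
      smul_mul_smul_comm]

lemma span_wordDeg (hD : ⨆ g, D g = ⊤) :
    Submodule.span K {x : TensorAlgebra K V | ∃ l g, WordDeg D l g ∧ word l = x} = ⊤ := by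
  rw [← span_word]
  refine le_antisymm (Submodule.span_mono ?_) (Submodule.span_le.2 ?_)
  · rintro _ ⟨l, g, -, rfl⟩
    exact ⟨l, rfl⟩
  rintro _ ⟨l, rfl⟩
  induction l with
  | nil => exact Submodule.subset_span ⟨[], 0, .nil, rfl⟩
  | cons a l ih =>
    rw [word_cons]
    have ha : a ∈ ⨆ g, D g := hD ▸ Submodule.mem_top
    refine Submodule.iSup_induction D
      (motive := fun a => TensorAlgebra.ι K a * word l ∈ Submodule.span K _) ha ?_ ?_ ?_
    · intro g a ha
      refine Submodule.span_induction (p := fun x _ => TensorAlgebra.ι K a * x ∈ _) ?_ ?_ ?_ ?_ ih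
      · rintro _ ⟨l, h, hl, rfl⟩
        exact Submodule.subset_span ⟨a :: l, _, .cons ha hl, word_cons _ _⟩
      · simp
      · intro x y _ _ hx hy
        rw [mul_add]
        exact Submodule.add_mem _ hx hy
      · intro r x _ hx
        rw [mul_smul_comm]
        exact Submodule.smul_mem _ _ hx
    · simp
    · intro x y hx hy
      rw [map_add, add_mul]
      exact Submodule.add_mem _ hx hy

lemma ext_wordDeg {M : Type u} [AddCommMonoid M] [Module K M] (hD : ⨆ g, D g = ⊤)
    {f g : TensorAlgebra K V →ₗ[K] M}
    (h : ∀ l i, WordDeg D l i → f (word l) = g (word l)) : f = g := by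
  refine LinearMap.ext_on (span_wordDeg hD) ?_
  rintro _ ⟨l, i, hl, rfl⟩
  exact h l i hl

lemma bar_mem {μ : TensorAlgebra K V →ₗ[K] V} (h1 : μ 1 = 0)
    (hs : ∀ g, ∀ a ∈ D g, σ a = (sgn g : ℤ) • a)
    (hd : ∀ l g, WordDeg D l g → μ (word l) ∈ D (g + one)) {l : List V} {g : Γ}
    (hl : WordDeg D l g) :
    bar σ μ (word l) ∈ Submodule.span K
      {x | ∃ l', WordDeg D l' (g + one) ∧ l'.length ≤ l.length ∧ word l' = x} := by
  rw [bar_word]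
  refine splitSum_mem _ fun u v huv => splitSum_mem _ fun v w hvw => ?_
  subst hvw huv
  obtain ⟨i, m, hu, hm, rfl⟩ := hl.split
  obtain ⟨j, k, hv, hw, rfl⟩ := hm.split
  by_cases hv0 : v = []
  · subst hv0
    rw [word_nil, h1, word_append, word_cons]
    simp
  refine Submodule.subset_span ⟨_, ?_, ?_, rfl⟩
  · have := (hu.map hs).append (.cons (hd _ _ hv) hw)
    have e : i + (j + k) + one = i + (j + one + k) := by abel
    rw [e]
    exact this
  · have := List.length_pos_iff.2 hv0
    simp
    omega

end WordDeg

end Graded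

/-! ### A-infinity algebras and modules -/

/-- A strictly unital `A_∞`-algebra. The structure maps `μⁿ : (sA)^{⊗n} → sA`, `n ≥ 1`, of degree
`1` are the restrictions of `μ` to the summands of `T (sA)`, and `μ` is zero on `(sA)^{⊗0}`.
The relation `μ_rel` is `∑ μ^{n-k+1} (1^{⊗r} ⊗ μ^k ⊗ 1^{⊗(n-r-k)}) = 0`, with Koszul signs.
The unit `e` satisfies `μ²(e ⊗ a) = a`, `μ²(a ⊗ e) = -(-1)^{|a|} a` (with `|a|` the degree in `sA`)
and `μⁿ(…, e, …) = 0` for `n ≠ 2`. -/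
structure AInfAlgebra (K : Type u) [Field K] (Γ : Type w) [AddCommGroup Γ] [ParityGrading Γ]
    extends GrSpace K Γ where
  μ : TensorAlgebra K carrier →ₗ[K] carrier
  μ_one : μ 1 = 0
  μ_deg : ∀ l g, WordDeg toGrSpace.suspGr l g → μ (word l) ∈ toGrSpace.suspGr (g + one)
  μ_rel : ∀ l : List carrier,
    splitSum (fun u v => splitSum (fun v₁ v₂ =>
      μ (word (u.map toGrSpace.suspSign ++ μ (word v₁) :: v₂))) v) l = 0
  e : carrier
  e_mem : e ∈ gr 0
  e_mul : ∀ a, μ (word [e, a]) = a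
  mul_e : ∀ a, μ (word [a, e]) = -toGrSpace.suspSign a
  e_zero : ∀ l l' : List carrier, l.length + l'.length ≠ 1 → μ (word (l ++ e :: l')) = 0

section Main

variable {K : Type u} [Field K] {Γ : Type w} [AddCommGroup Γ] [ParityGrading Γ]

/-- The total space `T (sA)` of the (coaugmented) bar construction of `A`. -/
abbrev AInfAlgebra.BA (A : AInfAlgebra K Γ) : Type u := TensorAlgebra K A.carrier

/-- The differential of the bar construction. -/
noncomputable abbrev AInfAlgebra.b (A : AInfAlgebra K Γ) :
    A.BA →ₗ[K] A.BA :=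
  bar A.suspSign A.μ

/-- A strictly unital left `A_∞`-module `P` over `A`: a graded vector space with a degree `1` map
`μ_P : BA ⊗ P → P`, written `act`, such that `μ_P ∘ ((1 ⊗ μ_P) ∘ (Δ ⊗ 1) + b ⊗ 1) = 0`,
`μ_P(e ⊗ p) = p`, and `μ_P` vanishes on `[a₁|⋯|aₙ] ⊗ p` if `n ≥ 2` and some `aᵢ` is `e`. -/
structure LeftModule (A : AInfAlgebra K Γ) extends GrSpace K Γ where
  act : A.BA →ₗ[K] carrier →ₗ[K] carrier
  act_deg : ∀ l g, WordDeg A.suspGr l g → ∀ h, ∀ p ∈ gr h, act (word l) p ∈ gr (g + h + one)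
  act_rel : ∀ (l : List A.carrier) (p : carrier),
    splitSum (fun u v => act (word (u.map A.suspSign)) (act (word v) p)) l
      + act (A.b (word l)) p = 0
  act_e : ∀ p, act (word [A.e]) p = p
  act_e_zero : ∀ l l' : List A.carrier, l.length + l'.length ≠ 0 →
    ∀ p, act (word (l ++ A.e :: l')) p = 0

/-- A strictly unital right `A_∞`-module `Q` over `A`: a graded vector space with a degree `1` map
`μ_Q : Q ⊗ BA → Q`, `μ_Q(q ⊗ x) = act x q`, such that
`μ_Q ∘ ((μ_Q ⊗ 1) ∘ (1 ⊗ Δ) + 1 ⊗ b) = 0`, `μ_Q(q ⊗ e) = -(-1)^{|q|} q`, and `μ_Q` vanishes on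
`q ⊗ [a₁|⋯|aₙ]` if `n ≥ 2` and some `aᵢ` is `e`. -/
structure RightModule (A : AInfAlgebra K Γ) extends GrSpace K Γ where
  act : A.BA →ₗ[K] carrier →ₗ[K] carrier
  act_deg : ∀ l g, WordDeg A.suspGr l g → ∀ h, ∀ q ∈ gr h, act (word l) q ∈ gr (h + g + one)
  act_rel : ∀ (l : List A.carrier) (q : carrier),
    splitSum (fun u v => act (word v) (act (word u) q)) l
      + act (A.b (word l)) (toGrSpace.signOp q) = 0
  act_e : ∀ q, act (word [A.e]) q = -toGrSpace.signOp q
  act_e_zero : ∀ l l' : List A.carrier, l.length + l'.length ≠ 0 →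
    ∀ q, act (word (l ++ A.e :: l')) q = 0

/-! ### Filtered complexes -/

/-- A `Γ`-graded cochain complex of vector spaces with an increasing `ℤ`-indexed family `F n` of
subcomplexes. -/
structure FilteredComplex (K : Type u) [Field K] (Γ : Type w) [AddCommGroup Γ]
    [ParityGrading Γ] where
  X : Γ → Type u
  [addCommGroup : ∀ g, AddCommGroup (X g)]
  [module : ∀ g, Module K (X g)]
  d : ∀ g h : Γ, g + one = h → (X g →ₗ[K] X h)
  d_d : ∀ g h k (e : g + one = h) (e' : h + one = k) (x : X g), d h k e' (d g h e x) = 0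
  F : ℤ → ∀ g, Submodule K (X g)
  F_mono : ∀ m n, m ≤ n → ∀ g, F m g ≤ F n g
  d_F : ∀ n g h (e : g + one = h), ∀ x ∈ F n g, d g h e x ∈ F n h

attribute [instance] FilteredComplex.addCommGroup FilteredComplex.module

namespace FilteredComplex

variable (C : FilteredComplex K Γ)

/-- The cocycles of degree `g`. -/
def cocycles (g : Γ) : Submodule K (C.X g) := LinearMap.ker (C.d g (g + one) rfl)

/-- The coboundaries of degree `g`. -/
def boundaries (g : Γ) : Submodule K (C.X g) :=
  LinearMap.range (C.d (g - one) g (sub_add_cancel g one))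

/-- The cohomology `H^g`. -/
abbrev cohomology (g : Γ) : Type u :=
  C.cocycles g ⧸ (C.boundaries g).comap (C.cocycles g).subtype

/-- The induced filtration of cohomology: `H^g_n` is the set of classes of cocycles in `F n`. -/
def filtCohomology (n : ℤ) (g : Γ) : Submodule K (C.cohomology g) :=
  ((C.F n g).comap (C.cocycles g).subtype).map
    ((C.boundaries g).comap (C.cocycles g).subtype).mkQ

/-- `ℓ₊ = inf {n : H_n = H}`. The infimum is taken in the extended reals, so it is `+∞` if there
is no such `n`, in particular if `⋃ H_n ≠ H`. -/
noncomputable def upperLength : EReal :=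
  sInf {x | ∃ n : ℤ, (∀ g, C.filtCohomology n g = ⊤) ∧ x = (n : ℝ)}

/-- `ℓ₋ = inf {n : H_n ≠ 0}`, which is `-∞` if there are such `n` arbitrarily close to `-∞`, in
particular if `⋂ H_n ≠ 0`. -/
noncomputable def lowerLength : EReal :=
  sInf {x | ∃ n : ℤ, (∃ g, C.filtCohomology n g ≠ ⊥) ∧ x = (n : ℝ)}

open Classical in
/-- The length `ℓ = max(|ℓ₊|, |ℓ₋|)` in `[0, ∞]`; an acyclic complex has length `0`. -/
noncomputable def length : ENNReal :=
  if ∀ g, Subsingleton (C.cohomology g) then 0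
  else max C.upperLength.abs C.lowerLength.abs

end FilteredComplex

/-! ### Compatibility of the structure maps with signs -/

namespace AInfAlgebra

variable (A : AInfAlgebra K Γ)

lemma iSup_suspGr : ⨆ g, A.suspGr g = ⊤ := by
  classical
  rw [← A.internal.submodule_iSup_eq_top]
  exact (Equiv.addRight (one : Γ)).iSup_congr (fun _ => rfl)

lemma suspSign_eq : ∀ g, ∀ a ∈ A.suspGr g, A.suspSign a = (sgn g : ℤ) • a :=
  fun _ _ h => A.suspSign_apply h

lemma μ_map (l : List A.carrier) : A.μ (word (l.map A.suspSign)) = -A.suspSign (A.μ (word l)) := by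
  have : A.μ ∘ₗ tSign A.suspSign = -(A.suspSign ∘ₗ A.μ) := by
    refine ext_wordDeg A.iSup_suspGr fun l g h => ?_
    simp only [LinearMap.comp_apply, tSign_word, LinearMap.neg_apply]
    rw [h.word_map A.suspSign_eq, map_zsmul, A.suspSign_eq _ _ (A.μ_deg _ _ h), sgn_add, sgn_one]
    simp
  simpa [tSign_word] using LinearMap.congr_fun this (word l)

lemma μ_b (l : List A.carrier) : A.μ (A.b (word l)) = 0 := by
  rw [b, bar_word, map_splitSum]
  simpa only [map_splitSum] using A.μ_rel l

lemma b_b (l : List A.carrier) : A.b (A.b (word l)) = 0 :=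
  bar_bar A.μ_one A.suspSign_suspSign A.μ_map A.μ_b l

lemma b_map (l : List A.carrier) :
    A.b (word (l.map A.suspSign)) = -tSign A.suspSign (A.b (word l)) := bar_map A.μ_map l

lemma suspSign_e : A.suspSign A.e = -A.e := by
  rw [GrSpace.suspSign, LinearMap.neg_apply, A.signOp_apply A.e_mem, sgn_zero]
  simp

end AInfAlgebra

lemma LeftModule.act_map {A : AInfAlgebra K Γ} (P : LeftModule A) (l : List A.carrier)
    (p : P.carrier) : P.act (word (l.map A.suspSign)) (P.signOp p)
      = -P.signOp (P.act (word l) p) := by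
  induction p using P.induct with
  | h0 g p hp =>
    have : (P.act ∘ₗ tSign A.suspSign).flip (P.signOp p) = -(P.signOp ∘ₗ P.act.flip p) := by
      refine ext_wordDeg A.iSup_suspGr fun l h hl => ?_
      simp only [LinearMap.comp_apply, tSign_word, LinearMap.neg_apply, LinearMap.flip_apply]
      rw [hl.word_map A.suspSign_eq, map_zsmul, LinearMap.smul_apply, P.signOp_apply hp, map_zsmul,
        P.signOp_apply (P.act_deg _ _ hl _ _ hp), sgn_add, sgn_one, sgn_add]
      simp [smul_smul, mul_comm]
    simpa [tSign_word] using LinearMap.congr_fun this (word l)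
  | ha v w hv hw =>
    simp only [map_add, hv, hw]
    abel

lemma RightModule.act_map {A : AInfAlgebra K Γ} (P : RightModule A) (l : List A.carrier)
    (p : P.carrier) : P.act (word (l.map A.suspSign)) (P.signOp p)
      = -P.signOp (P.act (word l) p) := by
  induction p using P.induct with
  | h0 g p hp =>
    have : (P.act ∘ₗ tSign A.suspSign).flip (P.signOp p) = -(P.signOp ∘ₗ P.act.flip p) := by
      refine ext_wordDeg A.iSup_suspGr fun l h hl => ?_
      simp only [LinearMap.comp_apply, tSign_word, LinearMap.neg_apply, LinearMap.flip_apply]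
      rw [hl.word_map A.suspSign_eq, map_zsmul, LinearMap.smul_apply, P.signOp_apply hp, map_zsmul,
        P.signOp_apply (P.act_deg _ _ hl _ _ hp), sgn_add, sgn_one, sgn_add]
      simp [smul_smul, mul_comm]
    simpa [tSign_word] using LinearMap.congr_fun this (word l)
  | ha v w hv hw =>
    simp only [map_add, hv, hw]
    abel

/-! ### The tensor product -/

section Tensor

variable {A : AInfAlgebra K Γ} (Q : RightModule A) (P : LeftModule A)

/-- `x' ⊗ x'' ⊗ p ↦ (-1)^{|x'|} x' ⊗ μ_P(x'' ⊗ p)`, as a multilinear map. -/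
noncomputable def leftSplit :
    A.BA →ₗ[K] A.BA →ₗ[K] P.carrier →ₗ[K] A.BA ⊗[K] P.carrier :=
  (LinearMap.llcomp K P.carrier P.carrier (A.BA ⊗[K] P.carrier)).compl₁₂
    (TensorProduct.mk K A.BA P.carrier ∘ₗ tSign A.suspSign) P.act

/-- The differential of the bar construction `BA ⊗ P` of a left module, see `leftBar_word`. -/
noncomputable def leftBar : A.BA ⊗[K] P.carrier →ₗ[K] A.BA ⊗[K] P.carrier :=
  TensorProduct.lift (convolve (leftSplit P) + TensorProduct.mk K A.BA P.carrier ∘ₗ A.b)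

theorem leftBar_word (l : List A.carrier) (p : P.carrier) :
    leftBar P (word l ⊗ₜ p) =
      splitSum (fun u v => word (u.map A.suspSign) ⊗ₜ[K] P.act (word v) p) l
        + A.b (word l) ⊗ₜ p := by
  simp [leftBar, leftSplit, convolve_word, splitSum_apply, tSign_word]

/-- `q ⊗ x' ⊗ x'' ↦ μ_Q(q ⊗ x') ⊗ x''`, as a multilinear map. -/
noncomputable def rightSplit :
    A.BA →ₗ[K] A.BA →ₗ[K] Q.carrier →ₗ[K] Q.carrier ⊗[K] A.BA :=
  (LinearMap.llcomp K Q.carrier Q.carrier (Q.carrier ⊗[K] A.BA)).flip.compl₁₂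
    Q.act (TensorProduct.mk K Q.carrier A.BA).flip

/-- `q ⊗ x ↦ ∑ μ_Q(q ⊗ x') ⊗ x''`, with `∑ x' ⊗ x''` the deconcatenation of `x`. -/
noncomputable def rightCut : Q.carrier ⊗[K] A.BA →ₗ[K] Q.carrier ⊗[K] A.BA :=
  TensorProduct.lift (convolve (rightSplit Q)).flip

/-- The differential of `Q ⊗_A P = Q ⊗ BA ⊗ P`, i.e.
`(μ_Q ⊗ 1 ⊗ 1)(1 ⊗ Δ ⊗ 1) + 1 ⊗ b ⊗ 1 + (1 ⊗ 1 ⊗ μ_P)(1 ⊗ Δ ⊗ 1)`; see `tensorD_word`. -/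
noncomputable def tensorD :
    Q.carrier ⊗[K] (A.BA ⊗[K] P.carrier) →ₗ[K] Q.carrier ⊗[K] (A.BA ⊗[K] P.carrier) :=
  (TensorProduct.assoc K Q.carrier A.BA P.carrier).toLinearMap ∘ₗ
      (rightCut Q).rTensor P.carrier ∘ₗ
        (TensorProduct.assoc K Q.carrier A.BA P.carrier).symm.toLinearMap
    + TensorProduct.map Q.signOp (leftBar P)

theorem tensorD_word (q : Q.carrier) (l : List A.carrier) (p : P.carrier) :
    tensorD Q P (q ⊗ₜ (word l ⊗ₜ p)) =
      splitSum (fun u v => Q.act (word u) q ⊗ₜ[K] (word v ⊗ₜ[K] p)) l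
        + Q.signOp q ⊗ₜ[K] (A.b (word l) ⊗ₜ[K] p)
        + splitSum (fun u v => Q.signOp q ⊗ₜ[K]
            (word (u.map A.suspSign) ⊗ₜ[K] P.act (word v) p)) l := by
  have h1 : ∀ x : Q.carrier ⊗[K] A.BA, x ⊗ₜ[K] p = (TensorProduct.mk K _ _).flip p x := fun _ => rfl
  have h2 : ∀ x : A.BA ⊗[K] P.carrier, Q.signOp q ⊗ₜ[K] x = TensorProduct.mk K _ _ (Q.signOp q) x :=
    fun _ => rfl
  simp only [tensorD, rightCut, LinearMap.add_apply, LinearMap.comp_apply, LinearEquiv.coe_coe,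
    TensorProduct.assoc_symm_tmul, LinearMap.rTensor_tmul, TensorProduct.lift.tmul,
    LinearMap.flip_apply, convolve_word, splitSum_apply, TensorProduct.map_tmul, leftBar_word]
  rw [h1, map_splitSum, map_splitSum, TensorProduct.tmul_add, h2, map_splitSum]
  simp [rightSplit]
  abel

lemma ext_tensor {M : Type u} [AddCommMonoid M] [Module K M]
    {f g : Q.carrier ⊗[K] (A.BA ⊗[K] P.carrier) →ₗ[K] M}
    (h : ∀ q l p, f (q ⊗ₜ (word l ⊗ₜ p)) = g (q ⊗ₜ (word l ⊗ₜ p))) : f = g := by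
  refine TensorProduct.ext' fun q y => ?_
  have : f ∘ₗ TensorProduct.mk K _ _ q = g ∘ₗ TensorProduct.mk K _ _ q := by
    refine TensorProduct.ext' fun x p => ?_
    have : (f ∘ₗ TensorProduct.mk K _ _ q) ∘ₗ (TensorProduct.mk K _ _).flip p
        = (g ∘ₗ TensorProduct.mk K _ _ q) ∘ₗ (TensorProduct.mk K _ _).flip p :=
      ext_word fun l => by simpa using h q l p
    simpa using LinearMap.congr_fun this x
  simpa using LinearMap.congr_fun this y

lemma tensorD_bar (q : Q.carrier) (l : List A.carrier) (p : P.carrier) :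
    tensorD Q P (q ⊗ₜ (A.b (word l) ⊗ₜ p))
      = splitSum (fun u v => Q.act (A.b (word u)) q ⊗ₜ[K] (word v ⊗ₜ[K] p)) l
        + splitSum (fun u v => Q.act (word (u.map A.suspSign)) q ⊗ₜ[K]
            (A.b (word v) ⊗ₜ[K] p)) l
        + splitSum (fun u v => Q.signOp q ⊗ₜ[K]
            (tSign A.suspSign (A.b (word u)) ⊗ₜ[K] P.act (word v) p)) l
        + splitSum (fun u v => Q.signOp q ⊗ₜ[K] (word u ⊗ₜ[K] P.act (A.b (word v)) p)) l := by
  have h1 : ∀ x : Q.carrier ⊗[K] A.BA, x ⊗ₜ[K] p = (TensorProduct.mk K _ _).flip p x := fun _ => rfl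
  have h2 : ∀ x : A.BA ⊗[K] P.carrier, Q.signOp q ⊗ₜ[K] x = TensorProduct.mk K _ _ (Q.signOp q) x :=
    fun _ => rfl
  simp only [tensorD, rightCut, leftBar, LinearMap.add_apply, LinearMap.comp_apply,
    LinearEquiv.coe_coe, TensorProduct.assoc_symm_tmul, LinearMap.rTensor_tmul,
    TensorProduct.lift.tmul, LinearMap.flip_apply, TensorProduct.map_tmul,
    convolve_bar _ _ A.μ_one, splitSum_apply, A.b_b, map_zero, add_zero]
  rw [h1, map_splitSum, map_splitSum, h2, map_splitSum]
  simp [rightSplit, leftSplit, TensorProduct.tmul_add, tSign_word,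
    map_map_sign A.suspSign_suspSign, splitSum_add, add_assoc]

theorem tensorD_tensorD (x : Q.carrier ⊗[K] (A.BA ⊗[K] P.carrier)) :
    tensorD Q P (tensorD Q P x) = 0 := by
  have : tensorD Q P ∘ₗ tensorD Q P = 0 := by
    refine ext_tensor Q P fun q l p => ?_
    rw [LinearMap.comp_apply, tensorD_word, map_add, map_add, tensorD_bar, map_splitSum,
      map_splitSum]
    simp only [tensorD_word, splitSum_add, Q.signOp_signOp, map_map_sign A.suspSign_suspSign,
      A.b_map, splitSum_map, LinearMap.zero_apply]
    rw [← splitSum_assoc (fun u v w => Q.act (word v) (Q.act (word u) q) ⊗ₜ[K]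
        ((word w : A.BA) ⊗ₜ[K] p)),
      ← splitSum_assoc (fun u v w => Q.signOp (Q.act (word u) q) ⊗ₜ[K]
        ((word (v.map A.suspSign) : A.BA) ⊗ₜ[K] P.act (word w) p)),
      splitSum_assoc (fun u v w => q ⊗ₜ[K]
        ((word u : A.BA) ⊗ₜ[K] P.act (word (v.map A.suspSign)) (P.act (word w) p)))]
    have c1 : splitSum (fun u w => splitSum (fun u v =>
          Q.act (word v) (Q.act (word u) q) ⊗ₜ[K] ((word w : A.BA) ⊗ₜ[K] p)) u) l
        + splitSum (fun u v => Q.act (A.b (word u)) (Q.signOp q) ⊗ₜ[K] ((word v : A.BA) ⊗ₜ[K] p)) l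
        = 0 := by
      rw [← splitSum_add]
      refine splitSum_eq_zero fun u w _ => ?_
      have h : ∀ x : Q.carrier, x ⊗ₜ[K] ((word w : A.BA) ⊗ₜ[K] p)
        = (TensorProduct.mk K _ _).flip ((word w : A.BA) ⊗ₜ[K] p) x := fun _ => rfl
      simp only [h]
      rw [← map_splitSum, ← map_add, Q.act_rel, map_zero]
    have c2 : splitSum (fun u v => Q.signOp (Q.act (word u) q) ⊗ₜ[K]
          (A.b (word v) ⊗ₜ[K] p)) l
        + splitSum (fun u v => Q.act (word (u.map A.suspSign)) (Q.signOp q) ⊗ₜ[K]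
            (A.b (word v) ⊗ₜ[K] p)) l = 0 := by
      rw [← splitSum_add]
      refine splitSum_eq_zero fun u w _ => ?_
      rw [Q.act_map, TensorProduct.neg_tmul, add_neg_cancel]
    have c3 : splitSum (fun u w => splitSum (fun u v => Q.signOp (Q.act (word u) q) ⊗ₜ[K]
          ((word (v.map A.suspSign) : A.BA) ⊗ₜ[K] P.act (word w) p)) u) l
        + splitSum (fun u w => splitSum (fun u v =>
          Q.act (word (u.map A.suspSign)) (Q.signOp q) ⊗ₜ[K]
          ((word (v.map A.suspSign) : A.BA) ⊗ₜ[K] P.act (word w) p)) u) l = 0 := by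
      rw [← splitSum_add]
      refine splitSum_eq_zero fun u w _ => ?_
      rw [← splitSum_add]
      refine splitSum_eq_zero fun u w _ => ?_
      rw [Q.act_map, TensorProduct.neg_tmul, add_neg_cancel]
    have c4 : splitSum (fun u v => q ⊗ₜ[K]
          (tSign A.suspSign (A.b (word u)) ⊗ₜ[K] P.act (word v) p)) l
        + splitSum (fun u v => q ⊗ₜ[K]
          ((-tSign A.suspSign (A.b (word u))) ⊗ₜ[K] P.act (word v) p)) l = 0 := by
      rw [← splitSum_add]
      refine splitSum_eq_zero fun u w _ => ?_
      rw [TensorProduct.neg_tmul, TensorProduct.tmul_neg, add_neg_cancel]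
    have c5 : splitSum (fun u v => q ⊗ₜ[K] ((word u : A.BA) ⊗ₜ[K] P.act (A.b (word v)) p)) l
        + splitSum (fun u w => splitSum (fun v w => q ⊗ₜ[K]
          ((word u : A.BA) ⊗ₜ[K] P.act (word (v.map A.suspSign)) (P.act (word w) p))) w) l = 0 := by
      rw [← splitSum_add]
      refine splitSum_eq_zero fun u w _ => ?_
      have h : ∀ x : P.carrier, q ⊗ₜ[K] ((word u : A.BA) ⊗ₜ[K] x)
        = (TensorProduct.mk K _ _ q ∘ₗ TensorProduct.mk K _ _ (word u)) x := fun _ => rfl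
      simp only [h]
      rw [← map_splitSum, ← map_add, add_comm, P.act_rel, map_zero]
    linear_combination (norm := module) c1 + c2 + c3 + c4 + c5
  simpa using LinearMap.congr_fun this x

/-- The homogeneous elements of degree `g` in `Q ⊗ BA ⊗ P`. -/
def tensorGr (g : Γ) : Submodule K (Q.carrier ⊗[K] (A.BA ⊗[K] P.carrier)) :=
  Submodule.span K {x | ∃ i h j, ∃ q ∈ Q.gr i, ∃ l, WordDeg A.suspGr l h ∧ ∃ p ∈ P.gr j,
    i + h + j = g ∧ q ⊗ₜ (word l ⊗ₜ p) = x}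

/-- The length filtration: `Q ⊗ (BA)_{≤ n} ⊗ P`. -/
def tensorF (n : ℤ) : Submodule K (Q.carrier ⊗[K] (A.BA ⊗[K] P.carrier)) :=
  Submodule.span K {x | ∃ (q : Q.carrier) (l : List A.carrier) (p : P.carrier),
    (l.length : ℤ) ≤ n ∧ q ⊗ₜ (word l ⊗ₜ p) = x}

lemma tensorD_mem_gr (g h : Γ) (e : g + one = h) :
    ∀ x ∈ tensorGr Q P g, tensorD Q P x ∈ tensorGr Q P h := by
  intro x hx
  refine Submodule.span_induction (p := fun x _ => tensorD Q P x ∈ tensorGr Q P h)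
    ?_ (by simp) (fun x y _ _ hx hy => by rw [map_add]; exact Submodule.add_mem _ hx hy)
    (fun r x _ hx => by rw [map_smul]; exact Submodule.smul_mem _ _ hx) hx
  rintro _ ⟨i, k, j, q, hq, l, hl, p, hp, rfl, rfl⟩
  rw [tensorD_word]
  refine Submodule.add_mem _ (Submodule.add_mem _ ?_ ?_) ?_
  · refine splitSum_mem _ fun u v huv => ?_
    subst huv
    obtain ⟨a, b, hu, hv, rfl⟩ := hl.split
    refine Submodule.subset_span ⟨_, _, _, _, Q.act_deg _ _ hu _ _ hq, _, hv, _, hp, ?_, rfl⟩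
    rw [← e]
    abel
  · have hb := bar_mem (μ := A.μ) A.μ_one A.suspSign_eq A.μ_deg hl
    refine Submodule.span_induction (p := fun x _ => Q.signOp q ⊗ₜ[K] (x ⊗ₜ[K] p) ∈
      tensorGr Q P h) ?_ (by simp) (fun x y _ _ hx hy => by
        rw [TensorProduct.add_tmul, TensorProduct.tmul_add]; exact Submodule.add_mem _ hx hy)
      (fun r x _ hx => by
        rw [← TensorProduct.smul_tmul', TensorProduct.tmul_smul]
        exact Submodule.smul_mem _ _ hx) hb
    rintro _ ⟨l', hl', -, rfl⟩
    refine Submodule.subset_span ⟨_, _, _, _, Q.signOp_mem hq, _, hl', _, hp, ?_, rfl⟩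
    rw [← e]
    abel
  · refine splitSum_mem _ fun u v huv => ?_
    subst huv
    obtain ⟨a, b, hu, hv, rfl⟩ := hl.split
    refine Submodule.subset_span ⟨_, _, _, _, Q.signOp_mem hq, _, hu.map A.suspSign_eq, _,
      P.act_deg _ _ hv _ _ hp, ?_, rfl⟩
    rw [← e]
    abel

lemma tensorD_mem_F (n : ℤ) : ∀ x ∈ tensorF Q P n, tensorD Q P x ∈ tensorF Q P n := by
  intro x hx
  refine Submodule.span_induction (p := fun x _ => tensorD Q P x ∈ tensorF Q P n)
    ?_ (by simp) (fun x y _ _ hx hy => by rw [map_add]; exact Submodule.add_mem _ hx hy)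
    (fun r x _ hx => by rw [map_smul]; exact Submodule.smul_mem _ _ hx) hx
  rintro _ ⟨q, l, p, hl, rfl⟩
  rw [tensorD_word]
  refine Submodule.add_mem _ (Submodule.add_mem _ ?_ ?_) ?_
  · refine splitSum_mem _ fun u v huv => Submodule.subset_span ⟨_, _, _, ?_, rfl⟩
    subst huv
    simp at hl
    omega
  · rw [AInfAlgebra.b, bar_word]
    have h : ∀ x : A.BA, Q.signOp q ⊗ₜ[K] (x ⊗ₜ[K] p)
        = (TensorProduct.mk K _ _ (Q.signOp q) ∘ₗ (TensorProduct.mk K _ _).flip p) x :=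
      fun _ => rfl
    rw [h, map_splitSum]
    simp only [map_splitSum]
    refine splitSum_mem _ fun u v huv => splitSum_mem _ fun v w hvw => ?_
    by_cases hv0 : v = []
    · subst hv0
      simp [word_append, A.μ_one]
    refine Submodule.subset_span ⟨_, _, _, ?_, rfl⟩
    subst hvw huv
    have := List.length_pos_iff.2 hv0
    simp at hl ⊢
    omega
  · refine splitSum_mem _ fun u v huv => Submodule.subset_span ⟨_, _, _, ?_, rfl⟩
    subst huv
    simp at hl ⊢
    omega

/-- The filtered complex `Q ⊗_A P`. -/
noncomputable def tensorComplex : FilteredComplex K Γ where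
  X g := tensorGr Q P g
  d g h e := (tensorD Q P).restrict (tensorD_mem_gr Q P g h e)
  d_d g h k e e' x := Subtype.ext (tensorD_tensorD Q P x)
  F n g := (tensorF Q P n).comap (tensorGr Q P g).subtype
  F_mono m n hmn g := Submodule.comap_mono (Submodule.span_mono (by
    rintro _ ⟨q, l, p, hl, rfl⟩
    exact ⟨q, l, p, hl.trans hmn, rfl⟩))
  d_F n g h e x hx := tensorD_mem_F Q P n x hx

end Tensor

/-! ### Morphisms -/

section Hom

variable {A : AInfAlgebra K Γ} (P N : LeftModule A)

/-- The map `x ↦ (-1)^{k|x|} x` of `BA`, where `s = (-1)^k`. -/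
noncomputable def twist (A : AInfAlgebra K Γ) (s : ℤˣ) :
    A.BA →ₗ[K] A.BA :=
  if s = 1 then LinearMap.id else tSign A.suspSign

/-- The differential on maps `φ : BA ⊗ P → N` of a degree `k` with `s = (-1)^k`:
`dφ = φ ∘ (1 ⊗ μ_P) ∘ Δ + φ ∘ (b ⊗ 1) - (-1)^k μ_N ∘ (1 ⊗ φ) ∘ Δ`; see `homD_word`. -/
noncomputable def homD (s : ℤˣ) :
    (A.BA →ₗ[K] P.carrier →ₗ[K] N.carrier) →ₗ[K] (A.BA →ₗ[K] P.carrier →ₗ[K] N.carrier) where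
  toFun φ :=
    convolve ((LinearMap.llcomp K P.carrier P.carrier N.carrier).compl₁₂
        (φ ∘ₗ tSign A.suspSign) P.act)
      + φ ∘ₗ A.b
      - (s : ℤ) • convolve ((LinearMap.llcomp K P.carrier N.carrier N.carrier).compl₁₂
          (N.act ∘ₗ twist A s) φ)
  map_add' φ ψ := by
    refine ext_word fun l => ?_
    simp [convolve_word, splitSum_add]
    abel
  map_smul' r φ := by
    refine ext_word fun l => ?_
    simp [convolve_word, splitSum, Finset.smul_sum, smul_add, smul_sub, smul_comm r]

theorem homD_word (s : ℤˣ) (φ : A.BA →ₗ[K] P.carrier →ₗ[K] N.carrier) (l : List A.carrier)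
    (p : P.carrier) : homD P N s φ (word l) p =
      splitSum (fun u v => φ (word (u.map A.suspSign)) (P.act (word v) p)) l
        + φ (A.b (word l)) p
        - (s : ℤ) • splitSum (fun u v => N.act (twist A s (word u)) (φ (word v) p)) l := by
  simp [homD, convolve_word, splitSum_apply, tSign_word]

lemma homD_bar (s : ℤˣ) (φ : A.BA →ₗ[K] P.carrier →ₗ[K] N.carrier) (l : List A.carrier)
    (p : P.carrier) : homD P N s φ (A.b (word l)) p =
      splitSum (fun u v => φ (tSign A.suspSign (A.b (word u))) (P.act (word v) p)) l
      + splitSum (fun u v => φ (word u) (P.act (A.b (word v)) p)) l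
      - (s : ℤ) • splitSum (fun u v => N.act (twist A s (A.b (word u))) (φ (word v) p)) l
      - (s : ℤ) • splitSum (fun u v =>
          N.act (twist A s (word (u.map A.suspSign))) (φ (A.b (word v)) p)) l := by
  simp [homD, convolve_bar _ _ A.μ_one, splitSum_apply, tSign_word, A.b_b, splitSum_add,
    map_map_sign A.suspSign_suspSign]
  abel

lemma twist_one (x : A.BA) : twist A 1 x = x := by simp [twist]

lemma twist_neg_one (x : A.BA) : twist A (-1) x = tSign A.suspSign x := by
  rw [twist, if_neg (by decide)]

lemma homD_homD (s : ℤˣ) (φ : A.BA →ₗ[K] P.carrier →ₗ[K] N.carrier) :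
    homD P N (-s) (homD P N s φ) = 0 := by
  refine ext_word fun l => LinearMap.ext fun p => ?_
  have c1 : splitSum (fun u w => splitSum (fun u v =>
        φ (word u) (P.act (word (v.map A.suspSign)) (P.act (word w) p))) u) l
      + splitSum (fun u v => φ (word u) (P.act (A.b (word v)) p)) l = 0 := by
    rw [splitSum_assoc (fun u v w => φ (word u)
      (P.act (word (v.map A.suspSign)) (P.act (word w) p))), ← splitSum_add]
    refine splitSum_eq_zero fun u v _ => ?_
    rw [← map_splitSum (φ (word u)), ← map_add, P.act_rel, map_zero]
  rw [homD_word, homD_bar]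
  rcases Int.units_eq_one_or s with rfl | rfl
  · simp only [homD_word, splitSum_add, splitSum_sub, splitSum_neg, splitSum_map,
      map_map_sign A.suspSign_suspSign, A.b_map, map_sub, map_add, map_neg, LinearMap.neg_apply,
      LinearMap.zero_apply, twist_one, twist_neg_one, tSign_word, Units.val_one, Units.val_neg,
      one_smul, neg_smul]
    have c3 : splitSum (fun u w => splitSum (fun u v => N.act (word (u.map A.suspSign))
          (φ (word (v.map A.suspSign)) (P.act (word w) p))) u) l
        = splitSum (fun u v => N.act (word (u.map A.suspSign))
          (splitSum (fun v w => φ (word (v.map A.suspSign)) (P.act (word w) p)) v)) l := by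
      simp only [map_splitSum]
      exact splitSum_assoc (fun u v w => N.act (word (u.map A.suspSign))
          (φ (word (v.map A.suspSign)) (P.act (word w) p))) l
    have c5 : splitSum (fun u v => N.act (A.b (word u)) (φ (word v) p)) l
        + splitSum (fun u v => N.act (word (u.map A.suspSign))
          (splitSum (fun v w => N.act (word v) (φ (word w) p)) v)) l = 0 := by
      simp only [map_splitSum]
      rw [← splitSum_assoc (fun u v w => N.act (word (u.map A.suspSign))
          (N.act (word v) (φ (word w) p))), ← splitSum_add]
      refine splitSum_eq_zero fun u v _ => ?_
      rw [add_comm, N.act_rel]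
    linear_combination (norm := module) c1 - c3 - c5
  · simp only [homD_word, splitSum_add, splitSum_sub, splitSum_neg, splitSum_map,
      map_map_sign A.suspSign_suspSign, A.b_map, map_sub, map_add, map_neg, LinearMap.neg_apply,
      LinearMap.zero_apply, twist_one, twist_neg_one, tSign_word, Units.val_one, Units.val_neg,
      one_smul, neg_smul, neg_neg]
    have c3 : splitSum (fun u w => splitSum (fun u v => N.act (word u)
          (φ (word (v.map A.suspSign)) (P.act (word w) p))) u) l
        = splitSum (fun u v => N.act (word u)
          (splitSum (fun v w => φ (word (v.map A.suspSign)) (P.act (word w) p)) v)) l := by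
      simp only [map_splitSum]
      exact splitSum_assoc (fun u v w => N.act (word u)
          (φ (word (v.map A.suspSign)) (P.act (word w) p))) l
    have c5 : splitSum (fun u v => N.act (tSign A.suspSign (A.b (word u))) (φ (word v) p)) l
        - splitSum (fun u v => N.act (word u)
          (splitSum (fun v w => N.act (word (v.map A.suspSign)) (φ (word w) p)) v)) l = 0 := by
      simp only [map_splitSum]
      rw [← splitSum_assoc (fun u v w => N.act (word u)
          (N.act (word (v.map A.suspSign)) (φ (word w) p))), ← splitSum_sub]
      refine splitSum_eq_zero fun u v _ => ?_
      have h := N.act_rel (u.map A.suspSign) (φ (word v) p)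
      rw [splitSum_map, A.b_map] at h
      simp only [map_map_sign A.suspSign_suspSign, map_neg, LinearMap.neg_apply] at h
      rw [← neg_eq_zero, ← h]
      abel
    linear_combination (norm := module) c1 + c3 + c5

/-- The strictly unital morphisms `P → N` of degree `g`: the homogeneous maps `φ : BA ⊗ P → N` of
degree `g` that vanish on `[a₁|⋯|aₙ] ⊗ p` if some `aᵢ` is `e`. -/
def homGr (g : Γ) : Submodule K (A.BA →ₗ[K] P.carrier →ₗ[K] N.carrier) where
  carrier := {φ | (∀ l h, WordDeg A.suspGr l h → ∀ j, ∀ p ∈ P.gr j,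
      φ (word l) p ∈ N.gr (g + h + j)) ∧
    ∀ (l l' : List A.carrier) (p : P.carrier), φ (word (l ++ A.e :: l')) p = 0}
  add_mem' := by
    rintro φ ψ ⟨h1, h2⟩ ⟨h3, h4⟩
    exact ⟨fun l h hl j p hp => Submodule.add_mem _ (h1 l h hl j p hp) (h3 l h hl j p hp),
      fun l l' p => by simp [h2, h4]⟩
  zero_mem' := ⟨fun l h hl j p hp => Submodule.zero_mem _, fun l l' p => rfl⟩
  smul_mem' := by
    rintro r φ ⟨h1, h2⟩
    exact ⟨fun l h hl j p hp => Submodule.smul_mem _ _ (h1 l h hl j p hp),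
      fun l l' p => by simp [h2]⟩

/-- The length filtration of morphisms: `φ ∈ F n` if `φ` maps `(BA)_{≤ m} ⊗ P` into `N_{m+n}` for
all `m`, where `N_k = N` for `k ≥ 0` and `N_k = 0` for `k < 0`. Equivalently, `φ` is zero on
`(sA)^{⊗m} ⊗ P` for all `m < -n`. -/
def homF (n : ℤ) : Submodule K (A.BA →ₗ[K] P.carrier →ₗ[K] N.carrier) where
  carrier := {φ | ∀ l : List A.carrier, (l.length : ℤ) < -n → φ (word l) = 0}
  add_mem' := by
    intro φ ψ h1 h2 l hl
    simp [h1 l hl, h2 l hl]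
  zero_mem' := fun l hl => rfl
  smul_mem' := by
    intro r φ h1 l hl
    simp [h1 l hl]

lemma homD_deg (g h : Γ) (e : g + one = h) (φ) (hφ : φ ∈ homGr P N g) :
    ∀ l i, WordDeg A.suspGr l i → ∀ j, ∀ p ∈ P.gr j,
      homD P N (sgn g) φ (word l) p ∈ N.gr (h + i + j) := by
  intro l i hl j p hp
  rw [homD_word]
  refine Submodule.sub_mem _ (Submodule.add_mem _ ?_ ?_) ?_
  · refine splitSum_mem _ fun u v huv => ?_
    subst huv
    obtain ⟨a, b, hu, hv, rfl⟩ := hl.split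
    have := hφ.1 _ _ (hu.map A.suspSign_eq) _ _ (P.act_deg _ _ hv _ _ hp)
    have e' : h + (a + b) + j = g + a + (b + j + one) := by rw [← e]; abel
    rw [e']
    exact this
  · have hb := bar_mem (μ := A.μ) A.μ_one A.suspSign_eq A.μ_deg hl
    refine Submodule.span_induction (p := fun x _ => φ x p ∈ N.gr (h + i + j)) ?_ (by simp)
      (fun x y _ _ hx hy => by
        rw [map_add]; exact Submodule.add_mem _ hx hy)
      (fun r x _ hx => by
        rw [map_smul]; exact Submodule.smul_mem _ _ hx) hb
    rintro _ ⟨l', hl', -, rfl⟩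
    have := hφ.1 _ _ hl' _ _ hp
    have e' : h + i + j = g + (i + one) + j := by rw [← e]; abel
    rw [e']
    exact this
  · refine (N.gr _).toAddSubgroup.zsmul_mem (splitSum_mem _ fun u v huv => ?_) _
    subst huv
    obtain ⟨a, b, hu, hv, rfl⟩ := hl.split
    have e' : h + (a + b) + j = a + (g + b + j) + one := by rw [← e]; abel
    rw [e']
    have hv' := hφ.1 _ _ hv _ _ hp
    rcases Int.units_eq_one_or (sgn g) with hg | hg
    · rw [hg, twist_one]
      exact N.act_deg _ _ hu _ _ hv'
    · rw [hg, twist_neg_one, tSign_word]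
      exact N.act_deg _ _ (hu.map A.suspSign_eq) _ _ hv'

lemma homD_mem_F (n : ℤ) (s : ℤˣ) (φ) (hφ : φ ∈ homF P N n) : homD P N s φ ∈ homF P N n := by
  intro l hl
  refine LinearMap.ext fun p => ?_
  rw [homD_word, LinearMap.zero_apply]
  have h1 : splitSum (fun u v => φ (word (u.map A.suspSign)) (P.act (word v) p)) l = 0 := by
    refine splitSum_eq_zero fun u v huv => ?_
    subst huv
    rw [hφ, LinearMap.zero_apply]
    simp at hl ⊢
    omega
  have h2 : φ (A.b (word l)) = 0 := by
    rw [AInfAlgebra.b, bar_word, map_splitSum]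
    simp only [map_splitSum]
    refine splitSum_eq_zero fun u v huv => splitSum_eq_zero fun v w hvw => ?_
    by_cases hv0 : v = []
    · subst hv0
      simp [word_append, A.μ_one]
    subst hvw huv
    have := List.length_pos_iff.2 hv0
    rw [hφ]
    simp at hl ⊢
    omega
  have h3 : splitSum (fun u v => N.act (twist A s (word u)) (φ (word v) p)) l = 0 := by
    refine splitSum_eq_zero fun u v huv => ?_
    subst huv
    rw [hφ v, LinearMap.zero_apply, map_zero]
    simp at hl ⊢
    omega
  simp [h1, h2, h3]

lemma splitSum_last {X Y : Type*} [AddCommMonoid Y] (f : List X → List X → Y) (l : List X)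
    (h : ∀ u v, v ≠ [] → f u v = 0) : splitSum f l = f l [] := by
  induction l generalizing f with
  | nil => simp
  | cons a l ih => rw [splitSum_cons, h [] (a :: l) (by simp), zero_add, ih _ fun u v => h _ v]

lemma splitSum_first {X Y : Type*} [AddCommMonoid Y] (f : List X → List X → Y) (l : List X)
    (h : ∀ u v, u ≠ [] → f u v = 0) : splitSum f l = f [] l := by
  cases l with
  | nil => simp
  | cons a l =>
    rw [splitSum_cons, splitSum_eq_zero fun u v _ => h _ _ (by simp), add_zero]

lemma word_neg (l l' : List A.carrier) (a : A.carrier) :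
    (word (l ++ (-a) :: l') : A.BA) = -word (l ++ a :: l') := by
  simp [word_append]

lemma bar_unit (φ : A.BA →ₗ[K] N.carrier)
    (hφ : ∀ l l' : List A.carrier, φ (word (l ++ A.e :: l')) = 0) (l l' : List A.carrier) :
    φ (A.b (word (l ++ A.e :: l')))
      = (if l = [] then 0 else -φ (word (l.map A.suspSign ++ l')))
        + (if l' = [] then 0 else φ (word (l.map A.suspSign ++ l'))) := by
  rw [AInfAlgebra.b, bar_word, map_splitSum]
  simp only [map_splitSum]
  rw [splitSum_append]
  have z1 : splitSum (fun u v => splitSum (fun v₁ v₂ =>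
      φ (word ((l ++ A.e :: u).map A.suspSign ++ A.μ (word v₁) :: v₂))) v) l' = 0 := by
    refine splitSum_eq_zero fun u v _ => splitSum_eq_zero fun v w _ => ?_
    rw [List.map_append, List.map_cons, A.suspSign_e, List.append_assoc, List.cons_append,
      word_neg, map_neg, hφ, neg_zero]
  rw [z1, add_zero]
  have z2 : ∀ u v, splitSum (fun v₁ v₂ => φ (word (u ++ A.μ (word v₁) :: v₂))) (v ++ A.e :: l')
      = splitSum (fun v₁ v₂ => φ (word (u ++ A.μ (word (v ++ A.e :: v₁)) :: v₂))) l' := by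
    intro u v
    rw [splitSum_append, splitSum_eq_zero, zero_add]
    intro v w _
    have := hφ (u ++ A.μ (word v) :: w) l'
    simpa using this
  simp only [z2]
  have z3 : ∀ u v v₁ v₂ : List A.carrier, v.length + v₁.length ≠ 1 →
      φ (word (u ++ A.μ (word (v ++ A.e :: v₁)) :: v₂)) = 0 := by
    intro u v v₁ v₂ h
    rw [A.e_zero _ _ h]
    simp [word_append]
  have z4 : splitSum (fun v₁ v₂ => φ (word (l.map A.suspSign ++
      A.μ (word ([] ++ A.e :: v₁)) :: v₂))) l'
      = if l' = [] then 0 else φ (word (l.map A.suspSign ++ l')) := by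
    cases l' with
    | nil => simpa using z3 (l.map A.suspSign) [] [] [] (by simp)
    | cons c k =>
      rw [splitSum_cons, z3 _ _ _ _ (by simp), zero_add, splitSum_first]
      · simp only [List.nil_append, A.e_mul]
        simp
      · intro u v hu
        have := List.length_pos_iff.2 hu
        exact z3 _ _ _ _ (by simp; omega)
  rcases List.eq_nil_or_concat l with rfl | ⟨k, c, rfl⟩
  · simp only [splitSum_nil, if_true, zero_add]
    exact z4
  · simp only [List.concat_eq_append] at z4 ⊢
    rw [splitSum_append, splitSum_nil, z4, splitSum_last]
    · rw [if_neg (show k ++ [c] ≠ [] by simp)]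
      congr 1
      rw [splitSum_first]
      · have h1 : [] ++ [c] ++ [A.e] = [c, A.e] := rfl
        rw [h1, A.mul_e, word_neg, map_neg]
        simp
      · intro u v hu
        have := List.length_pos_iff.2 hu
        exact z3 _ _ _ _ (by simp; omega)
    · intro u v hv
      have := List.length_pos_iff.2 hv
      exact splitSum_eq_zero fun u' v' _ => z3 _ _ _ _ (by simp; omega)

lemma homD_unital (g : Γ) (φ) (hφ : φ ∈ homGr P N g) (l l' : List A.carrier) (p : P.carrier) :
    homD P N (sgn g) φ (word (l ++ A.e :: l')) p = 0 := by
  obtain ⟨-, hφ⟩ := hφ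
  rw [homD_word]
  have t2 := bar_unit N (φ.flip p) (fun l l' => hφ l l' p) l l'
  simp only [LinearMap.flip_apply] at t2
  have t1 : splitSum (fun u v => φ (word (u.map A.suspSign)) (P.act (word v) p)) (l ++ A.e :: l')
      = if l' = [] then φ (word (l.map A.suspSign ++ l')) p else 0 := by
    rw [splitSum_append, splitSum_eq_zero (l := l'), add_zero]
    · split_ifs with h
      · subst h
        rw [splitSum_last]
        · simp only [List.nil_append, List.append_nil, P.act_e]
        · intro u v hv
          have := List.length_pos_iff.2 hv
          rw [P.act_e_zero _ _ (by simp; omega), map_zero]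
      · refine splitSum_eq_zero fun u v _ => ?_
        have := List.length_pos_iff.2 h
        rw [P.act_e_zero _ _ (by omega), map_zero]
    · intro u v _
      rw [List.map_append, List.map_cons, A.suspSign_e, word_neg, map_neg, LinearMap.neg_apply, hφ,
        neg_zero]
  obtain ⟨f, t4⟩ : ∃ f : A.carrier → A.carrier, ∀ u x,
      N.act (twist A (sgn g) (word (l ++ A.e :: u))) x
        = (sgn g : ℤ) • N.act (word (l.map f ++ A.e :: u.map f)) x := by
    rcases Int.units_eq_one_or (sgn g) with hg | hg
    · exact ⟨id, fun u x => by simp [hg, twist_one]⟩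
    · refine ⟨A.suspSign, fun u x => ?_⟩
      rw [hg, twist_neg_one, tSign_word, List.map_append, List.map_cons, A.suspSign_e, word_neg]
      simp
  have t3 : splitSum (fun u v => N.act (twist A (sgn g) (word u)) (φ (word v) p))
      (l ++ A.e :: l') = if l = [] then (sgn g : ℤ) • φ (word (l.map A.suspSign ++ l')) p
        else 0 := by
    rw [splitSum_append, splitSum_eq_zero (l := l), zero_add]
    · simp only [t4]
      by_cases h : l = []
      · subst h
        rw [if_pos rfl, splitSum_first]
        · simp only [List.map_nil, List.nil_append, N.act_e]
        · intro u v hu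
          have := List.length_pos_iff.2 hu
          rw [N.act_e_zero _ _ (by simp; omega), smul_zero]
      · rw [if_neg h]
        refine splitSum_eq_zero fun u v _ => ?_
        have := List.length_pos_iff.2 h
        rw [N.act_e_zero _ _ (by simp only [List.length_map]; omega), smul_zero]
    · intro u v _
      rw [hφ, map_zero]
  rw [t1, t2, t3]
  by_cases h : l = [] <;> by_cases h' : l' = [] <;> simp [h, h', smul_smul]

/-- The filtered complex `Hom_A(P, N)` of strictly unital morphisms. -/
noncomputable def homComplex : FilteredComplex K Γ where
  X g := homGr P N g
  d g h e := (homD P N (sgn g)).restrict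
    (show ∀ φ ∈ homGr P N g, homD P N (sgn g) φ ∈ homGr P N h from
      fun φ hφ => ⟨homD_deg P N g h e φ hφ, homD_unital P N g φ hφ⟩)
  d_d g h k e e' x := Subtype.ext (by
    have : sgn h = -sgn g := by rw [← e, sgn_add, sgn_one, mul_neg, mul_one]
    simp [LinearMap.restrict_apply, this, homD_homD])
  F n g := (homF P N n).comap (homGr P N g).subtype
  F_mono m n hmn g := Submodule.comap_mono
    (show homF P N m ≤ homF P N n from fun φ hφ l hl => hφ l (by omega))
  d_F n g h e x hx := homD_mem_F P N n _ x.1 (Submodule.mem_comap.1 hx)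

end Hom

section Lengths

variable {A : AInfAlgebra K Γ} (P : LeftModule A)

/-- The length of the functor `_ ⊗_A P` on right `A`-modules. -/
noncomputable def tensorLength : ENNReal := ⨆ Q : RightModule A, (tensorComplex Q P).length

/-- The length of the functor `Hom_A(P, _)` on left `A`-modules. -/
noncomputable def homLength : ENNReal := ⨆ N : LeftModule A, (homComplex P N).length

end Lengths

end Main
end AInfinity

/-! The proof is by duality. The graded dual of a right module `Q` is a left module `dualModule Q`.
Currying identifies homogeneous maps `BA ⊗ P → Q^∨` with homogeneous functionals on `Q ⊗ BA ⊗ P`,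
and up to signs the differential of Hom becomes the transpose of that of `Q ⊗_A P`
(`uncurry_homD_one`, `uncurry_homD_neg_one`). Vanishing on words of length at most `n` is membership
in `F_{-(n+1)}` of Hom.

If `n` is the integer part of the length of `Hom_A(P, _)`, assumed finite, then `H(Hom_A(P,
N))_{-(n+1)} = 0` for all `N`, since otherwise `ℓ₋ ≤ -(n+1)` (`le_length`). Suppose a homogeneous
cocycle `x` of `Q ⊗_A P` were not in `im d + F_n + D`, where `D` is spanned by the words containing
the unit. A functional separating `x` from this subspace can be taken homogeneous. It is then a
cocycle of `Hom_A(P, Q^∨)` in `F_{-(n+1)}`, hence a coboundary, hence zero on cocycles, a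
contradiction (`functional_apply_eq_zero`, `exists_homogeneous_representative`).

The summand `D` is forced by the setting: Hom consists of strictly unital maps, whereas the tensor
product uses the full bar construction. To get `x ∈ im d + F_n` one needs a normalization theorem
with control of lengths (`exists_eq_tensorD_add`). There are two cases.

If the unit is `μ¹(a)`, then the action of `a` contracts the leading part of the differential and `Q
⊗_A P` is acyclic (`exists_tensorD_eq_of_unit_exact`).

Otherwise there is a functional `c` of degree zero on `A` with `c(e) = 1` and `c ∘ μ¹ = 0`
(`exists_counit`). Doubling a unit, `[u|e|v] ↦ ±[u|e|e|v]`, is a contracting homotopy of `D` up to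
words with a unit further to the left (`homotopy_unitSpan`). Its extension by means of `c`
anticommutes with the length-preserving part of the differential, so a cocycle in `D ∩ F_n` bounds
in `D ∩ F_{n+1}` (`exists_tensorD_eq`). In `exists_normalize` the loss of one in length is made up
by the fact that the error term there lies in `F_{n-1}`.

Thus `H(Q ⊗_A P)_n` is everything, and since the filtration vanishes in negative degrees both `ℓ₊`
and `ℓ₋` lie between `0` and `n`. -/

namespace AInfinity

open TensorProduct ParityGrading

section Main

variable {K : Type u} [Field K] {Γ : Type w} [AddCommGroup Γ] [ParityGrading Γ]

/-! ### The bar differential on words containing the unit -/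

section UnitWords

lemma splitSum_sub_first_mem {X Y R : Type*} [AddCommGroup Y] [Semiring R] [Module R Y]
    (S : Submodule R Y) (f : List X → List X → Y) (l : List X)
    (h : ∀ u v, u ++ v = l → u ≠ [] → f u v ∈ S) : splitSum f l - f [] l ∈ S := by
  cases l with
  | nil => simp
  | cons a l =>
    rw [splitSum_cons, add_sub_cancel_left]
    exact splitSum_mem _ fun u v huv => h _ _ (by simp [huv]) (by simp)

lemma splitSum_sub_last_mem {X Y R : Type*} [AddCommGroup Y] [Semiring R] [Module R Y]
    (S : Submodule R Y) (f : List X → List X → Y) (l : List X)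
    (h : ∀ u v, u ++ v = l → v ≠ [] → f u v ∈ S) : splitSum f l - f l [] ∈ S := by
  induction l generalizing f with
  | nil => simp
  | cons a l ih =>
    rw [splitSum_cons, add_sub_assoc]
    exact Submodule.add_mem _ (h _ _ (by simp) (by simp))
      (ih _ fun u v huv hv => h _ _ (by simp [huv]) hv)

variable (A : AInfAlgebra K Γ)

lemma headOp_nil : headOp A.μ (1 : A.BA) = 0 := by
  simpa [A.μ_one] using headOp_word A.μ []

/-- By strict unitality, a block that contains the displayed `e` contributes only if it has two
letters. This leaves `μ²(e, v₁)` when `u` is empty and `μ²(a, e)` when `u = [a]`. -/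
lemma headOp_unit (u v : List A.carrier) : headOp A.μ (word (u ++ A.e :: v) : A.BA)
    = headOp A.μ (word u) * word (A.e :: v)
      + (if u = [] then (if v = [] then 0 else word v) else 0)
      - (if u.length = 1 then word (u.map A.suspSign) * word v else 0) := by
  rw [headOp_word, splitSum_append, headOp_word, splitSum_mul, add_sub_assoc]
  congr 1
  · exact splitSum_congr fun u₁ u₂ _ => by rw [← List.cons_append, word_append]
  have z : ∀ v₁ v₂ : List A.carrier, u.length + v₁.length ≠ 1 →
      (word (A.μ (word (u ++ A.e :: v₁)) :: v₂) : A.BA) = 0 := by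
    intro v₁ v₂ h
    rw [A.e_zero _ _ h]
    simp
  match u, z with
  | [], z =>
    cases v with
    | nil => simpa using z [] [] (by simp)
    | cons c k =>
      rw [splitSum_cons, z _ _ (by simp), zero_add, splitSum_first]
      · simp only [List.nil_append, A.e_mul]
        simp
      · intro u v hu
        have := List.length_pos_iff.2 hu
        exact z _ _ (by simp; omega)
  | [a], z =>
    rw [splitSum_first]
    · simp only [List.cons_append, List.nil_append, A.mul_e]
      simp
    · intro u v hu
      have := List.length_pos_iff.2 hu
      exact z _ _ (by simp; omega)
  | a :: b :: u, z =>
    rw [splitSum_eq_zero fun u v _ => z _ _ (by simp; omega)]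
    simp

/-- The two products of `e` with its neighbours delete it and carry opposite signs, so they cancel
when both neighbours exist. Otherwise the surviving one is cancelled by a module action, see
`tensorD_unit`. -/
lemma b_unit (u v : List A.carrier) : A.b (word (u ++ A.e :: v) : A.BA)
    = A.b (word u) * word (A.e :: v)
      + (if v = [] then 0 else word (u.map A.suspSign ++ v))
      - (if u = [] then 0 else word (u.map A.suspSign ++ v))
      - word (u.map A.suspSign ++ [A.e]) * A.b (word v) := by
  induction u with
  | nil =>
    have b1 : A.b 1 = 0 := by simpa [A.μ_one] using bar_word A.suspSign A.μ []
    have := headOp_unit A [] v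
    simp only [List.nil_append] at this
    rw [List.nil_append, AInfAlgebra.b, bar_cons, this, A.suspSign_e]
    simp [headOp_nil, b1, sub_eq_add_neg]
  | cons a u ih =>
    have := headOp_unit A (a :: u) v
    rw [List.cons_append] at this
    rw [List.cons_append, AInfAlgebra.b, bar_cons, this, ih, bar_cons]
    by_cases hu : u = [] <;> by_cases hv : v = [] <;>
      simp [hu, hv, mul_add, add_mul, mul_sub, mul_assoc, word_append] <;> abel

end UnitWords

/-! ### The differential of `Q ⊗_A P` on words containing the unit -/

section TensorUnit

variable {A : AInfAlgebra K Γ} (Q : RightModule A) (P : LeftModule A)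

/-- A unit in a word separates it: every term in which `e` interacts with a letter, with `q` or with
`p` cancels against the one on its other side. The differential therefore acts on `q ⊗ u` and on `v
⊗ p` independently. The minus signs on the right come from passing `e`, which is odd in `sA`. -/
lemma tensorD_unit (q : Q.carrier) (u v : List A.carrier) (p : P.carrier) :
    tensorD Q P (q ⊗ₜ (word (u ++ A.e :: v) ⊗ₜ p)) =
      splitSum (fun u₁ u₂ => Q.act (word u₁) q ⊗ₜ[K] ((word (u₂ ++ A.e :: v) : A.BA) ⊗ₜ[K] p)) u
        + Q.signOp q ⊗ₜ[K] ((A.b (word u) * word (A.e :: v)) ⊗ₜ[K] p)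
        - Q.signOp q ⊗ₜ[K] ((word (u.map A.suspSign ++ [A.e]) * A.b (word v)) ⊗ₜ[K] p)
        - splitSum (fun v₁ v₂ => Q.signOp q ⊗ₜ[K]
            ((word (u.map A.suspSign ++ A.e :: v₁.map A.suspSign) : A.BA)
              ⊗ₜ[K] P.act (word v₂) p)) v := by
  rw [tensorD_word, b_unit, splitSum_append, splitSum_append]
  have h1 : splitSum (fun w₁ w₂ => Q.act (word (u ++ A.e :: w₁)) q ⊗ₜ[K]
      ((word w₂ : A.BA) ⊗ₜ[K] p)) v
      = if u = [] then -(Q.signOp q ⊗ₜ[K] ((word v : A.BA) ⊗ₜ[K] p)) else 0 := by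
    split_ifs with hu
    · subst hu
      rw [splitSum_first]
      · simp only [List.nil_append, Q.act_e, TensorProduct.neg_tmul]
      · intro w₁ w₂ hw
        have := List.length_pos_iff.2 hw
        rw [Q.act_e_zero _ _ (by simp; omega), TensorProduct.zero_tmul]
    · have := List.length_pos_iff.2 hu
      exact splitSum_eq_zero fun w₁ w₂ _ => by
        rw [Q.act_e_zero _ _ (by omega), TensorProduct.zero_tmul]
  have h2 : splitSum (fun w₁ w₂ => Q.signOp q ⊗ₜ[K] ((word (w₁.map A.suspSign) : A.BA)
      ⊗ₜ[K] P.act (word (w₂ ++ A.e :: v)) p)) u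
      = if v = [] then Q.signOp q ⊗ₜ[K] ((word (u.map A.suspSign) : A.BA) ⊗ₜ[K] p) else 0 := by
    split_ifs with hv
    · subst hv
      rw [splitSum_last]
      · simp only [List.nil_append, P.act_e]
      · intro w₁ w₂ hw
        have := List.length_pos_iff.2 hw
        rw [P.act_e_zero _ _ (by simp; omega), TensorProduct.tmul_zero, TensorProduct.tmul_zero]
    · have := List.length_pos_iff.2 hv
      exact splitSum_eq_zero fun w₁ w₂ _ => by
        rw [P.act_e_zero _ _ (by omega), TensorProduct.tmul_zero, TensorProduct.tmul_zero]
  have h3 : splitSum (fun w₁ w₂ => Q.signOp q ⊗ₜ[K]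
      ((word ((u ++ A.e :: w₁).map A.suspSign) : A.BA) ⊗ₜ[K] P.act (word w₂) p)) v
      = -splitSum (fun v₁ v₂ => Q.signOp q ⊗ₜ[K]
            ((word (u.map A.suspSign ++ A.e :: v₁.map A.suspSign) : A.BA)
              ⊗ₜ[K] P.act (word v₂) p)) v := by
    rw [← splitSum_neg]
    refine splitSum_congr fun w₁ w₂ _ => ?_
    rw [List.map_append, List.map_cons, A.suspSign_e, word_neg, TensorProduct.neg_tmul,
      TensorProduct.tmul_neg]
  rw [h1, h2, h3]
  by_cases hu : u = [] <;> by_cases hv : v = [] <;>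
    simp [hu, hv, TensorProduct.tmul_add, TensorProduct.tmul_sub, TensorProduct.add_tmul,
      TensorProduct.sub_tmul] <;> abel

/-- The span of the tensors `q ⊗ [u|e|v] ⊗ p` with `u` of length less than `k`. -/
def unitSpan (k : ℕ) : Submodule K (Q.carrier ⊗[K] (A.BA ⊗[K] P.carrier)) :=
  Submodule.span K {x | ∃ (q : Q.carrier) (u v : List A.carrier) (p : P.carrier),
    u.length < k ∧ q ⊗ₜ (word (u ++ A.e :: v) ⊗ₜ p) = x}

variable {Q P}

lemma unitSpan_mono {k m : ℕ} (h : k ≤ m) : unitSpan Q P k ≤ unitSpan Q P m :=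
  Submodule.span_mono (by
    rintro _ ⟨q, u, v, p, hu, rfl⟩
    exact ⟨q, u, v, p, hu.trans_le h, rfl⟩)

lemma tmul_word_mem_unitSpan {k : ℕ} (q : Q.carrier) {u : List A.carrier} (v : List A.carrier)
    (p : P.carrier) (hu : u.length < k) :
    q ⊗ₜ[K] ((word (u ++ A.e :: v) : A.BA) ⊗ₜ[K] p) ∈ unitSpan Q P k :=
  Submodule.subset_span ⟨q, u, v, p, hu, rfl⟩

lemma map_mem_of_words {M : Type*} [AddCommGroup M] [Module K M] (S : Submodule K M)
    (f : A.BA →ₗ[K] M) (h : ∀ l, f (word l) ∈ S) (x : A.BA) : f x ∈ S := by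
  have hx : x ∈ Submodule.span K (Set.range (word : List A.carrier → A.BA)) := by
    rw [span_word]
    exact Submodule.mem_top
  refine Submodule.span_induction (p := fun x _ => f x ∈ S) ?_ (by simp)
    (fun x y _ _ hx hy => by rw [map_add]; exact Submodule.add_mem _ hx hy)
    (fun r x _ hx => by rw [map_smul]; exact Submodule.smul_mem _ _ hx) hx
  rintro _ ⟨l, rfl⟩
  exact h l

/-- The linear map `x ↦ q ⊗ x ⊗ p`. -/
noncomputable def insertBetween (q : Q.carrier) (p : P.carrier) :
    A.BA →ₗ[K] Q.carrier ⊗[K] (A.BA ⊗[K] P.carrier) :=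
  TensorProduct.mk K _ _ q ∘ₗ (TensorProduct.mk K _ _).flip p

@[simp] lemma insertBetween_apply (q : Q.carrier) (p : P.carrier) (x : A.BA) :
    insertBetween q p x = q ⊗ₜ[K] (x ⊗ₜ[K] p) := rfl

lemma tmul_mul_mem_unitSpan {k : ℕ} (q : Q.carrier) {u : List A.carrier} (x : A.BA)
    (p : P.carrier) (hu : u.length < k) :
    q ⊗ₜ[K] ((word (u ++ [A.e]) * x) ⊗ₜ[K] p) ∈ unitSpan Q P k := by
  refine map_mem_of_words _ (insertBetween q p ∘ₗ LinearMap.mulLeft K (word (u ++ [A.e])))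
    (fun l => ?_) x
  have := tmul_word_mem_unitSpan q l p hu
  simpa [word_append, mul_assoc] using this

lemma tmul_b_mul_mem_unitSpan {k : ℕ} (q : Q.carrier) {u : List A.carrier} (v : List A.carrier)
    (p : P.carrier) (hu : u.length < k) :
    q ⊗ₜ[K] ((A.b (word u) * word (A.e :: v)) ⊗ₜ[K] p) ∈ unitSpan Q P k := by
  rw [AInfAlgebra.b, bar_word, splitSum_mul]
  simp only [splitSum_mul, ← word_append]
  rw [← insertBetween_apply, map_splitSum]
  simp only [map_splitSum]
  refine splitSum_mem _ fun u₁ u₂ h => splitSum_mem _ fun v₁ v₂ h' => ?_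
  by_cases hv : v₁ = []
  · subst hv
    simp [A.μ_one, word_append]
  have := List.length_pos_iff.2 hv
  refine tmul_word_mem_unitSpan q v p ?_
  subst h h'
  simp at hu ⊢
  omega

/-- By `tensorD_unit` the unit survives, and the part of the word to its left never grows. -/
lemma tensorD_mem_unitSpan {k : ℕ} {x} (hx : x ∈ unitSpan Q P k) :
    tensorD Q P x ∈ unitSpan Q P k := by
  refine Submodule.span_induction (p := fun x _ => tensorD Q P x ∈ unitSpan Q P k) ?_ (by simp)
    (fun x y _ _ hx hy => by rw [map_add]; exact Submodule.add_mem _ hx hy)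
    (fun r x _ hx => by rw [map_smul]; exact Submodule.smul_mem _ _ hx) hx
  rintro _ ⟨q, u, v, p, hu, rfl⟩
  rw [tensorD_unit]
  refine Submodule.sub_mem _ (Submodule.sub_mem _ (Submodule.add_mem _ ?_ ?_) ?_) ?_
  · refine splitSum_mem _ fun u₁ u₂ h => tmul_word_mem_unitSpan _ _ _ ?_
    subst h
    simp at hu
    omega
  · exact tmul_b_mul_mem_unitSpan _ _ _ hu
  · exact tmul_mul_mem_unitSpan _ _ _ (by simpa using hu)
  · exact splitSum_mem _ fun v₁ v₂ h => tmul_word_mem_unitSpan _ _ _ (by simpa using hu)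

end TensorUnit

/-! ### The contracting homotopy of the degenerate words -/

section Homotopy

variable {A : AInfAlgebra K Γ} (c : A.carrier →ₗ[K] K)

/-- The map `a ↦ a - c(a) e`, which is the projection onto `ker c` along `e` if `c(e) = 1`. -/
noncomputable def unitProj : A.carrier →ₗ[K] A.carrier := LinearMap.id - c.smulRight A.e

lemma unitProj_apply (a : A.carrier) : unitProj c a = a - c a • A.e := rfl

/-- Auxiliary to `doubleUnit`. -/
noncomputable def doubleUnitAux : A.BA →ₐ[K] Module.End K (A.BA × A.BA) :=
  TensorAlgebra.lift K
    { toFun := fun a =>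
        LinearMap.prod
          (LinearMap.mulLeft K (TensorAlgebra.ι K a) ∘ₗ LinearMap.fst K _ _)
          (c a • LinearMap.mulLeft K (word [A.e, A.e]) ∘ₗ LinearMap.fst K _ _
            + LinearMap.mulLeft K (TensorAlgebra.ι K (A.suspSign (unitProj c a))) ∘ₗ
                LinearMap.snd K _ _)
      map_add' := by
        intro a b
        ext x <;> simp [add_mul, add_smul]
      map_smul' := by
        intro r a
        ext x <;> simp [mul_smul] }

/-- The map `[a₁|⋯|aₙ] ↦ ∑ₖ c(aₖ) [σ π a₁|⋯|σ π aₖ₋₁|e|e|aₖ₊₁|⋯|aₙ]`, where `π = unitProj c`. -/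
noncomputable def doubleUnit : A.BA →ₗ[K] A.BA :=
  LinearMap.snd K _ _ ∘ₗ LinearMap.applyₗ (1, 0) ∘ₗ (doubleUnitAux c).toLinearMap

lemma doubleUnitAux_fst (x : A.BA) : (doubleUnitAux c x (1, 0)).1 = x := by
  have : LinearMap.fst K _ _ ∘ₗ LinearMap.applyₗ (1, 0) ∘ₗ (doubleUnitAux c).toLinearMap
      = LinearMap.id := by
    refine ext_word fun l => ?_
    induction l with
    | nil => simp
    | cons a l ih => simp [doubleUnitAux] at ih ⊢; simp [ih]
  exact LinearMap.congr_fun this x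

@[simp] lemma doubleUnit_one : doubleUnit c (1 : A.BA) = 0 := by simp [doubleUnit]

lemma doubleUnit_ι_mul (a : A.carrier) (x : A.BA) : doubleUnit c (TensorAlgebra.ι K a * x)
    = c a • (word [A.e, A.e] * x)
      + TensorAlgebra.ι K (A.suspSign (unitProj c a)) * doubleUnit c x := by
  have h := doubleUnitAux_fst c x
  simp [doubleUnit, doubleUnitAux] at h ⊢
  simp [h, mul_assoc]

variable {c}

/-- A term of `doubleUnit` at a letter of `u` has a unit within the first `u.length` places, and so
does the error of replacing `π a` by `a`. At the displayed `e` the coefficient is `c(e) = 1`, and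
later terms vanish because `π e = 0`. The map `f` is arbitrary so that the induction can absorb the
first letter into it. -/
lemma doubleUnit_unit_sub_mem (he : c A.e = 1) {M : Type*} [AddCommGroup M] [Module K M]
    (u v : List A.carrier) (S : Submodule K M) (f : A.BA →ₗ[K] M)
    (hS : ∀ u' v' : List A.carrier, u'.length < u.length → f (word (u' ++ A.e :: v')) ∈ S) :
    f (doubleUnit c (word (u ++ A.e :: v)) - word (u.map A.suspSign ++ A.e :: A.e :: v)) ∈ S := by
  induction u generalizing f with
  | nil =>
    rw [List.nil_append, word_cons, doubleUnit_ι_mul, unitProj_apply]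
    simp [he, mul_assoc]
  | cons a u ih =>
    have h1 := ih (f ∘ₗ LinearMap.mulLeft K (TensorAlgebra.ι K (A.suspSign (unitProj c a)))) (by
      intro u' v' h
      simpa using hS (A.suspSign (unitProj c a) :: u') v' (by simpa using h))
    have h2 := hS [] (A.e :: (u ++ A.e :: v)) (by simp)
    have h3 := hS [] (u.map A.suspSign ++ A.e :: A.e :: v) (by simp)
    have e : f (doubleUnit c (word (a :: u ++ A.e :: v))
          - word ((a :: u).map A.suspSign ++ A.e :: A.e :: v))
        = c a • f (word ([] ++ A.e :: A.e :: (u ++ A.e :: v)))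
          + f (TensorAlgebra.ι K (A.suspSign (unitProj c a)) * (doubleUnit c (word (u ++ A.e :: v))
              - word (u.map A.suspSign ++ A.e :: A.e :: v)))
          + c a • f (word ([] ++ A.e :: (u.map A.suspSign ++ A.e :: A.e :: v))) := by
      rw [List.cons_append, word_cons, doubleUnit_ι_mul, unitProj_apply]
      simp [A.suspSign_e, mul_sub, add_mul, mul_assoc]
      abel
    rw [e]
    exact Submodule.add_mem _ (Submodule.add_mem _ (Submodule.smul_mem _ _ h2) h1)
      (Submodule.smul_mem _ _ h3)

variable (c) (Q : RightModule A) (P : LeftModule A)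

/-- The map `q ⊗ x ⊗ p ↦ -(-1)^{|q|} q ⊗ doubleUnit x ⊗ p`. -/
noncomputable def unitHomotopy :
    Q.carrier ⊗[K] (A.BA ⊗[K] P.carrier) →ₗ[K] Q.carrier ⊗[K] (A.BA ⊗[K] P.carrier) :=
  -TensorProduct.map Q.signOp ((doubleUnit c).rTensor P.carrier)

variable {Q P}

lemma unitHomotopy_tmul (q : Q.carrier) (x : A.BA) (p : P.carrier) :
    unitHomotopy c Q P (q ⊗ₜ (x ⊗ₜ p)) = -(Q.signOp q ⊗ₜ (doubleUnit c x ⊗ₜ p)) := rfl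

variable {c}

lemma unitHomotopy_unit_mod (he : c A.e = 1) {k : ℕ} (q : Q.carrier) {u : List A.carrier}
    (v : List A.carrier) (p : P.carrier) (hu : u.length ≤ k) :
    (unitSpan Q P k).mkQ (unitHomotopy c Q P (q ⊗ₜ (word (u ++ A.e :: v) ⊗ₜ p)))
      = -(unitSpan Q P k).mkQ
          (Q.signOp q ⊗ₜ (word (u.map A.suspSign ++ A.e :: A.e :: v) ⊗ₜ p)) := by
  rw [eq_neg_iff_add_eq_zero, ← map_add, Submodule.mkQ_apply, Submodule.Quotient.mk_eq_zero]
  have := doubleUnit_unit_sub_mem he u v (unitSpan Q P k) (insertBetween (-Q.signOp q) p)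
    fun u' v' h => tmul_word_mem_unitSpan _ _ _ (h.trans_le hu)
  rw [unitHomotopy_tmul]
  simpa [TensorProduct.tmul_sub, TensorProduct.sub_tmul, TensorProduct.neg_tmul] using this

lemma unitHomotopy_mul_mod (he : c A.e = 1) {k : ℕ} (q : Q.carrier) {u : List A.carrier}
    (x : A.BA) (p : P.carrier) (hu : u.length ≤ k) :
    (unitSpan Q P k).mkQ (unitHomotopy c Q P (q ⊗ₜ ((word (u ++ [A.e]) * x) ⊗ₜ p)))
      = -(unitSpan Q P k).mkQ
          (Q.signOp q ⊗ₜ ((word (u.map A.suspSign ++ [A.e, A.e]) * x) ⊗ₜ p)) := by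
  have : (unitSpan Q P k).mkQ ∘ₗ unitHomotopy c Q P ∘ₗ insertBetween q p ∘ₗ
        LinearMap.mulLeft K (word (u ++ [A.e]))
      = -((unitSpan Q P k).mkQ ∘ₗ insertBetween (Q.signOp q) p ∘ₗ
        LinearMap.mulLeft K (word (u.map A.suspSign ++ [A.e, A.e]))) := by
    refine ext_word fun l => ?_
    have := unitHomotopy_unit_mod he (P := P) q l p hu
    simpa [word_append, mul_assoc] using this
  simpa using LinearMap.congr_fun this x

/-- There is no minus sign here, in contrast to `unitHomotopy_unit_mod`: the sign operator
anticommutes with `b`. -/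
lemma unitHomotopy_b_mod (he : c A.e = 1) {k : ℕ} (q : Q.carrier) {u : List A.carrier}
    (v : List A.carrier) (p : P.carrier) (hu : u.length ≤ k) :
    (unitSpan Q P k).mkQ (unitHomotopy c Q P (q ⊗ₜ ((A.b (word u) * word (A.e :: v)) ⊗ₜ p)))
      = (unitSpan Q P k).mkQ
          (Q.signOp q ⊗ₜ ((A.b (word (u.map A.suspSign)) * word (A.e :: A.e :: v)) ⊗ₜ p)) := by
  rw [A.b_map, AInfAlgebra.b, bar_word, map_splitSum, ← splitSum_neg, splitSum_mul, splitSum_mul]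
  simp only [map_splitSum, splitSum_mul, ← word_append]
  rw [← insertBetween_apply, ← insertBetween_apply]
  simp only [map_splitSum]
  refine splitSum_congr fun u₁ u₂ h => ?_
  rw [← splitSum_neg, splitSum_mul]
  simp only [map_splitSum]
  refine splitSum_congr fun v₁ v₂ h' => ?_
  -- An empty block would lengthen the word, but `μ` vanishes on it; all other blocks keep the part
  -- before the unit of length at most `k`.
  by_cases hv : v₁ = []
  · subst hv
    simp [A.μ_one, word_append]
  have := List.length_pos_iff.2 hv
  rw [insertBetween_apply, unitHomotopy_unit_mod he]
  · rw [tSign_word, neg_mul, map_neg, map_neg, ← word_append, insertBetween_apply]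
  · subst h h'
    simp at hu ⊢
    omega

lemma unitHomotopy_mem_unitSpan (he : c A.e = 1) {k : ℕ} {x} (hx : x ∈ unitSpan Q P k) :
    unitHomotopy c Q P x ∈ unitSpan Q P k := by
  refine Submodule.span_induction (p := fun x _ => unitHomotopy c Q P x ∈ unitSpan Q P k) ?_
    (by simp) (fun x y _ _ hx hy => by rw [map_add]; exact Submodule.add_mem _ hx hy)
    (fun r x _ hx => by rw [map_smul]; exact Submodule.smul_mem _ _ hx) hx
  rintro _ ⟨q, u, v, p, hu, rfl⟩
  have := unitHomotopy_unit_mod he (P := P) q v p hu.le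
  rw [eq_neg_iff_add_eq_zero, ← map_add, Submodule.mkQ_apply, Submodule.Quotient.mk_eq_zero] at this
  exact (Submodule.add_mem_iff_left _ (tmul_word_mem_unitSpan _ _ _ (by simpa using hu))).1 this

/-- Modulo `unitSpan Q P k` the homotopy turns `[u|e|v]` into `±[u|e|e|v]`. In both words the
differential acts separately on the two sides of the first `e`, and these contributions cancel. What
remains is the action of the second `e` on `v` or, if `v` is empty, on `p`, and this is the
identity. -/
lemma homotopy_unitSpan (he : c A.e = 1) {k : ℕ} {x} (hx : x ∈ unitSpan Q P (k + 1)) :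
    x - tensorD Q P (unitHomotopy c Q P x) - unitHomotopy c Q P (tensorD Q P x)
      ∈ unitSpan Q P k := by
  refine Submodule.span_induction (p := fun x _ => x - tensorD Q P (unitHomotopy c Q P x)
    - unitHomotopy c Q P (tensorD Q P x) ∈ unitSpan Q P k) ?_ (by simp)
    (fun x y _ _ hx hy => by
      have := Submodule.add_mem _ hx hy
      simp only [map_add]
      convert this using 1
      abel)
    (fun r x _ hx => by
      simp only [map_smul, ← smul_sub]
      exact Submodule.smul_mem _ _ hx) hx
  rintro _ ⟨q, u, v, p, hu, rfl⟩
  have hu : u.length ≤ k := by omega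
  have hh := unitHomotopy_unit_mod he (P := P) q v p hu
  rw [eq_neg_iff_add_eq_zero, ← map_add, Submodule.mkQ_apply,
    Submodule.Quotient.mk_eq_zero] at hh
  -- The subspace `unitSpan Q P k` is a subcomplex, so the homotopy may be replaced by its leading
  -- term also under the differential.
  have hd := tensorD_mem_unitSpan hh
  rw [← Submodule.Quotient.mk_eq_zero, ← Submodule.mkQ_apply, map_add, map_add,
    ← eq_neg_iff_add_eq_zero] at hd
  have bv : A.b (word (A.e :: v)) = (if v = [] then 0 else word v) - word [A.e] * A.b (word v) := by
    have := b_unit A [] v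
    have b1 : A.b 1 = 0 := by simpa [A.μ_one] using bar_word A.suspSign A.μ []
    simpa [b1] using this
  rw [← Submodule.Quotient.mk_eq_zero, ← Submodule.mkQ_apply, map_sub, map_sub, hd, tensorD_unit,
    tensorD_unit]
  simp only [map_add, map_sub, map_splitSum, unitHomotopy_mul_mod he _ _ _ (show
      (u.map A.suspSign).length ≤ k by simpa using hu), unitHomotopy_b_mod he _ _ _ hu,
    unitHomotopy_unit_mod he _ _ _ (show (u.map A.suspSign).length ≤ k by simpa using hu),
    map_map_sign A.suspSign_suspSign, Q.signOp_signOp, splitSum_map, splitSum_neg]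
  -- The sign of the homotopy and the sign in `Q.act_map` cancel.
  have e1 : splitSum (fun u₁ u₂ => (unitSpan Q P k).mkQ (unitHomotopy c Q P
      (Q.act (word u₁) q ⊗ₜ[K] (word (u₂ ++ A.e :: v) ⊗ₜ[K] p)))) u
      = splitSum (fun u₁ u₂ => (unitSpan Q P k).mkQ
        (Q.act (word (u₁.map A.suspSign)) (Q.signOp q) ⊗ₜ[K]
          ((word (u₂.map A.suspSign ++ A.e :: A.e :: v) : A.BA) ⊗ₜ[K] p))) u := by
    refine splitSum_congr fun u₁ u₂ h => ?_
    rw [unitHomotopy_unit_mod he, Q.act_map, TensorProduct.neg_tmul, map_neg]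
    subst h
    simp at hu
    omega
  -- The cut before the second unit lets `e :: v` act on `p`, which is nonzero only for empty `v`.
  -- The other cuts pass the odd letter `e` and acquire a minus sign.
  have e2 : splitSum (fun v₁ v₂ => (unitSpan Q P k).mkQ (q ⊗ₜ[K]
        ((word (u ++ A.e :: v₁.map A.suspSign) : A.BA) ⊗ₜ[K] P.act (word v₂) p))) (A.e :: v)
      = (if v = [] then (unitSpan Q P k).mkQ (q ⊗ₜ[K] ((word (u ++ [A.e]) : A.BA) ⊗ₜ[K] p)) else 0)
        - splitSum (fun v₁ v₂ => (unitSpan Q P k).mkQ (q ⊗ₜ[K]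
        ((word (u ++ A.e :: A.e :: v₁.map A.suspSign) : A.BA) ⊗ₜ[K] P.act (word v₂) p))) v := by
    rw [splitSum_cons, sub_eq_add_neg, ← splitSum_neg]
    congr 1
    · split_ifs with h
      · subst h
        rw [P.act_e]
        rfl
      · have := P.act_e_zero [] v (by simpa using h) p
        rw [List.nil_append] at this
        rw [this]
        simp
    · refine splitSum_congr fun v₁ v₂ _ => ?_
      have := word_neg (u ++ [A.e]) (v₁.map A.suspSign) A.e
      simp only [List.append_assoc, List.cons_append, List.nil_append] at this
      rw [List.map_cons, A.suspSign_e, this, TensorProduct.neg_tmul, TensorProduct.tmul_neg,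
        map_neg]
  rw [e1, e2, bv]
  by_cases hv : v = []
  · simp [hv, word_append, mul_assoc, TensorProduct.tmul_neg, TensorProduct.neg_tmul]
    abel
  · simp [hv, word_append, mul_assoc, mul_sub, TensorProduct.sub_tmul, TensorProduct.tmul_sub]
    abel

end Homotopy

/-! ### The length-preserving part of the differential -/

section Leading

lemma ιInv_word_of_length_ne {V : Type u} [AddCommGroup V] [Module K V] {l : List V}
    (h : l.length ≠ 1) : TensorAlgebra.ιInv (word l : TensorAlgebra K V) = 0 := by
  match l, h with
  | [], _ =>
    -- `ιInv` is defined through the trivial square-zero extension, which requires the opposite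
    -- scalar action.
    let : Module Kᵐᵒᵖ V := Module.compHom _ ((RingHom.id K).fromOpposite mul_comm)
    have : IsCentralScalar K V := ⟨fun _ _ => rfl⟩
    rw [word_nil]
    exact congrArg TrivSqZeroExt.snd
      (map_one (TensorAlgebra.toTrivSqZeroExt : TensorAlgebra K V →ₐ[K] TrivSqZeroExt K V))
  | a :: b :: l, _ =>
    simp [TensorAlgebra.ιInv, ← mul_assoc, TrivSqZeroExt.inr_mul_inr]

lemma tSign_mul {V : Type u} [AddCommGroup V] [Module K V] (f : V →ₗ[K] V)
    (x y : TensorAlgebra K V) : tSign f (x * y) = tSign f x * tSign f y := by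
  simp [tSign]

@[simp] lemma tSign_one {V : Type u} [AddCommGroup V] [Module K V] (f : V →ₗ[K] V) :
    tSign f (1 : TensorAlgebra K V) = 1 := by
  simp [tSign]

@[simp] lemma tSign_ι {V : Type u} [AddCommGroup V] [Module K V] (f : V →ₗ[K] V) (a : V) :
    tSign f (TensorAlgebra.ι K a) = TensorAlgebra.ι K (f a) := by
  simp [tSign]

variable (A : AInfAlgebra K Γ)

/-- The operation `μ¹`. -/
noncomputable def AInfAlgebra.μ₁ : A.carrier →ₗ[K] A.carrier := A.μ ∘ₗ TensorAlgebra.ι K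

/-- The length-preserving part of the bar differential. -/
noncomputable def AInfAlgebra.b₁ : A.BA →ₗ[K] A.BA := bar A.suspSign (A.μ₁ ∘ₗ TensorAlgebra.ιInv)

lemma μ₁_e : A.μ₁ A.e = 0 := by
  simpa [AInfAlgebra.μ₁] using A.e_zero [] [] (by simp)

lemma μ₁_suspSign (a : A.carrier) : A.μ₁ (A.suspSign a) = -A.suspSign (A.μ₁ a) := by
  simpa [AInfAlgebra.μ₁] using A.μ_map [a]

@[simp] lemma b₁_one : A.b₁ (1 : A.BA) = 0 := by
  have := bar_word A.suspSign (A.μ₁ ∘ₗ TensorAlgebra.ιInv) []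
  have h := ιInv_word_of_length_ne (K := K) (l := ([] : List A.carrier)) (by simp)
  rw [word_nil] at h
  simpa [h, AInfAlgebra.b₁] using this

lemma b₁_ι_mul (a : A.carrier) (x : A.BA) : A.b₁ (TensorAlgebra.ι K a * x)
    = TensorAlgebra.ι K (A.μ₁ a) * x + TensorAlgebra.ι K (A.suspSign a) * A.b₁ x := by
  have : A.b₁ ∘ₗ LinearMap.mulLeft K (TensorAlgebra.ι K a)
      = LinearMap.mulLeft K (TensorAlgebra.ι K (A.μ₁ a))
        + LinearMap.mulLeft K (TensorAlgebra.ι K (A.suspSign a)) ∘ₗ A.b₁ := by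
    refine ext_word fun l => ?_
    have h0 := ιInv_word_of_length_ne (K := K) (l := ([] : List A.carrier)) (by simp)
    have h1 := TensorAlgebra.ι_leftInverse (R := K) a
    simp only [LinearMap.comp_apply, LinearMap.add_apply, LinearMap.mulLeft_apply, ← word_cons]
    rw [AInfAlgebra.b₁, bar_cons, headOp_word, splitSum_cons, splitSum_first]
    · simp only [LinearMap.comp_apply, h0]
      simp [h1]
    · intro u v hu
      have := List.length_pos_iff.2 hu
      rw [LinearMap.comp_apply, ιInv_word_of_length_ne (by simp; omega)]
      simp
  simpa using LinearMap.congr_fun this x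

variable {A} {c : A.carrier →ₗ[K] K}

lemma unitProj_e (he : c A.e = 1) : unitProj c A.e = 0 := by simp [unitProj_apply, he]

lemma unitProj_unitProj (he : c A.e = 1) (a : A.carrier) :
    unitProj c (unitProj c a) = unitProj c a := by simp [unitProj_apply, he]

lemma unitProj_suspSign (hc : ∀ a, c (A.suspSign a) = -c a) (a : A.carrier) :
    unitProj c (A.suspSign a) = A.suspSign (unitProj c a) := by
  simp [unitProj_apply, hc, A.suspSign_e]

lemma unitProj_μ₁ (hμ : ∀ a, c (A.μ₁ a) = 0) (a : A.carrier) :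
    unitProj c (A.μ₁ a) = A.μ₁ (unitProj c a) := by
  simp [unitProj_apply, hμ, μ₁_e]

lemma doubleUnit_tSign (hc : ∀ a, c (A.suspSign a) = -c a) (x : A.BA) :
    doubleUnit c (tSign A.suspSign x) = -tSign A.suspSign (doubleUnit c x) := by
  have : doubleUnit c ∘ₗ tSign A.suspSign = -(tSign A.suspSign ∘ₗ doubleUnit c) := by
    refine ext_word fun l => ?_
    induction l with
    | nil => simp
    | cons a l ih =>
      simp at ih
      simp [tSign_mul, doubleUnit_ι_mul, hc, unitProj_suspSign hc, ih, A.suspSign_e,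
        A.suspSign_suspSign]
      abel
  exact LinearMap.congr_fun this x

/-- The letter replaced by `e|e` contributes `c(μ¹ a) = 0` on one side and `μ¹ e = 0` on the other,
while the projection `π` commutes with `μ¹`. The overall sign is that of the odd functional `c`. -/
lemma doubleUnit_b₁ (hc : ∀ a, c (A.suspSign a) = -c a) (hμ : ∀ a, c (A.μ₁ a) = 0) (x : A.BA) :
    doubleUnit c (A.b₁ x) = -A.b₁ (doubleUnit c x) := by
  have : doubleUnit c ∘ₗ A.b₁ = -(A.b₁ ∘ₗ doubleUnit c) := by
    refine ext_word fun l => ?_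
    induction l with
    | nil => simp
    | cons a l ih =>
      simp at ih
      simp [b₁_ι_mul, mul_assoc, doubleUnit_ι_mul, hc, hμ, unitProj_suspSign hc, unitProj_μ₁ hμ, ih,
        A.suspSign_e, μ₁_e, A.suspSign_suspSign, μ₁_suspSign]
      abel
  exact LinearMap.congr_fun this x

lemma tSign_unitProj_suspSign (hc : ∀ a, c (A.suspSign a) = -c a) (x : A.BA) :
    tSign (unitProj c) (tSign A.suspSign x) = tSign A.suspSign (tSign (unitProj c) x) := by
  have : tSign (unitProj c) ∘ₗ tSign A.suspSign = tSign A.suspSign ∘ₗ tSign (unitProj c) := by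
    refine ext_word fun l => ?_
    simp [tSign_word, Function.comp_def, unitProj_suspSign hc]
  exact LinearMap.congr_fun this x

lemma tSign_unitProj_b₁ (hc : ∀ a, c (A.suspSign a) = -c a) (hμ : ∀ a, c (A.μ₁ a) = 0)
    (x : A.BA) : tSign (unitProj c) (A.b₁ x) = A.b₁ (tSign (unitProj c) x) := by
  have : tSign (unitProj c) ∘ₗ A.b₁ = A.b₁ ∘ₗ tSign (unitProj c) := by
    refine ext_word fun l => ?_
    induction l with
    | nil => simp
    | cons a l ih =>
      simp at ih
      simp [b₁_ι_mul, tSign_mul, unitProj_suspSign hc, unitProj_μ₁ hμ, ih]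
  exact LinearMap.congr_fun this x

lemma tSign_unitProj_idem (he : c A.e = 1) (x : A.BA) :
    tSign (unitProj c) (tSign (unitProj c) x) = tSign (unitProj c) x := by
  have : tSign (unitProj c) ∘ₗ tSign (unitProj c) = tSign (unitProj c) := by
    refine ext_word fun l => ?_
    simp [tSign_word, Function.comp_def, unitProj_unitProj he]
  exact LinearMap.congr_fun this x

variable (Q : RightModule A) (P : LeftModule A)

/-- The length-preserving part of the differential of `Q ⊗_A P`. -/
noncomputable def tensorD₁ :
    Q.carrier ⊗[K] (A.BA ⊗[K] P.carrier) →ₗ[K] Q.carrier ⊗[K] (A.BA ⊗[K] P.carrier) :=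
  (Q.act 1).rTensor _
    + TensorProduct.map Q.signOp
        (A.b₁.rTensor _ + TensorProduct.map (tSign A.suspSign) (P.act 1))

variable {Q P}

lemma tensorD₁_tmul (q : Q.carrier) (x : A.BA) (p : P.carrier) :
    tensorD₁ Q P (q ⊗ₜ (x ⊗ₜ p)) = Q.act 1 q ⊗ₜ (x ⊗ₜ p) + Q.signOp q ⊗ₜ (A.b₁ x ⊗ₜ p)
      + Q.signOp q ⊗ₜ (tSign A.suspSign x ⊗ₜ P.act 1 p) := by
  simp [tensorD₁, TensorProduct.tmul_add, add_assoc]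

lemma tmul_word_mem_tensorF {n : ℤ} (q : Q.carrier) {l : List A.carrier} (p : P.carrier)
    (h : (l.length : ℤ) ≤ n) : q ⊗ₜ (word l ⊗ₜ p) ∈ tensorF Q P n :=
  Submodule.subset_span ⟨q, l, p, h, rfl⟩

lemma map_mem_of_mem_tensorF {M : Type*} [AddCommGroup M] [Module K M]
    {f : Q.carrier ⊗[K] (A.BA ⊗[K] P.carrier) →ₗ[K] M} {S : Submodule K M} {n : ℤ}
    (h : ∀ (q : Q.carrier) (l : List A.carrier) (p : P.carrier), (l.length : ℤ) ≤ n →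
      f (q ⊗ₜ (word l ⊗ₜ p)) ∈ S) {x} (hx : x ∈ tensorF Q P n) : f x ∈ S := by
  have : tensorF Q P n ≤ S.comap f := Submodule.span_le.2 (by
    rintro _ ⟨q, l, p, hl, rfl⟩
    exact h q l p hl)
  exact this hx

lemma tensorF_mono {m n : ℤ} (h : m ≤ n) : tensorF Q P m ≤ tensorF Q P n :=
  Submodule.span_mono (by
    rintro _ ⟨q, l, p, hl, rfl⟩
    exact ⟨q, l, p, hl.trans h, rfl⟩)

lemma tensorF_eq_bot {n : ℤ} (h : n < 0) : tensorF Q P n = ⊥ := by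
  rw [tensorF, Submodule.span_eq_bot]
  rintro _ ⟨q, l, p, hl, rfl⟩
  omega

lemma exists_mem_tensorF (x : Q.carrier ⊗[K] (A.BA ⊗[K] P.carrier)) :
    ∃ n : ℕ, x ∈ tensorF Q P n := by
  have add : ∀ x y : Q.carrier ⊗[K] (A.BA ⊗[K] P.carrier), (∃ n : ℕ, x ∈ tensorF Q P n) →
      (∃ n : ℕ, y ∈ tensorF Q P n) → ∃ n : ℕ, x + y ∈ tensorF Q P n := by
    rintro x y ⟨m, hm⟩ ⟨n, hn⟩
    exact ⟨m + n, Submodule.add_mem _ (tensorF_mono (by simp) hm) (tensorF_mono (by simp) hn)⟩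
  induction x using TensorProduct.induction_on with
  | zero => exact ⟨0, Submodule.zero_mem _⟩
  | add x y hx hy => exact add x y hx hy
  | tmul q y =>
    induction y using TensorProduct.induction_on with
    | zero => exact ⟨0, by simp⟩
    | add x y hx hy =>
      rw [TensorProduct.tmul_add]
      exact add _ _ hx hy
    | tmul z p =>
      have hz : z ∈ Submodule.span K (Set.range (word : List A.carrier → A.BA)) := by
        rw [span_word]
        exact Submodule.mem_top
      induction hz using Submodule.span_induction with
      | mem z hz =>
        obtain ⟨l, rfl⟩ := hz
        exact ⟨l.length, tmul_word_mem_tensorF _ _ le_rfl⟩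
      | zero => exact ⟨0, by simp⟩
      | add x y _ _ hx hy =>
        rw [TensorProduct.add_tmul, TensorProduct.tmul_add]
        exact add _ _ hx hy
      | smul r x _ hx =>
        obtain ⟨n, hn⟩ := hx
        refine ⟨n, ?_⟩
        rw [← TensorProduct.smul_tmul', TensorProduct.tmul_smul]
        exact Submodule.smul_mem _ _ hn

/-- Blocks of one letter make up `b₁`, and blocks of at least two letters shorten the word. -/
lemma b_sub_b₁_mem {M : Type*} [AddCommGroup M] [Module K M] (f : A.BA →ₗ[K] M)
    (S : Submodule K M) (l : List A.carrier)
    (h : ∀ l' : List A.carrier, l'.length < l.length → f (word l') ∈ S) :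
    f (A.b (word l) - A.b₁ (word l)) ∈ S := by
  rw [AInfAlgebra.b, AInfAlgebra.b₁, bar_word, bar_word, ← splitSum_sub]
  simp only [← splitSum_sub, map_splitSum]
  refine splitSum_mem _ fun u w hw => splitSum_mem _ fun v₁ v₂ hv => ?_
  have h0 := ιInv_word_of_length_ne (K := K) (l := ([] : List A.carrier)) (by simp)
  match v₁, hv with
  | [], hv =>
    simp only [LinearMap.comp_apply, h0]
    simp [A.μ_one]
  | [a], hv =>
    have h1 := TensorAlgebra.ι_leftInverse (R := K) a
    simp [AInfAlgebra.μ₁, h1]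
  | a :: b :: v, hv =>
    rw [LinearMap.comp_apply, ιInv_word_of_length_ne (by simp)]
    have := h (u.map A.suspSign ++ A.μ (word (a :: b :: v)) :: v₂) (by
      subst hw hv
      simp)
    simpa [word_append] using this

/-- Every operation that consumes at least one letter of the word in a module action, or at least
two in `μ`, lowers the length. The rest is `tensorD₁`. -/
lemma tensorD_sub_tensorD₁_mem {n : ℤ} {x} (hx : x ∈ tensorF Q P n) :
    tensorD Q P x - tensorD₁ Q P x ∈ tensorF Q P (n - 1) := by
  refine map_mem_of_mem_tensorF (f := tensorD Q P - tensorD₁ Q P) (fun q l p hl => ?_) hx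
  have h1 := splitSum_sub_first_mem (tensorF Q P (n - 1))
    (fun u v => Q.act (word u) q ⊗ₜ[K] ((word v : A.BA) ⊗ₜ[K] p)) l (by
      intro u v huv hu
      have := List.length_pos_iff.2 hu
      refine tmul_word_mem_tensorF _ _ ?_
      subst huv
      simp at hl
      omega)
  have h2 := splitSum_sub_last_mem (tensorF Q P (n - 1))
    (fun u v => Q.signOp q ⊗ₜ[K]
            ((word (u.map A.suspSign) : A.BA) ⊗ₜ[K] P.act (word v) p)) l (by
      intro u v huv hv
      have := List.length_pos_iff.2 hv
      refine tmul_word_mem_tensorF _ _ ?_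
      subst huv
      simp at hl ⊢
      omega)
  have h3 := b_sub_b₁_mem (insertBetween (Q.signOp q) p) (tensorF Q P (n - 1)) l (by
    intro l' h
    exact tmul_word_mem_tensorF _ _ (by omega))
  rw [insertBetween_apply, TensorProduct.sub_tmul, TensorProduct.tmul_sub] at h3
  rw [LinearMap.sub_apply, tensorD_word, tensorD₁_tmul, tSign_word]
  rw [word_nil] at h1 h2
  convert Submodule.add_mem _ (Submodule.add_mem _ h1 h2) h3 using 1
  abel

end Leading

/-! ### Acyclicity of the degenerate subcomplex with control of lengths, and normalization -/

section Filtered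

variable {A : AInfAlgebra K Γ} {Q : RightModule A} {P : LeftModule A} {c : A.carrier →ₗ[K] K}

lemma tensor_ext {M : Type*} [AddCommGroup M] [Module K M]
    {f g : Q.carrier ⊗[K] (A.BA ⊗[K] P.carrier) →ₗ[K] M}
    (h : ∀ q x p, f (q ⊗ₜ (x ⊗ₜ p)) = g (q ⊗ₜ (x ⊗ₜ p))) : f = g := by
  ext q x p
  exact h q x p

lemma act_one_signOp (q : Q.carrier) : Q.act 1 (Q.signOp q) = -Q.signOp (Q.act 1 q) := by
  simpa using Q.act_map [] q

lemma tensorD₁_unitHomotopy (hc : ∀ a, c (A.suspSign a) = -c a) (hμ : ∀ a, c (A.μ₁ a) = 0)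
    (x : Q.carrier ⊗[K] (A.BA ⊗[K] P.carrier)) :
    tensorD₁ Q P (unitHomotopy c Q P x) + unitHomotopy c Q P (tensorD₁ Q P x) = 0 := by
  have : tensorD₁ Q P ∘ₗ unitHomotopy c Q P + unitHomotopy c Q P ∘ₗ tensorD₁ Q P = 0 := by
    refine tensor_ext fun q x p => ?_
    simp [unitHomotopy_tmul, tensorD₁_tmul, Q.signOp_signOp, doubleUnit_tSign hc,
      doubleUnit_b₁ hc hμ, act_one_signOp, TensorProduct.neg_tmul, TensorProduct.tmul_neg]
    abel
  simpa using LinearMap.congr_fun this x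

lemma doubleUnit_word_mem {M : Type*} [AddCommGroup M] [Module K M] (f : A.BA →ₗ[K] M)
    (S : Submodule K M) (l : List A.carrier)
    (h : ∀ l' : List A.carrier, l'.length ≤ l.length + 1 → f (word l') ∈ S) :
    f (doubleUnit c (word l)) ∈ S := by
  induction l generalizing f with
  | nil => simp
  | cons a l ih =>
    rw [word_cons, doubleUnit_ι_mul, map_add, map_smul, ← word_append]
    refine Submodule.add_mem _ (Submodule.smul_mem _ _ (h _ (by simp))) ?_
    refine ih (f ∘ₗ LinearMap.mulLeft K (TensorAlgebra.ι K _)) fun l' h' => ?_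
    rw [LinearMap.comp_apply, LinearMap.mulLeft_apply, ← word_cons]
    exact h _ (by simpa using h')

lemma unitHomotopy_mem_tensorF {n : ℤ} {x} (hx : x ∈ tensorF Q P n) :
    unitHomotopy c Q P x ∈ tensorF Q P (n + 1) := by
  refine map_mem_of_mem_tensorF (fun q l p hl => ?_) hx
  rw [unitHomotopy_tmul]
  refine Submodule.neg_mem _ ?_
  rw [← insertBetween_apply]
  exact doubleUnit_word_mem _ _ _ fun l' h => tmul_word_mem_tensorF _ _ (by omega)

/-- The homotopy raises the length by one, so a priori only `F (n + 1)` is reached. The leading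
parts cancel by `tensorD₁_unitHomotopy`, and the remainder of the differential lowers the length by
one. -/
lemma homotopy_mem_tensorF (hc : ∀ a, c (A.suspSign a) = -c a) (hμ : ∀ a, c (A.μ₁ a) = 0)
    {n : ℤ} {x} (hx : x ∈ tensorF Q P n) :
    tensorD Q P (unitHomotopy c Q P x) + unitHomotopy c Q P (tensorD Q P x)
      ∈ tensorF Q P n := by
  have h1 := tensorD_sub_tensorD₁_mem (unitHomotopy_mem_tensorF (c := c) hx)
  have h2 := unitHomotopy_mem_tensorF (c := c) (tensorD_sub_tensorD₁_mem hx)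
  have h3 := tensorD₁_unitHomotopy hc hμ x
  rw [add_sub_cancel_right] at h1
  rw [sub_add_cancel, map_sub] at h2
  convert Submodule.add_mem _ h1 h2 using 1
  rw [← sub_eq_zero, ← h3]
  abel

/-- A cocycle of `D ∩ F n`, where `D` is the span of the words containing the unit, is the
differential of an element of `D ∩ F (n + 1)`. -/
lemma exists_tensorD_eq (he : c A.e = 1) (hc : ∀ a, c (A.suspSign a) = -c a)
    (hμ : ∀ a, c (A.μ₁ a) = 0) {n : ℤ} {k : ℕ} {x} (hx : x ∈ unitSpan Q P k)
    (hF : x ∈ tensorF Q P n) (hd : tensorD Q P x = 0) :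
    ∃ y ∈ unitSpan Q P k, y ∈ tensorF Q P (n + 1) ∧ tensorD Q P y = x := by
  induction k generalizing x with
  | zero =>
    have : unitSpan Q P 0 = ⊥ := by
      rw [unitSpan, Submodule.span_eq_bot]
      rintro _ ⟨q, u, v, p, h, rfl⟩
      omega
    rw [this, Submodule.mem_bot] at hx
    subst hx
    exact ⟨0, Submodule.zero_mem _, Submodule.zero_mem _, map_zero _⟩
  | succ k ih =>
    -- For closed `x` the error of the homotopy is `x - d h x`. It has its units one place further
    -- left and stays in `F n`, so the bound `n + 1` on the primitive does not deteriorate in the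
    -- induction.
    have h1 := homotopy_unitSpan he hx
    have h2 := homotopy_mem_tensorF hc hμ hF
    rw [hd, map_zero] at h1 h2
    rw [sub_zero] at h1
    rw [add_zero] at h2
    obtain ⟨y, hy, hyF, hyd⟩ := ih h1 (Submodule.sub_mem _ hF h2) (by
      rw [map_sub, tensorD_tensorD, hd, sub_zero])
    refine ⟨y + unitHomotopy c Q P x, Submodule.add_mem _ (unitSpan_mono (Nat.le_succ k) hy)
      (unitHomotopy_mem_unitSpan he hx), Submodule.add_mem _ hyF (unitHomotopy_mem_tensorF hF), ?_⟩
    rw [map_add, hyd, sub_add_cancel]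

variable (Q P) in
/-- The span of the words containing the unit. -/
def degenerate : Submodule K (Q.carrier ⊗[K] (A.BA ⊗[K] P.carrier)) :=
  Submodule.span K {x | ∃ (q : Q.carrier) (u v : List A.carrier) (p : P.carrier),
    q ⊗ₜ (word (u ++ A.e :: v) ⊗ₜ p) = x}

lemma exists_mem_unitSpan {x} (hx : x ∈ degenerate Q P) : ∃ k, x ∈ unitSpan Q P k := by
  induction hx using Submodule.span_induction with
  | mem x hx =>
    obtain ⟨q, u, v, p, rfl⟩ := hx
    exact ⟨u.length + 1, tmul_word_mem_unitSpan _ _ _ (Nat.lt_succ_self _)⟩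
  | zero => exact ⟨0, Submodule.zero_mem _⟩
  | add x y _ _ hx hy =>
    obtain ⟨m, hm⟩ := hx
    obtain ⟨n, hn⟩ := hy
    exact ⟨m + n, Submodule.add_mem _ (unitSpan_mono (by simp) hm) (unitSpan_mono (by simp) hn)⟩
  | smul r x _ hx =>
    obtain ⟨n, hn⟩ := hx
    exact ⟨n, Submodule.smul_mem _ _ hn⟩

lemma unitSpan_le_degenerate (k : ℕ) : unitSpan Q P k ≤ degenerate Q P :=
  Submodule.span_mono (by
    rintro _ ⟨q, u, v, p, -, rfl⟩
    exact ⟨q, u, v, p, rfl⟩)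

lemma tensorD_mem_degenerate {x} (hx : x ∈ degenerate Q P) : tensorD Q P x ∈ degenerate Q P := by
  obtain ⟨k, hk⟩ := exists_mem_unitSpan hx
  exact unitSpan_le_degenerate k (tensorD_mem_unitSpan hk)

/-- The projection of `Q ⊗ BA ⊗ P` induced by `unitProj c`. -/
noncomputable def reduce (c : A.carrier →ₗ[K] K) (Q : RightModule A) (P : LeftModule A) :
    Q.carrier ⊗[K] (A.BA ⊗[K] P.carrier) →ₗ[K] Q.carrier ⊗[K] (A.BA ⊗[K] P.carrier) :=
  ((tSign (unitProj c)).rTensor P.carrier).lTensor Q.carrier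

lemma reduce_tmul (q : Q.carrier) (x : A.BA) (p : P.carrier) :
    reduce c Q P (q ⊗ₜ (x ⊗ₜ p)) = q ⊗ₜ (tSign (unitProj c) x ⊗ₜ p) := rfl

lemma reduce_reduce (he : c A.e = 1) (x) :
    reduce c Q P (reduce c Q P x) = reduce c Q P x := by
  have : reduce c Q P ∘ₗ reduce c Q P = reduce c Q P :=
    tensor_ext fun q x p => by simp [reduce_tmul, tSign_unitProj_idem he]
  exact LinearMap.congr_fun this x

/-- The complement `ker c` of the unit is preserved by `μ¹` but not by the higher products, so
`reduce` commutes only with the length-preserving part of the differential. -/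
lemma reduce_tensorD₁ (hc : ∀ a, c (A.suspSign a) = -c a) (hμ : ∀ a, c (A.μ₁ a) = 0) (x) :
    reduce c Q P (tensorD₁ Q P x) = tensorD₁ Q P (reduce c Q P x) := by
  have : reduce c Q P ∘ₗ tensorD₁ Q P = tensorD₁ Q P ∘ₗ reduce c Q P :=
    tensor_ext fun q x p => by
      simp [reduce_tmul, tensorD₁_tmul, tSign_unitProj_b₁ hc hμ, tSign_unitProj_suspSign hc]
  exact LinearMap.congr_fun this x

lemma reduce_mem_tensorF {n : ℤ} {x} (hx : x ∈ tensorF Q P n) :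
    reduce c Q P x ∈ tensorF Q P n := by
  refine map_mem_of_mem_tensorF (fun q l p hl => ?_) hx
  rw [reduce_tmul, tSign_word]
  exact tmul_word_mem_tensorF _ _ (by simpa using hl)

lemma reduce_of_mem_degenerate (he : c A.e = 1) {x} (hx : x ∈ degenerate Q P) :
    reduce c Q P x = 0 := by
  have : degenerate Q P ≤ LinearMap.ker (reduce c Q P) := Submodule.span_le.2 (by
    rintro _ ⟨q, u, v, p, rfl⟩
    simp [reduce_tmul, tSign_mul, word_append, unitProj_e he])
  exact this hx

lemma word_sub_tSign_mem {M : Type*} [AddCommGroup M] [Module K M] (f : A.BA →ₗ[K] M)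
    (S : Submodule K M) (h : ∀ u v : List A.carrier, f (word (u ++ A.e :: v)) ∈ S)
    (l : List A.carrier) : f (word l - tSign (unitProj c) (word l)) ∈ S := by
  induction l generalizing f with
  | nil => simp
  | cons a l ih =>
    have h1 := ih (f ∘ₗ LinearMap.mulLeft K (TensorAlgebra.ι K (unitProj c a))) (by
      intro u v
      rw [LinearMap.comp_apply, LinearMap.mulLeft_apply, ← word_cons, ← List.cons_append]
      exact h _ v)
    have h2 := S.smul_mem (c a) (h [] l)
    convert Submodule.add_mem _ h1 h2 using 1
    rw [LinearMap.comp_apply, LinearMap.mulLeft_apply, ← map_smul, ← map_add, word_cons, tSign_mul,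
      tSign_ι]
    congr 1
    simp [unitProj_apply, mul_sub, sub_mul]
    abel

/-- Together with `reduce_of_mem_degenerate` this makes `reduce` a projection with kernel
`degenerate Q P`. -/
lemma sub_reduce_mem_degenerate (x) : x - reduce c Q P x ∈ degenerate Q P := by
  obtain ⟨n, hn⟩ := exists_mem_tensorF x
  refine map_mem_of_mem_tensorF (f := LinearMap.id - reduce c Q P) (fun q l p _ => ?_) hn
  have := word_sub_tSign_mem (c := c) (insertBetween q p) (degenerate Q P)
    (fun u v => Submodule.subset_span ⟨q, u, v, p, rfl⟩) l
  simpa [TensorProduct.tmul_sub, TensorProduct.sub_tmul, reduce_tmul] using this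

/-- The reduced part `g` of `f` need not be closed, but its differential is degenerate and lies in
`F (n - 1)`. A degenerate `ε ∈ F n` therefore corrects it, and `x` differs from `g - ε` by a
boundary and a degenerate cocycle, which is itself a boundary. -/
lemma exists_normalize (he : c A.e = 1) (hc : ∀ a, c (A.suspSign a) = -c a)
    (hμ : ∀ a, c (A.μ₁ a) = 0) {n : ℤ} {x y f δ} (hx : tensorD Q P x = 0)
    (hf : f ∈ tensorF Q P n) (hδ : δ ∈ degenerate Q P) (e : x = tensorD Q P y + f + δ) :
    ∃ y', ∃ f' ∈ tensorF Q P n, x = tensorD Q P y' + f' := by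
  set g := reduce c Q P f with hg
  have hgF : g ∈ tensorF Q P n := reduce_mem_tensorF hf
  have hδ' : f - g + δ ∈ degenerate Q P :=
    Submodule.add_mem _ (sub_reduce_mem_degenerate f) hδ
  have e' : tensorD Q P g = -tensorD Q P (f - g + δ) := by
    rw [eq_neg_iff_add_eq_zero, ← map_add, show g + (f - g + δ) = x - tensorD Q P y by
      rw [e]; abel, map_sub, hx, tensorD_tensorD, sub_zero]
  have hgD : tensorD Q P g ∈ degenerate Q P := by
    rw [e']
    exact Submodule.neg_mem _ (tensorD_mem_degenerate hδ')
  have hr := tensorD_sub_tensorD₁_mem hgF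
  -- With `r = d g - d₁ g ∈ F (n - 1)`, one has `r - reduce r = d g`, because `d₁ g` is reduced and
  -- `reduce (d g) = 0`.
  have hgF' : tensorD Q P g ∈ tensorF Q P (n - 1) := by
    have h1 : tensorD₁ Q P g = reduce c Q P (tensorD₁ Q P g) := by
      rw [reduce_tensorD₁ hc hμ, hg, reduce_reduce he]
    have h2 := reduce_of_mem_degenerate he hgD
    have h3 := Submodule.sub_mem _ hr (reduce_mem_tensorF (c := c) hr)
    rw [map_sub, h2, ← h1] at h3
    simpa using h3
  obtain ⟨k, hk⟩ := exists_mem_unitSpan hgD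
  obtain ⟨ε, hε, hεF, hεd⟩ := exists_tensorD_eq he hc hμ hk hgF' (tensorD_tensorD Q P g)
  rw [sub_add_cancel] at hεF
  have hD : f - g + δ + ε ∈ degenerate Q P :=
    Submodule.add_mem _ hδ' (unitSpan_le_degenerate k hε)
  obtain ⟨k', hk'⟩ := exists_mem_unitSpan hD
  -- The length `m` is arbitrary: the primitive `z` is only used inside the boundary term.
  obtain ⟨m, hm⟩ := exists_mem_tensorF (f - g + δ + ε)
  obtain ⟨z, -, -, hz⟩ := exists_tensorD_eq he hc hμ hk' hm (by rw [map_add, hεd, e']; abel)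
  refine ⟨y + z, g - ε, Submodule.sub_mem _ hgF hεF, ?_⟩
  rw [map_add, hz, e]
  abel

/-- If the unit is exact, then so is `Q ⊗_A P`. -/
lemma exists_tensorD_eq_of_unit_exact {a : A.carrier} (ha : A.suspSign a = a) (hae : A.μ₁ a = A.e)
    {x} (hx : tensorD Q P x = 0) : ∃ y, tensorD Q P y = x := by
  -- The shift by one starts the induction at `F (-1) = 0`.
  have key : ∀ n : ℕ, ∀ x ∈ tensorF Q P ((n : ℤ) - 1), tensorD Q P x = 0 →
      ∃ y, tensorD Q P y = x := by
    let k : Q.carrier ⊗[K] (A.BA ⊗[K] P.carrier) →ₗ[K] Q.carrier ⊗[K] (A.BA ⊗[K] P.carrier) :=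
      (Q.act (word [a])).rTensor _
    have hkt : ∀ q y, k (q ⊗ₜ y) = Q.act (word [a]) q ⊗ₜ y := fun _ _ => rfl
    have hkF : ∀ m, ∀ x ∈ tensorF Q P m, k x ∈ tensorF Q P m := fun m x hx =>
      map_mem_of_mem_tensorF (fun q l p hl => tmul_word_mem_tensorF _ _ hl) hx
    -- The module relation for the word `[a]` says that the action of `a` is a homotopy from zero to
    -- the action of `b[a] = [e]`, which up to sign is the identity of `Q`. The other terms of
    -- `tensorD₁` cancel because `a` is even in `sA`, so that its action is odd.
    have hk : ∀ x, tensorD₁ Q P (k x) + k (tensorD₁ Q P x) = x := by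
      intro x
      have : tensorD₁ Q P ∘ₗ k + k ∘ₗ tensorD₁ Q P = LinearMap.id := by
        refine tensor_ext fun q x p => ?_
        have h1 := Q.act_map [a] q
        have h2 := Q.act_rel [a] q
        have h3 : A.b (word [a]) = word [A.e] := by
          have b1 : A.b 1 = 0 := by simpa [A.μ_one] using bar_word A.suspSign A.μ []
          rw [← hae, AInfAlgebra.b, bar_cons, headOp_word, word_nil, b1]
          simp [splitSum_cons, A.μ_one, AInfAlgebra.μ₁]
        rw [h3, Q.act_e, Q.signOp_signOp, splitSum_cons, splitSum_nil, word_nil] at h2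
        rw [List.map_singleton, ha] at h1
        rw [add_neg_eq_zero] at h2
        simp only [LinearMap.add_apply, LinearMap.comp_apply, hkt, tensorD₁_tmul, map_add, h1,
          TensorProduct.neg_tmul, LinearMap.id_apply]
        conv_rhs => rw [← h2, TensorProduct.add_tmul]
        abel
      simpa using LinearMap.congr_fun this x
    intro n
    induction n with
    | zero =>
      intro x hx _
      rw [tensorF_eq_bot (by simp), Submodule.mem_bot] at hx
      exact ⟨0, by simp [hx]⟩
    | succ n ih =>
      intro x hx hd
      have h1 := tensorD_sub_tensorD₁_mem (hkF _ x hx)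
      have h2 := hkF _ _ (tensorD_sub_tensorD₁_mem hx)
      rw [hd, zero_sub, map_neg] at h2
      obtain ⟨y, hy⟩ := ih (x - tensorD Q P (k x)) (by
        have h3 := Submodule.neg_mem _ (Submodule.add_mem _ h1 h2)
        push_cast at h3
        rw [add_sub_cancel_right] at h3
        convert h3 using 1
        nth_rewrite 1 [← hk x]
        abel) (by rw [map_sub, hd, tensorD_tensorD, sub_zero])
      exact ⟨y + k x, by rw [map_add, hy, sub_add_cancel]⟩
  obtain ⟨n, hn⟩ := exists_mem_tensorF x
  exact key (n + 1) x (by simpa using hn) hx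

end Filtered

/-! ### Homogeneous components -/

section Components

open Classical in
/-- The linear map with given restrictions to the homogeneous components. -/
noncomputable def GrSpace.lift (V : GrSpace K Γ) {M : Type*} [AddCommGroup M] [Module K M]
    (f : Γ → V.carrier →ₗ[K] M) : V.carrier →ₗ[K] M :=
  DirectSum.toModule K Γ M (fun g => f g ∘ₗ (V.gr g).subtype) ∘ₗ
    (LinearEquiv.ofBijective (DirectSum.coeLinearMap V.gr) V.internal).symm.toLinearMap

lemma GrSpace.lift_apply (V : GrSpace K Γ) {M : Type*} [AddCommGroup M] [Module K M]
    (f : Γ → V.carrier →ₗ[K] M) {g : Γ} {v : V.carrier} (hv : v ∈ V.gr g) :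
    V.lift f v = f g v := by
  classical
  have : (LinearEquiv.ofBijective (DirectSum.coeLinearMap V.gr) V.internal).symm v
      = DirectSum.lof K Γ (fun g => V.gr g) g ⟨v, hv⟩ := by
    rw [LinearEquiv.symm_apply_eq]
    exact (DirectSum.coeLinearMap_lof V.gr g ⟨v, hv⟩).symm
  rw [lift, LinearMap.comp_apply, LinearEquiv.coe_coe, this, DirectSum.toModule_lof]
  rfl

open Classical in
/-- The projection onto a homogeneous component. -/
noncomputable def GrSpace.proj (V : GrSpace K Γ) (g : Γ) : V.carrier →ₗ[K] V.carrier :=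
  V.lift fun h => if g = h then LinearMap.id else 0

open Classical in
lemma GrSpace.proj_apply (V : GrSpace K Γ) (g : Γ) {h : Γ} {v : V.carrier} (hv : v ∈ V.gr h) :
    V.proj g v = if g = h then v else 0 := by
  rw [proj, V.lift_apply _ hv]
  split_ifs <;> rfl

variable {A : AInfAlgebra K Γ}

lemma μ₁_mem {g : Γ} {a : A.carrier} (ha : a ∈ A.gr g) : A.μ₁ a ∈ A.gr (g + one) := by
  have := A.μ_deg [a] (g - one + 0) (.cons (by
    rw [GrSpace.suspGr, sub_add_cancel]
    exact ha) .nil)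
  rw [GrSpace.suspGr] at this
  simpa [AInfAlgebra.μ₁] using this

/-- A functional that separates `e` from `μ¹(A^{-1})` is normalized and cut down to degree `0`. Only
elements of degree `-1` are mapped there by `μ¹`. As degree `0` of `A` is odd in `sA`, the
functional anticommutes with the sign. -/
lemma exists_counit (h : ∀ a ∈ A.gr (-one), A.μ₁ a ≠ A.e) : ∃ c : A.carrier →ₗ[K] K,
    c A.e = 1 ∧ (∀ a, c (A.suspSign a) = -c a) ∧ ∀ a, c (A.μ₁ a) = 0 := by
  classical
  have he : A.e ∉ (A.gr (-one)).map A.μ₁ := by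
    rintro ⟨a, ha, hae⟩
    exact h a ha hae
  obtain ⟨f, hf, hker⟩ := Submodule.exists_le_ker_of_notMem he
  refine ⟨((f A.e)⁻¹ • f) ∘ₗ A.proj 0, ?_, ?_, ?_⟩
  · simp [A.proj_apply 0 A.e_mem, hf]
  · intro a
    induction a using A.induct with
    | h0 g a ha =>
      have h1 : A.suspSign a ∈ A.gr g := by
        rw [GrSpace.suspSign]
        exact Submodule.neg_mem _ (A.signOp_mem ha)
      rw [LinearMap.comp_apply, LinearMap.comp_apply, A.proj_apply 0 h1, A.proj_apply 0 ha]
      split_ifs with h0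
      · subst h0
        rw [GrSpace.suspSign, LinearMap.neg_apply, A.signOp_apply ha, sgn_zero]
        simp
      · simp
    | ha v w hv hw =>
      simp only [map_add, hv, hw]
      abel
  · intro a
    induction a using A.induct with
    | h0 g a ha =>
      rw [LinearMap.comp_apply, A.proj_apply 0 (μ₁_mem ha)]
      split_ifs with h0
      · have : A.μ₁ a ∈ LinearMap.ker f := hker ⟨a, by
          rwa [← eq_neg_of_add_eq_zero_left h0.symm], rfl⟩
        rw [LinearMap.smul_apply, LinearMap.mem_ker.1 this, smul_zero]
      · simp
    | ha v w hv hw => simp only [map_add, hv, hw, add_zero]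

/-- A class that is represented in `F n` modulo words containing the unit is represented in
`F n`. -/
theorem exists_eq_tensorD_add {Q : RightModule A} {P : LeftModule A} {n : ℤ} {x y f δ}
    (hx : tensorD Q P x = 0) (hf : f ∈ tensorF Q P n) (hδ : δ ∈ degenerate Q P)
    (e : x = tensorD Q P y + f + δ) :
    ∃ y', ∃ f' ∈ tensorF Q P n, x = tensorD Q P y' + f' := by
  -- Either the unit is not exact and a counit `c` exists, or it is exact and the whole complex is
  -- acyclic.
  by_cases h : ∀ a ∈ A.gr (-one), A.μ₁ a ≠ A.e
  · obtain ⟨c, he, hc, hμ⟩ := exists_counit h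
    exact exists_normalize he hc hμ hx hf hδ e
  · push Not at h
    obtain ⟨a, ha, hae⟩ := h
    have hσ : A.suspSign a = a := by
      have h1 : sgn (-one : Γ) = -1 := by
        have := sgn_add (-one : Γ) one
        rw [neg_add_cancel, sgn_zero, sgn_one, mul_neg, mul_one] at this
        rw [this, neg_neg]
      rw [GrSpace.suspSign, LinearMap.neg_apply, A.signOp_apply ha, h1]
      simp
    obtain ⟨z, hz⟩ := exists_tensorD_eq_of_unit_exact hσ hae hx
    exact ⟨z, 0, Submodule.zero_mem _, by rw [hz, add_zero]⟩

/-- Letters equal to the homogeneous element `e` are not decomposed, so `e` persists in every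
summand. This makes the projections to homogeneous components preserve the degenerate subspace. -/
lemma word_mem_span_wordDeg {V : Type u} [AddCommGroup V] [Module K V] {D : Γ → Submodule K V}
    (hD : ⨆ g, D g = ⊤) {e : V} {i : Γ} (he : e ∈ D i) (l : List V) :
    (word l : TensorAlgebra K V) ∈ Submodule.span K {x | ∃ l' g, WordDeg D l' g ∧
      l'.length = l.length ∧ (e ∈ l → e ∈ l') ∧ word l' = x} := by
  induction l with
  | nil => exact Submodule.subset_span ⟨[], 0, .nil, rfl, id, rfl⟩
  | cons a l ih =>
    have step : ∀ g, ∀ a' ∈ D g, (e = a → e = a') → (word (a' :: l) : TensorAlgebra K V) ∈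
        Submodule.span K {x | ∃ l' g, WordDeg D l' g ∧
        l'.length = (a :: l).length ∧ (e ∈ a :: l → e ∈ l') ∧ word l' = x} := by
      intro g a' ha' haa
      rw [word_cons, ← LinearMap.mulLeft_apply (R := K)]
      refine (Submodule.span_le (p := (Submodule.span K _).comap _)).2 ?_ ih
      rintro _ ⟨l', h, hl', hlen, hmem, rfl⟩
      refine Submodule.subset_span ⟨a' :: l', _, .cons ha' hl', by simp [hlen], ?_, word_cons _ _⟩
      intro h
      rcases List.mem_cons.1 h with h | h
      · rw [← haa h]
        exact List.mem_cons_self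
      · exact List.mem_cons_of_mem _ (hmem h)
    by_cases hea : e = a
    · exact step i a (hea ▸ he) id
    · have ha : a ∈ ⨆ g, D g := hD ▸ Submodule.mem_top
      rw [word_cons]
      refine Submodule.iSup_induction D
        (motive := fun a' => TensorAlgebra.ι K a' * word l ∈ Submodule.span K _) ha ?_ (by simp) ?_
      · intro g a' ha'
        rw [← word_cons]
        exact step g a' ha' fun h => absurd h hea
      · intro x y hx hy
        rw [map_add, add_mul]
        exact Submodule.add_mem _ hx hy

variable {Q : RightModule A} {P : LeftModule A}

lemma map_word_mem_of_homogeneous {M : Type*} [AddCommGroup M] [Module K M]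
    (f : Q.carrier ⊗[K] (A.BA ⊗[K] P.carrier) →ₗ[K] M) (S : Submodule K M) (l : List A.carrier)
    (h : ∀ i, ∀ q ∈ Q.gr i, ∀ l' j, WordDeg A.suspGr l' j → l'.length = l.length →
      (A.e ∈ l → A.e ∈ l') → ∀ k, ∀ p ∈ P.gr k, f (q ⊗ₜ (word l' ⊗ₜ p)) ∈ S)
    (q : Q.carrier) (p : P.carrier) : f (q ⊗ₜ (word l ⊗ₜ p)) ∈ S := by
  induction q using Q.induct with
  | ha v w hv hw =>
    rw [TensorProduct.add_tmul, map_add]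
    exact Submodule.add_mem _ hv hw
  | h0 i q hq =>
    induction p using P.induct with
    | ha v w hv hw =>
      rw [TensorProduct.tmul_add, TensorProduct.tmul_add, map_add]
      exact Submodule.add_mem _ hv hw
    | h0 k p hp =>
      have he : A.e ∈ A.suspGr (-one) := by
        rw [GrSpace.suspGr, neg_add_cancel]
        exact A.e_mem
      refine (Submodule.span_le (p := S.comap (f ∘ₗ insertBetween q p))).2 ?_
        (word_mem_span_wordDeg A.iSup_suspGr he l)
      rintro _ ⟨l', j, hl', hlen, hmem, rfl⟩
      exact h i q hq l' j hl' hlen hmem k p hp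

lemma tensor_ext_homogeneous {M : Type*} [AddCommGroup M] [Module K M]
    {f g : Q.carrier ⊗[K] (A.BA ⊗[K] P.carrier) →ₗ[K] M}
    (h : ∀ i, ∀ x ∈ tensorGr Q P i, f x = g x) : f = g := by
  refine tensor_ext fun q x p => ?_
  rw [← sub_eq_zero, ← LinearMap.sub_apply, ← Submodule.mem_bot K]
  refine map_mem_of_words ⊥ ((f - g) ∘ₗ insertBetween q p) (fun l => ?_) x
  refine map_word_mem_of_homogeneous (f - g) ⊥ l (fun i q hq l' j hl' _ _ k p hp => ?_) q p
  rw [Submodule.mem_bot, LinearMap.sub_apply, sub_eq_zero]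
  exact h _ _ (Submodule.subset_span ⟨i, j, k, q, hq, l', hl', p, hp, rfl, rfl⟩)

variable (A) in
/-- The coaction of the group algebra of `Γ` on `BA` that describes the grading. -/
noncomputable def wordCoact : A.BA →ₐ[K] AddMonoidAlgebra A.BA Γ :=
  TensorAlgebra.lift K
    -- Degree `g` in `A` is degree `g - 1` in the shift `sA`.
    (A.lift fun g => AddMonoidAlgebra.lsingle (g - one) ∘ₗ TensorAlgebra.ι K)

lemma wordCoact_word {l : List A.carrier} {g : Γ} (h : WordDeg A.suspGr l g) :
    wordCoact A (word l) = AddMonoidAlgebra.single g (word l) := by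
  induction h with
  | nil => simp [AddMonoidAlgebra.one_def]
  | cons ha _ ih =>
    rw [word_cons, map_mul, ih, wordCoact, TensorAlgebra.lift_ι_apply, A.lift_apply _ ha]
    simp [AddMonoidAlgebra.single_mul_single]

/-- The grading of a tensor product, described by the coactions. -/
noncomputable def tensorCoact {M N : Type*} [AddCommGroup M] [Module K M] [AddCommGroup N]
    [Module K N] (f : M →ₗ[K] Γ →₀ M) (g : N →ₗ[K] Γ →₀ N) : M ⊗[K] N →ₗ[K] Γ →₀ M ⊗[K] N :=
  Finsupp.lmapDomain _ K (fun x : Γ × Γ => x.1 + x.2) ∘ₗ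
    (finsuppTensorFinsupp K K M N Γ Γ).toLinearMap ∘ₗ TensorProduct.map f g

lemma tensorCoact_tmul {M N : Type*} [AddCommGroup M] [Module K M] [AddCommGroup N]
    [Module K N] {f : M →ₗ[K] Γ →₀ M} {g : N →ₗ[K] Γ →₀ N} {m : M} {n : N} {i j : Γ}
    (hm : f m = Finsupp.single i m) (hn : g n = Finsupp.single j n) :
    tensorCoact f g (m ⊗ₜ n) = Finsupp.single (i + j) (m ⊗ₜ n) := by
  simp [tensorCoact, hm, hn, finsuppTensorFinsupp_single, Finsupp.mapDomain_single]

variable (Q P) in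
/-- The projection of `Q ⊗ BA ⊗ P` to the component of degree `g`. -/
noncomputable def tensorProj (g : Γ) :
    Q.carrier ⊗[K] (A.BA ⊗[K] P.carrier) →ₗ[K] Q.carrier ⊗[K] (A.BA ⊗[K] P.carrier) :=
  Finsupp.lapply g ∘ₗ tensorCoact (Q.lift fun i => Finsupp.lsingle i)
    (tensorCoact ((AddMonoidAlgebra.coeffLinearEquiv K).toLinearMap ∘ₗ (wordCoact A).toLinearMap)
      (P.lift fun i => Finsupp.lsingle i))

-- The components `tensorGr` are given only as spans; the coactions provide the projections that
-- show them to be independent.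
open Classical in
lemma tensorProj_apply (g : Γ) {i : Γ} {x} (hx : x ∈ tensorGr Q P i) :
    tensorProj Q P g x = if g = i then x else 0 := by
  have : tensorGr Q P i ≤ LinearMap.eqLocus (tensorProj Q P g)
      (if g = i then LinearMap.id else 0) := by
    refine Submodule.span_le.2 ?_
    rintro _ ⟨a, b, c, q, hq, l, hl, p, hp, rfl, rfl⟩
    have h1 := Q.lift_apply (fun i => Finsupp.lsingle (R := K) i) hq
    have h2 := P.lift_apply (fun i => Finsupp.lsingle (R := K) i) hp
    have h3 : ((AddMonoidAlgebra.coeffLinearEquiv K).toLinearMap ∘ₗ (wordCoact A).toLinearMap)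
        (word l) = Finsupp.single b (word l) := by
      simp [wordCoact_word hl]
    rw [SetLike.mem_coe, LinearMap.mem_eqLocus, tensorProj, LinearMap.comp_apply,
      tensorCoact_tmul h1 (tensorCoact_tmul h3 h2), Finsupp.lapply_apply, Finsupp.single_apply,
      ← add_assoc]
    simp only [eq_comm (b := g)]
    split_ifs <;> rfl
  have := this hx
  rw [LinearMap.mem_eqLocus] at this
  rw [this]
  split_ifs <;> rfl

lemma tensorProj_tensorD (g : Γ) (x) :
    tensorProj Q P (g + one) (tensorD Q P x) = tensorD Q P (tensorProj Q P g x) := by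
  classical
  have : tensorProj Q P (g + one) ∘ₗ tensorD Q P = tensorD Q P ∘ₗ tensorProj Q P g := by
    refine tensor_ext_homogeneous fun i x hx => ?_
    rw [LinearMap.comp_apply, LinearMap.comp_apply, tensorProj_apply _ hx,
      tensorProj_apply _ (tensorD_mem_gr Q P i _ rfl x hx)]
    by_cases h : g = i <;> simp [h]
  exact LinearMap.congr_fun this x

lemma tensorProj_mem_gr (g : Γ) (x) : tensorProj Q P g x ∈ tensorGr Q P g := by
  classical
  have : (tensorGr Q P g).mkQ ∘ₗ tensorProj Q P g = 0 := by
    refine tensor_ext_homogeneous fun i x hx => ?_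
    rw [LinearMap.comp_apply, tensorProj_apply _ hx]
    split_ifs with h
    · subst h
      simpa using hx
    · simp
  simpa using LinearMap.congr_fun this x

lemma tensorProj_mem_F (g : Γ) {n : ℤ} {x} (hx : x ∈ tensorF Q P n) :
    tensorProj Q P g x ∈ tensorF Q P n := by
  classical
  refine map_mem_of_mem_tensorF (fun q l p hl => ?_) hx
  refine map_word_mem_of_homogeneous _ _ l (fun i q hq l' j hl' hlen _ k p hp => ?_) q p
  rw [tensorProj_apply g (Submodule.subset_span ⟨i, j, k, q, hq, l', hl', p, hp, rfl, rfl⟩)]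
  split_ifs
  · exact tmul_word_mem_tensorF _ _ (by rwa [hlen])
  · exact Submodule.zero_mem _

lemma tensorProj_mem_degenerate (g : Γ) {x} (hx : x ∈ degenerate Q P) :
    tensorProj Q P g x ∈ degenerate Q P := by
  classical
  refine (Submodule.span_le (p := (degenerate Q P).comap (tensorProj Q P g))).2 ?_ hx
  rintro _ ⟨q, u, v, p, rfl⟩
  refine map_word_mem_of_homogeneous (tensorProj Q P g) (degenerate Q P) (u ++ A.e :: v)
    (fun i q hq l' j hl' _ hmem k p hp => ?_) q p
  rw [tensorProj_apply g (Submodule.subset_span ⟨i, j, k, q, hq, l', hl', p, hp, rfl, rfl⟩)]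
  split_ifs
  · obtain ⟨u', v', rfl⟩ := List.append_of_mem (hmem (by simp))
    exact Submodule.subset_span ⟨q, u', v', p, rfl⟩
  · exact Submodule.zero_mem _

end Components

/-! ### The graded dual of a right module -/

section Dual

/-- The functionals of degree `g`, which vanish on all components but that of degree `-g`. -/
def GrSpace.dualGr (V : GrSpace K Γ) (g : Γ) : Submodule K (Module.Dual K V.carrier) where
  carrier := {ξ | ∀ i, i + g ≠ 0 → ∀ v ∈ V.gr i, ξ v = 0}
  add_mem' := by
    intro ξ η h1 h2 i hi v hv
    simp [h1 i hi v hv, h2 i hi v hv]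
  zero_mem' := fun _ _ _ _ => rfl
  smul_mem' := by
    intro r ξ h i hi v hv
    simp [h i hi v hv]

/-- The total space of the graded dual. -/
def GrSpace.dualSpace (V : GrSpace K Γ) : Submodule K (Module.Dual K V.carrier) :=
  ⨆ g, V.dualGr g

lemma GrSpace.iSupIndep_dualGr (V : GrSpace K Γ) : iSupIndep V.dualGr := by
  rw [iSupIndep_def]
  intro g
  rw [Submodule.disjoint_def]
  intro ξ h1 h2
  have h3 : ∀ v ∈ V.gr (-g), ξ v = 0 := by
    have : ⨆ j, ⨆ (_ : j ≠ g), V.dualGr j ≤ (V.gr (-g)).dualAnnihilator := by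
      refine iSup₂_le fun j hj η hη => ?_
      rw [Submodule.mem_dualAnnihilator]
      exact fun v hv => hη _ (by rwa [ne_eq, neg_add_eq_zero, eq_comm]) v hv
    exact (Submodule.mem_dualAnnihilator _).1 (this h2)
  ext v
  induction v using V.induct with
  | h0 i v hv =>
    by_cases hi : i + g = 0
    · rw [add_eq_zero_iff_eq_neg] at hi
      subst hi
      exact h3 v hv
    · exact h1 i hi v hv
  | ha v w hv hw => simp_all

open Classical in
lemma isInternal_comap_iSup {M : Type*} [AddCommGroup M] [Module K M]
    {S : Γ → Submodule K M} (h : iSupIndep S) {T : Submodule K M} (hT : T = ⨆ i, S i) :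
    DirectSum.IsInternal fun i => (S i).comap T.subtype := by
  refine (DirectSum.isInternal_submodule_iff_iSupIndep_and_iSup_eq_top _).2 ⟨?_, ?_⟩
  · rw [iSupIndep_def] at h ⊢
    intro i
    rw [Submodule.disjoint_def]
    intro x h1 h2
    refine Subtype.ext ((Submodule.disjoint_def.1 (h i)) x.1 h1 ?_)
    have : ⨆ j, ⨆ (_ : j ≠ i), (S j).comap T.subtype
        ≤ (⨆ j, ⨆ (_ : j ≠ i), S j).comap T.subtype :=
      iSup₂_le fun j hj => Submodule.comap_mono (le_iSup₂_of_le j hj le_rfl)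
    exact this h2
  · refine Submodule.map_injective_of_injective T.subtype_injective ?_
    rw [Submodule.map_iSup, Submodule.map_top, Submodule.range_subtype, hT]
    exact iSup_congr fun i => by
      rw [Submodule.map_comap_subtype, inf_eq_right.2 (le_iSup S i)]

/-- The graded dual. -/
noncomputable def GrSpace.dual (V : GrSpace K Γ) : GrSpace K Γ where
  carrier := V.dualSpace
  gr g := (V.dualGr g).comap V.dualSpace.subtype
  internal := by
    have := isInternal_comap_iSup (T := V.dualSpace) V.iSupIndep_dualGr rfl
    exact this

/-- The inclusion of the graded dual into the dual. -/
noncomputable def GrSpace.dualVal (V : GrSpace K Γ) : V.dual.carrier →ₗ[K] Module.Dual K V.carrier :=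
  V.dualSpace.subtype

lemma GrSpace.dual_ext (V : GrSpace K Γ) {ξ η : V.dual.carrier}
    (h : ∀ v, V.dualVal ξ v = V.dualVal η v) : ξ = η :=
  Subtype.ext (LinearMap.ext h)

variable {A : AInfAlgebra K Γ}

lemma GrSpace.mem_of_word {V : GrSpace K Γ} {M : Type*} [AddCommGroup M] [Module K M]
    {f : A.BA →ₗ[K] V.carrier →ₗ[K] M} {S : Submodule K M}
    (h : ∀ l i, WordDeg A.suspGr l i → ∀ j, ∀ v ∈ V.gr j, f (word l) v ∈ S)
    (x : A.BA) (v : V.carrier) : f x v ∈ S := by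
  induction v using V.induct with
  | ha v w hv hw =>
    rw [map_add]
    exact Submodule.add_mem _ hv hw
  | h0 j v hv =>
    have hx : x ∈ Submodule.span K
        {x : A.BA | ∃ l g, WordDeg A.suspGr l g ∧ word l = x} := by
      rw [span_wordDeg A.iSup_suspGr]
      exact Submodule.mem_top
    refine (Submodule.span_le (p := S.comap (f.flip v))).2 ?_ hx
    rintro _ ⟨l, i, hl, rfl⟩
    exact h l i hl j v hv

/-- A bilinear map with values in the graded dual. -/
noncomputable def GrSpace.dualLift₂ (V : GrSpace K Γ) {M N : Type*} [AddCommGroup M] [Module K M]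
    [AddCommGroup N] [Module K N] (f : M →ₗ[K] N →ₗ[K] Module.Dual K V.carrier)
    (h : ∀ x y, f x y ∈ V.dualSpace) : M →ₗ[K] N →ₗ[K] V.dual.carrier :=
  LinearMap.mk₂ K (fun x y => (⟨f x y, h x y⟩ : V.dualSpace))
    (fun _ _ _ => Subtype.ext (by simp; rfl)) (fun _ _ _ => Subtype.ext (by simp; rfl))
    (fun _ _ _ => Subtype.ext (by simp; rfl)) (fun _ _ _ => Subtype.ext (by simp; rfl))

variable (Q : RightModule A)

/-- The left action on functionals, `(a ξ)(q) = -(-1)^{|q|} ξ(q a)`. -/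
noncomputable def dualAct : A.BA →ₗ[K] Module.Dual K Q.carrier →ₗ[K] Module.Dual K Q.carrier :=
  LinearMap.mk₂ K (fun x ξ => -(ξ ∘ₗ Q.act x ∘ₗ Q.signOp))
    (fun x y ξ => by ext q; simp; abel) (fun r x ξ => by ext q; simp)
    (fun x ξ η => by ext q; simp; abel) (fun r x ξ => by ext q; simp)

lemma dualAct_apply (x : A.BA) (ξ : Module.Dual K Q.carrier) (q : Q.carrier) :
    dualAct Q x ξ q = -ξ (Q.act x (Q.signOp q)) := rfl

lemma dualAct_mem_gr {l : List A.carrier} {g h : Γ} (hl : WordDeg A.suspGr l g)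
    {ξ : Module.Dual K Q.carrier} (hξ : ξ ∈ Q.dualGr h) :
    dualAct Q (word l) ξ ∈ Q.dualGr (g + h + one) := by
  intro i hi q hq
  rw [dualAct_apply, hξ _ ?_ _ (Q.act_deg l g hl i _ (Q.signOp_mem hq)), neg_zero]
  convert hi using 1
  abel

lemma dualAct_mem (x : A.BA) (ξ : Q.dual.carrier) :
    (dualAct Q).compl₂ Q.dualVal x ξ ∈ Q.dualSpace :=
  GrSpace.mem_of_word (V := Q.dual)
    (fun _ _ hl _ _ hv => Submodule.mem_iSup_of_mem _ (dualAct_mem_gr Q hl hv)) x ξ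

/-- The left action on the graded dual. -/
noncomputable def gradedDualAct : A.BA →ₗ[K] Q.dual.carrier →ₗ[K] Q.dual.carrier :=
  Q.dualLift₂ ((dualAct Q).compl₂ Q.dualVal) (dualAct_mem Q)

lemma gradedDualAct_apply (x : A.BA) (ξ : Q.dual.carrier) (q : Q.carrier) :
    Q.dualVal (gradedDualAct Q x ξ) q = -Q.dualVal ξ (Q.act x (Q.signOp q)) := rfl

/-- The graded dual of a right module is a left module. -/
noncomputable def dualModule : LeftModule A where
  toGrSpace := Q.dual
  act := gradedDualAct Q
  act_deg l g hl h ξ hξ := dualAct_mem_gr Q hl hξ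
  act_rel l ξ := by
    refine Q.dual_ext fun q => ?_
    -- Dualizing reverses the order of the two actions, and moving the sign operator between them by
    -- `Q.act_map` gives both terms of the relation the same sign.
    have h1 := congrArg (Q.dualVal ξ) (Q.act_rel l q)
    rw [map_add, map_splitSum, map_zero] at h1
    rw [map_add, map_splitSum, LinearMap.add_apply, splitSum_apply]
    simp only [gradedDualAct_apply, Q.act_map, map_neg, Q.signOp_signOp, neg_neg, splitSum_neg]
    rw [← neg_add, h1, neg_zero, map_zero, LinearMap.zero_apply]
  act_e ξ := by
    refine Q.dual_ext fun q => ?_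
    rw [gradedDualAct_apply, Q.act_e, Q.signOp_signOp, map_neg, neg_neg]
  act_e_zero l l' h ξ := by
    refine Q.dual_ext fun q => ?_
    rw [gradedDualAct_apply, Q.act_e_zero l l' h, map_zero, neg_zero, map_zero,
      LinearMap.zero_apply]

/-- The functional given by an element of the dual module. -/
noncomputable def dualEval : (dualModule Q).carrier →ₗ[K] Module.Dual K Q.carrier := Q.dualVal

lemma dualEval_ext {ξ η : (dualModule Q).carrier} (h : ∀ q, dualEval Q ξ q = dualEval Q η q) :
    ξ = η := Q.dual_ext h

lemma dualEval_act (x : A.BA) (ξ : (dualModule Q).carrier) (q : Q.carrier) :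
    dualEval Q ((dualModule Q).act x ξ) q = -dualEval Q ξ (Q.act x (Q.signOp q)) := rfl

variable (P : LeftModule A)

/-- The functional on `Q ⊗ BA ⊗ P` adjoint to a map `BA ⊗ P → Q^∨`. -/
noncomputable def uncurry (ψ : A.BA →ₗ[K] P.carrier →ₗ[K] (dualModule Q).carrier) :
    Module.Dual K (Q.carrier ⊗[K] (A.BA ⊗[K] P.carrier)) :=
  TensorProduct.lift (dualEval Q ∘ₗ TensorProduct.lift ψ).flip

lemma uncurry_tmul (ψ : A.BA →ₗ[K] P.carrier →ₗ[K] (dualModule Q).carrier)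
    (q : Q.carrier) (x : A.BA) (p : P.carrier) :
    uncurry Q P ψ (q ⊗ₜ (x ⊗ₜ p)) = dualEval Q (ψ x p) q := rfl

/-- The sign in the dual action turns the term `-(-1)^k μ_N(1 ⊗ ψ)` into one with coefficient
`(-1)^k`. -/
lemma uncurry_homD (s : ℤˣ) (ψ : A.BA →ₗ[K] P.carrier →ₗ[K] (dualModule Q).carrier)
    (q : Q.carrier) (l : List A.carrier) (p : P.carrier) :
    uncurry Q P (homD P (dualModule Q) s ψ) (q ⊗ₜ (word l ⊗ₜ p))
      = splitSum (fun u v =>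
          uncurry Q P ψ (q ⊗ₜ (word (u.map A.suspSign) ⊗ₜ P.act (word v) p))) l
        + uncurry Q P ψ (q ⊗ₜ (A.b (word l) ⊗ₜ p))
        + (s : ℤ) • splitSum (fun u v => uncurry Q P ψ
            (Q.act (twist A s (word u)) (Q.signOp q) ⊗ₜ (word v ⊗ₜ p))) l := by
  simp only [uncurry_tmul]
  rw [homD_word, map_sub, map_add, map_zsmul, map_splitSum, map_splitSum]
  simp only [LinearMap.sub_apply, LinearMap.add_apply, LinearMap.smul_apply, splitSum_apply,
    dualEval_act, splitSum_neg, smul_neg, sub_neg_eq_add]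

/-- For maps of even degree the differential of Hom is the transpose of `tensorD` preceded by the
sign of `Q`. For odd degree the sign comes after `tensorD`, see `uncurry_homD_neg_one`. -/
lemma uncurry_homD_one (ψ : A.BA →ₗ[K] P.carrier →ₗ[K] (dualModule Q).carrier) (x) :
    uncurry Q P (homD P (dualModule Q) 1 ψ) x
      = uncurry Q P ψ (tensorD Q P (Q.signOp.rTensor _ x)) := by
  have : uncurry Q P (homD P (dualModule Q) 1 ψ)
      = uncurry Q P ψ ∘ₗ tensorD Q P ∘ₗ Q.signOp.rTensor _ := by
    refine ext_tensor Q P fun q l p => ?_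
    rw [uncurry_homD, LinearMap.comp_apply, LinearMap.comp_apply,
      LinearMap.rTensor_tmul, tensorD_word, map_add, map_add, map_splitSum, map_splitSum]
    simp only [Q.signOp_signOp, twist_one, Units.val_one, one_smul]
    abel
  exact LinearMap.congr_fun this x

lemma uncurry_homD_neg_one (ψ : A.BA →ₗ[K] P.carrier →ₗ[K] (dualModule Q).carrier) (x) :
    uncurry Q P (homD P (dualModule Q) (-1) ψ) x
      = uncurry Q P ψ (Q.signOp.rTensor _ (tensorD Q P x)) := by
  have : uncurry Q P (homD P (dualModule Q) (-1) ψ)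
      = uncurry Q P ψ ∘ₗ Q.signOp.rTensor _ ∘ₗ tensorD Q P := by
    refine ext_tensor Q P fun q l p => ?_
    rw [uncurry_homD, LinearMap.comp_apply, LinearMap.comp_apply,
      tensorD_word, map_add, map_add, map_add, map_add, map_splitSum, map_splitSum, map_splitSum,
      map_splitSum]
    simp only [LinearMap.rTensor_tmul, Q.signOp_signOp, twist_neg_one, Units.val_neg,
      Units.val_one, neg_smul, one_smul, tSign_word, Q.act_map, TensorProduct.neg_tmul,
      map_neg, splitSum_neg, neg_neg]
    abel
  exact LinearMap.congr_fun this x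

/-- The map `BA ⊗ P → Dual Q` adjoint to a functional on `Q ⊗ BA ⊗ P`. -/
noncomputable def curryAux (Φ : Module.Dual K (Q.carrier ⊗[K] (A.BA ⊗[K] P.carrier))) :
    A.BA →ₗ[K] P.carrier →ₗ[K] Module.Dual K Q.carrier :=
  TensorProduct.curry (TensorProduct.curry Φ).flip

lemma curryAux_apply (Φ : Module.Dual K (Q.carrier ⊗[K] (A.BA ⊗[K] P.carrier)))
    (x : A.BA) (p : P.carrier) (q : Q.carrier) : curryAux Q P Φ x p q = Φ (q ⊗ₜ (x ⊗ₜ p)) := rfl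

variable {Q P} {Φ : Module.Dual K (Q.carrier ⊗[K] (A.BA ⊗[K] P.carrier))} {g : Γ}

lemma curryAux_mem_gr (hΦ : ∀ i, i ≠ g → ∀ x ∈ tensorGr Q P i, Φ x = 0)
    {l : List A.carrier} {i j : Γ} (hl : WordDeg A.suspGr l i) {p : P.carrier}
    (hp : p ∈ P.gr j) : curryAux Q P Φ (word l) p ∈ Q.dualGr (-g + i + j) := by
  intro k hk q hq
  rw [curryAux_apply]
  refine hΦ (k + i + j) ?_ _ (Submodule.subset_span ⟨k, i, j, q, hq, l, hl, p, hp, rfl, rfl⟩)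
  rintro rfl
  exact hk (by abel)

variable (hΦ : ∀ i, i ≠ g → ∀ x ∈ tensorGr Q P i, Φ x = 0)

/-- The map `BA ⊗ P → Q^∨` adjoint to a homogeneous functional on `Q ⊗ BA ⊗ P`. -/
noncomputable def curryDual : A.BA →ₗ[K] P.carrier →ₗ[K] (dualModule Q).carrier :=
  Q.dualLift₂ (curryAux Q P Φ) (GrSpace.mem_of_word
    fun _ _ hl _ _ hp => Submodule.mem_iSup_of_mem _ (curryAux_mem_gr hΦ hl hp))

lemma uncurry_curryDual : uncurry Q P (curryDual hΦ) = Φ :=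
  ext_tensor Q P fun _ _ _ => rfl

/-- Strict unitality of the adjoint map is the vanishing of the functional on degenerate tensors. A
functional supported in degree `g` has degree `-g`. -/
lemma curryDual_mem_gr (hD : ∀ x ∈ degenerate Q P, Φ x = 0) :
    curryDual hΦ ∈ homGr P (dualModule Q) (-g) :=
  ⟨fun _ _ hl _ _ hp => curryAux_mem_gr hΦ hl hp, fun l l' p => dualEval_ext Q fun q =>
    hD _ (Submodule.subset_span ⟨q, l, l', p, rfl⟩)⟩

/-- The index is `-(n + 1)` because the filtration of Hom at index `m` requires vanishing on lengths
strictly less than `-m`. -/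
lemma curryDual_mem_F {n : ℤ} (hF : ∀ x ∈ tensorF Q P n, Φ x = 0) :
    curryDual hΦ ∈ homF P (dualModule Q) (-(n + 1)) := by
  intro l hl
  refine LinearMap.ext fun p => dualEval_ext Q fun q => ?_
  exact hF _ (tmul_word_mem_tensorF _ _ (by omega))

lemma uncurry_injective {φ ψ : A.BA →ₗ[K] P.carrier →ₗ[K] (dualModule Q).carrier}
    (h : uncurry Q P φ = uncurry Q P ψ) : φ = ψ := by
  refine LinearMap.ext fun x => LinearMap.ext fun p => dualEval_ext Q fun q => ?_
  exact LinearMap.congr_fun h (q ⊗ₜ (x ⊗ₜ p))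

end Dual

/-! ### Comparison of the lengths -/

section Comparison

variable {A : AInfAlgebra K Γ} {Q : RightModule A} {P : LeftModule A}

lemma rTensor_signOp_signOp (x : Q.carrier ⊗[K] (A.BA ⊗[K] P.carrier)) :
    Q.signOp.rTensor _ (Q.signOp.rTensor _ x) = x := by
  have : Q.signOp.rTensor (A.BA ⊗[K] P.carrier) ∘ₗ Q.signOp.rTensor _ = LinearMap.id :=
    tensor_ext fun q x p => by simp [Q.signOp_signOp]
  exact LinearMap.congr_fun this x

lemma uncurry_zero : uncurry Q P 0 = 0 := by
  refine ext_tensor Q P fun q l p => ?_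
  rw [uncurry_tmul]
  simp

lemma signOp_rTensor_mem_gr {i : Γ} {x} (hx : x ∈ tensorGr Q P i) :
    Q.signOp.rTensor _ x ∈ tensorGr Q P i := by
  refine (Submodule.span_le (p := (tensorGr Q P i).comap (Q.signOp.rTensor _))).2 ?_ hx
  rintro _ ⟨a, b, c, q, hq, l, hl, p, hp, h, rfl⟩
  exact Submodule.subset_span ⟨a, b, c, _, Q.signOp_mem hq, l, hl, p, hp, h, rfl⟩

lemma signOp_rTensor_mem_F {n : ℤ} {x} (hx : x ∈ tensorF Q P n) :
    Q.signOp.rTensor _ x ∈ tensorF Q P n :=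
  map_mem_of_mem_tensorF (fun _ _ _ hl => tmul_word_mem_tensorF _ _ hl) hx

lemma signOp_rTensor_mem_degenerate {x} (hx : x ∈ degenerate Q P) :
    Q.signOp.rTensor _ x ∈ degenerate Q P := by
  refine (Submodule.span_le (p := (degenerate Q P).comap (Q.signOp.rTensor _))).2 ?_ hx
  rintro _ ⟨q, u, v, p, rfl⟩
  exact Submodule.subset_span ⟨_, u, v, p, rfl⟩

/-- If the cocycles of `Hom_A(P, Q^∨)` that vanish on words of length at most `n` are coboundaries,
then a homogeneous closed functional on `Q ⊗_A P` vanishing on `F n` and on the words containing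
the unit vanishes on the cocycles. -/
lemma functional_apply_eq_zero {n : ℤ}
    (h : ∀ g, ∀ φ ∈ homGr P (dualModule Q) (g + one), φ ∈ homF P (dualModule Q) (-(n + 1)) →
      homD P (dualModule Q) (sgn (g + one)) φ = 0 → ∃ ψ, homD P (dualModule Q) (sgn g) ψ = φ)
    {Φ : Module.Dual K (Q.carrier ⊗[K] (A.BA ⊗[K] P.carrier))} {g : Γ}
    (hΦ : ∀ i, i ≠ g → ∀ x ∈ tensorGr Q P i, Φ x = 0) (hF : ∀ x ∈ tensorF Q P n, Φ x = 0)
    (hD : ∀ x ∈ degenerate Q P, Φ x = 0) (hd : ∀ x, Φ (tensorD Q P x) = 0)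
    {x} (hx : tensorD Q P x = 0) : Φ x = 0 := by
  -- The map adjoint to `Φ` has degree `-g`, so a primitive has degree `-g - 1` and the opposite
  -- parity.
  specialize h (-g - one)
  rw [sub_add_cancel] at h
  have hs : sgn (-g - one) = -sgn (-g) := by
    have := sgn_add (-g - one) one
    rw [sub_add_cancel, sgn_one, mul_neg, mul_one] at this
    rw [this, neg_neg]
  rcases Int.units_eq_one_or (sgn (-g)) with hg | hg
  · rw [hs, hg] at h
    obtain ⟨ψ, hψ⟩ := h (curryDual hΦ) (curryDual_mem_gr hΦ hD) (curryDual_mem_F hΦ hF)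
      (uncurry_injective (LinearMap.ext fun y => by
        rw [uncurry_homD_one, uncurry_curryDual, hd, uncurry_zero,
          LinearMap.zero_apply]))
    have := uncurry_homD_neg_one Q P ψ x
    rw [hψ, uncurry_curryDual, hx, map_zero, map_zero] at this
    exact this
  -- In odd degree the sign of `Q` stands between the functional and `tensorD`. It has to be
  -- composed with `Φ` for the adjoint map to be closed.
  · have hΦ' : ∀ i, i ≠ g → ∀ x ∈ tensorGr Q P i, (Φ ∘ₗ Q.signOp.rTensor _) x = 0 :=
      fun i hi x hx => hΦ i hi _ (signOp_rTensor_mem_gr hx)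
    rw [hs, hg, neg_neg] at h
    obtain ⟨ψ, hψ⟩ := h (curryDual hΦ')
      (curryDual_mem_gr hΦ' fun x hx => hD _ (signOp_rTensor_mem_degenerate hx))
      (curryDual_mem_F hΦ' fun x hx => hF _ (signOp_rTensor_mem_F hx))
      (uncurry_injective (LinearMap.ext fun y => by
        rw [uncurry_homD_neg_one, uncurry_curryDual, LinearMap.comp_apply, rTensor_signOp_signOp, hd,
          uncurry_zero, LinearMap.zero_apply]))
    have := uncurry_homD_one Q P ψ (Q.signOp.rTensor _ x)
    rw [hψ, uncurry_curryDual, rTensor_signOp_signOp, hx, map_zero, LinearMap.comp_apply,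
      rTensor_signOp_signOp] at this
    exact this

/-- Over a field, a vector belongs to a subspace as soon as every functional that kills the subspace
kills the vector. This turns the vanishing of classes in Hom into a representation of `x` modulo
boundaries, `F n` and degenerate tensors; normalization then removes the last. -/
lemma exists_homogeneous_representative {n : ℤ}
    (h : ∀ g, ∀ φ ∈ homGr P (dualModule Q) (g + one), φ ∈ homF P (dualModule Q) (-(n + 1)) →
      homD P (dualModule Q) (sgn (g + one)) φ = 0 → ∃ ψ, homD P (dualModule Q) (sgn g) ψ = φ)
    {g : Γ} {x} (hg : x ∈ tensorGr Q P (g + one)) (hx : tensorD Q P x = 0) :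
    ∃ y ∈ tensorGr Q P g, ∃ f ∈ tensorF Q P n, x = tensorD Q P y + f := by
  classical
  have key : x ∈ LinearMap.range (tensorD Q P) ⊔ tensorF Q P n ⊔ degenerate Q P := by
    by_contra hn
    obtain ⟨Φ, hΦx, hΦ⟩ := Submodule.exists_le_ker_of_notMem hn
    have hxx : tensorProj Q P (g + one) x = x := by rw [tensorProj_apply _ hg, if_pos rfl]
    -- The separating functional is made homogeneous by composition with `tensorProj`, which fixes
    -- `x` and preserves boundaries, `F n` and degenerate tensors.
    refine hΦx ?_
    rw [← hxx, ← LinearMap.comp_apply]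
    refine functional_apply_eq_zero h (g := g + one) ?_ ?_ ?_ ?_ hx
    · intro i hi y hy
      rw [LinearMap.comp_apply, tensorProj_apply _ hy, if_neg hi.symm, map_zero]
    · intro y hy
      exact hΦ ((le_sup_right.trans le_sup_left : tensorF Q P n ≤ _) (tensorProj_mem_F _ hy))
    · intro y hy
      exact hΦ ((le_sup_right : degenerate Q P ≤ _) (tensorProj_mem_degenerate _ hy))
    · intro y
      rw [LinearMap.comp_apply, tensorProj_tensorD]
      exact hΦ ((le_sup_left.trans le_sup_left : LinearMap.range (tensorD Q P) ≤ _) ⟨_, rfl⟩)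
  obtain ⟨_, h1, δ, hδ, rfl⟩ := Submodule.mem_sup.1 key
  obtain ⟨_, ⟨y, rfl⟩, f, hf, rfl⟩ := Submodule.mem_sup.1 h1
  obtain ⟨y', f', hf', e⟩ := exists_eq_tensorD_add hx hf hδ rfl
  have hxx := tensorProj_apply (g + one) hg
  rw [if_pos rfl] at hxx
  -- Normalization does not preserve homogeneity, which is restored by projecting the resulting
  -- identity.
  refine ⟨tensorProj Q P g y', tensorProj_mem_gr _ _, tensorProj Q P (g + one) f',
    tensorProj_mem_F _ hf', ?_⟩
  rw [← tensorProj_tensorD, ← map_add, ← e, hxx]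

end Comparison

/-! ### From vanishing of filtered cohomology to bounds on lengths -/

section Lengths

namespace FilteredComplex

variable (C : FilteredComplex K Γ)

lemma filtCohomology_eq_bot_iff (n : ℤ) (g : Γ) : C.filtCohomology n g = ⊥ ↔
    ∀ x ∈ C.cocycles g, x ∈ C.F n g → x ∈ C.boundaries g := by
  rw [filtCohomology, ← le_bot_iff, Submodule.map_le_iff_le_comap, Submodule.comap_bot,
    Submodule.ker_mkQ]
  exact ⟨fun h x hx hF => h (show (⟨x, hx⟩ : C.cocycles g) ∈ _ from hF),
    fun h x hx => h x.1 x.2 hx⟩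

lemma filtCohomology_eq_top {n : ℤ} {g : Γ}
    (h : ∀ x ∈ C.cocycles g, ∃ f ∈ C.F n g, x - f ∈ C.boundaries g) :
    C.filtCohomology n g = ⊤ := by
  rw [eq_top_iff]
  rintro x -
  obtain ⟨⟨x, hx⟩, rfl⟩ := Submodule.mkQ_surjective _ x
  obtain ⟨f, hf, hxf⟩ := h x hx
  have hb : C.boundaries g ≤ C.cocycles g := by
    rintro _ ⟨y, rfl⟩
    exact C.d_d _ _ _ _ _ y
  have hfc : f ∈ C.cocycles g := by
    have := Submodule.sub_mem _ hx (hb hxf)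
    rwa [sub_sub_cancel] at this
  refine ⟨⟨f, hfc⟩, hf, ?_⟩
  rw [Submodule.mkQ_apply, Submodule.mkQ_apply, eq_comm, Submodule.Quotient.eq]
  exact hxf

/-- Here `ℓ₋ ≤ -n`, hence `|ℓ₋| ≥ n`; the value `ℓ₋ = -∞` has absolute value `∞`. -/
lemma le_length {n : ℕ} {g : Γ} (h : C.filtCohomology (-(n : ℤ)) g ≠ ⊥) :
    (n : ENNReal) ≤ C.length := by
  have hne : ¬ ∀ g, Subsingleton (C.cohomology g) := by
    intro hs
    have := hs g
    exact h (Subsingleton.elim _ _)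
  rw [length, if_neg hne]
  refine le_trans ?_ (le_max_right _ _)
  have hle : C.lowerLength ≤ ((-(n : ℝ) : ℝ) : EReal) :=
    sInf_le ⟨-(n : ℤ), ⟨g, h⟩, by push_cast; rfl⟩
  generalize C.lowerLength = y at hle
  induction y with
  | bot => simp
  | top => exact absurd hle (not_le.2 (EReal.coe_lt_top _))
  | coe r =>
    rw [EReal.coe_le_coe_iff] at hle
    rw [EReal.abs_def, ← ENNReal.ofReal_natCast]
    exact ENNReal.ofReal_le_ofReal (by linarith [neg_le_abs r])

/-- If the cohomology is nonzero, both infima range over nonnegative integers, and `n` occurs in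
both: `H_n = H` is also nonzero. -/
lemma length_le {n : ℕ} (h0 : ∀ m < 0, ∀ g, C.F m g = ⊥)
    (h : ∀ g, C.filtCohomology n g = ⊤) : C.length ≤ n := by
  rw [length]
  split_ifs with hs
  · exact zero_le
  push Not at hs
  obtain ⟨g, hg⟩ := hs
  have hbot : ∀ m < 0, ∀ g, C.filtCohomology m g = ⊥ := by
    intro m hm g
    rw [filtCohomology_eq_bot_iff, h0 m hm]
    rintro x - hx
    rw [(Submodule.mem_bot K).1 hx]
    exact Submodule.zero_mem _
  have hbt : (⊥ : Submodule K (C.cohomology g)) ≠ ⊤ := bot_ne_top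
  have abs_le : ∀ y : EReal, 0 ≤ y → y ≤ ((n : ℝ) : EReal) → y.abs ≤ n := by
    intro y hy0 hyn
    induction y with
    | bot => exact absurd hy0 (not_le.2 EReal.bot_lt_zero)
    | top => exact absurd hyn (not_le.2 (EReal.coe_lt_top _))
    | coe r =>
      rw [EReal.coe_le_coe_iff] at hyn
      rw [EReal.coe_nonneg] at hy0
      rw [EReal.abs_def, ← ENNReal.ofReal_natCast, abs_of_nonneg hy0]
      exact ENNReal.ofReal_le_ofReal hyn
  refine max_le (abs_le _ (le_sInf ?_) (sInf_le ⟨n, h, by simp⟩))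
    (abs_le _ (le_sInf ?_) (sInf_le ⟨n, ⟨g, by rw [h]; exact hbt.symm⟩, by simp⟩))
  · rintro _ ⟨m, hm, rfl⟩
    rw [EReal.coe_nonneg, Int.cast_nonneg_iff]
    by_contra hlt
    exact hbt ((hbot m (by omega) g).symm.trans (hm g))
  · rintro _ ⟨m, ⟨g', hm⟩, rfl⟩
    rw [EReal.coe_nonneg, Int.cast_nonneg_iff]
    by_contra hlt
    exact hm (hbot m (by omega) g')

end FilteredComplex

variable {A : AInfAlgebra K Γ}

lemma tensorComplex_length_le {P : LeftModule A} {n : ℕ}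
    (h : ∀ (N : LeftModule A) (g : Γ),
      (homComplex P N).filtCohomology (-((n + 1 : ℕ) : ℤ)) g = ⊥) (Q : RightModule A) :
    (tensorComplex Q P).length ≤ n := by
  have h' : ∀ g, ∀ φ ∈ homGr P (dualModule Q) (g + one),
      φ ∈ homF P (dualModule Q) (-((n : ℤ) + 1)) →
      homD P (dualModule Q) (sgn (g + one)) φ = 0 →
      ∃ ψ, homD P (dualModule Q) (sgn g) ψ = φ := by
    intro g φ hφ hF hd
    have := ((homComplex P (dualModule Q)).filtCohomology_eq_bot_iff _ (g + one)).1
      (h (dualModule Q) (g + one)) ⟨φ, hφ⟩ (LinearMap.mem_ker.2 (Subtype.ext hd)) (by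
        push_cast
        exact hF)
    obtain ⟨⟨ψ, hψ⟩, e⟩ := this
    refine ⟨ψ, ?_⟩
    -- Coboundaries of degree `g + 1` are defined as images from degree `(g + 1) - 1`.
    have e' : homD P (dualModule Q) (sgn (g + one - one)) ψ = φ := congrArg Subtype.val e
    rwa [add_sub_cancel_right] at e'
  refine FilteredComplex.length_le _ ?_ ?_
  · intro m hm g
    change (tensorF Q P m).comap _ = ⊥
    rw [tensorF_eq_bot hm, Submodule.comap_bot, Submodule.ker_subtype]
  · intro g
    refine FilteredComplex.filtCohomology_eq_top _ ?_
    rintro ⟨x, hx⟩ hd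
    have hd₀ : (tensorComplex Q P).d g (g + one) rfl ⟨x, hx⟩ = 0 := hd
    have hd' : tensorD Q P x = 0 := congrArg Subtype.val hd₀
    have hx' : x ∈ tensorGr Q P (g - one + one) := by rwa [sub_add_cancel]
    obtain ⟨y, hy, f, hf, e⟩ := exists_homogeneous_representative h' hx' hd'
    have hfg : f ∈ tensorGr Q P g := by
      rw [show f = x - tensorD Q P y by rw [e]; abel]
      exact Submodule.sub_mem _ hx (tensorD_mem_gr Q P _ _ (sub_add_cancel g one) y hy)
    exact ⟨⟨f, hfg⟩, hf, ⟨y, hy⟩, Subtype.ext (show tensorD Q P y = x - f by rw [e]; abel)⟩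

end Lengths
end Main
end AInfinity

theorem mainTheorem7 {K : Type u} [Field K] {Γ : Type w} [AddCommGroup Γ]
    [AInfinity.ParityGrading Γ] (A : AInfinity.AInfAlgebra K Γ) (P : AInfinity.LeftModule A) :
    AInfinity.tensorLength P ≤ AInfinity.homLength P := by
  by_cases htop : AInfinity.homLength P = ⊤
  · rw [htop]
    exact le_top
  obtain ⟨r, hr⟩ : ∃ r : NNReal, (r : ENNReal) = AInfinity.homLength P :=
    ⟨_, ENNReal.coe_toNNReal htop⟩
  -- A nonzero class in `H(Hom_A(P, N))` at index `-(⌊r⌋ + 1)` would force the length of `Hom_A(P,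
  -- _)` to be at least `⌊r⌋ + 1 > r`.
  refine iSup_le fun Q => le_trans (AInfinity.tensorComplex_length_le (n := ⌊r⌋₊) ?_ Q) ?_
  · intro N g
    by_contra hne
    have h1 := ((AInfinity.homComplex P N).le_length hne).trans
      (le_iSup (fun N => (AInfinity.homComplex P N).length) N)
    change _ ≤ AInfinity.homLength P at h1
    rw [← hr, ← ENNReal.coe_natCast, ENNReal.coe_le_coe] at h1
    exact absurd (Nat.lt_floor_add_one r) (not_lt.2 (by exact_mod_cast h1))
  · rw [← hr, ← ENNReal.coe_natCast, ENNReal.coe_le_coe]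
    exact Nat.floor_le (zero_le)
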